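/- **Model.** For groups $s=1,2,\dots$ of deterministic sizes $n_s\ge 3$ let $y_s=\lambda G_sy_s+X_s\beta+\varepsilon_s$ a.s., where $G_s\in\{0,1\}^{n_s\times n_s}$ is an unobserved adjacency matrix with zero diagonal (undirected: $G_s=G_s'$ a.s.), $I_s-\lambda G_s$ is a.s. invertible, $X_s$ is an $n_s\times K$ random matrix, $\beta\in\mathbb R^K$, and $H_s\in\{0,1\}^{n_s\times n_s}$ (zero diagonal) is a single unsymmetrized noisy measure of $G_s$. The tuples $(G_s,H_s,X_s,\varepsilon_s)$ are independent across $s$, not necessarily identically distributed. Let $p=(p_0,p_1)'$, $\theta=(\lambda,\beta')'$, and for every group assume (A1) $E(H_{ij}|G,X)=E(H_{ij}|G_{ij},X)$ for all $i,j$; (A2) $E(H_{ij}|G_{ij}=1,X)=1-p_1$ and $E(H_{ij}|G_{ij}=0,X)=p_0$ for all $i\ne j$, and $p_0+p_1<1$; (A3) $E(\varepsilon|G,X,H)=0$ ($\varepsilon$ integrable); (A4) conditionally on $(G,X)$, $H_{ij}$ and $H_{kl}$ are independent whenever $(i,j)\ne(k,l)$. With $\iota_s$ the vector of ones put $W_s(p)=\frac{H_s-p_0(\iota_s\iota_s'-I_s)}{1-p_0-p_1}$,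 $R_s(p)=(W_s(p)y_s,X_s)$, $Z_s=(H_s'X_s,X_s)$, $v_s=\varepsilon_s+\lambda(G_s-W_s(p))y_s$. **First step.** Let $\phi_{s,ij}=\phi_{ij}(X_s)\in\{0,1\}$ be measurable. For $i>j$ let $H^{(1)}_{s,\{i,j\}}=H_{s,ij}$, $H^{(2)}_{s,\{i,j\}}=H_{s,ji}$, $H^{(3)}_{s,\{i,j\}}=\max\{H_{s,ij},H_{s,ji}\}$, $H^{(0)}_{s,\{i,j\}}=1$. Let $\upsilon_s$ be the vector with the eight entries $\upsilon_s^{(t,d)}=\frac{2}{n_s(n_s-1)}\sum_{i>j}H^{(t)}_{s,\{i,j\}}1\{\phi_{s,ij}=d\}$, $t\in\{0,1,2,3\}$, $d\in\{0,1\}$. For $m\in\mathbb R^8$ let $\psi^{(t)}_d=m^{(t,d)}/m^{(0,d)}$, $\bar\psi=(\psi_1^{(1)}+\psi_1^{(2)})/2$, $C_1=\bar\psi-1+\frac{\psi_0^{(3)}-\psi_1^{(3)}}{\psi_0^{(2)}-\bar\psi}-(1-\bar\psi)$, $C_0=2\bar\psi-\bar\psi^2-\psi_1^{(3)}$, $\xi=\frac12(C_1+\sqrt{C_1^2+4C_0})$,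 and $$r_0(m)=\bar\psi-\xi,\qquad \pi_1(m)=\frac{(\bar\psi-r_0)^2}{2(1-r_0)(\bar\psi-r_0)-(\psi_1^{(3)}-2r_0+r_0^2)},\qquad r_1(m)=1-r_0-\frac{\bar\psi-r_0}{\pi_1(m)}.$$ The estimator of $p$ is $\hat p=r\big(\frac1S\sum_{s\le S}\upsilon_s\big)$, $r=(r_0,r_1)'$. **Second step.** With $\mathbf A=\sum_{s\le S}Z_s'R_s(\hat p)$, $\mathbf B=\sum_{s\le S}Z_s'Z_s$, let $\hat\theta=(\mathbf A'\mathbf B^{-1}\mathbf A)^{-1}\mathbf A'\mathbf B^{-1}\sum_{s\le S}Z_s'y_s$. **Regularity conditions (REG).** Write $\bar E[\cdot_s]=\lim_{S\to\infty}\frac1S\sum_{s\le S}E[\cdot_s]$. (i) The limits $\upsilon_0=\bar E[\upsilon_s]$, $A_0=\bar E[Z_s'R_s(p)]$, $B_0=\bar E[Z_s'Z_s]$, $F_0=\bar E[Z_s'\nabla_p(R_s(p)\theta)]$ exist, and so does $V=\bar E[\kappa_s\kappa_s']$, where $\kappa_s=Z_s'v_s-F_0\tau_s$, $\tau_s=\mathcal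 J_0[\upsilon_s-E\upsilon_s]$, and $\mathcal J_0$ is the Jacobian matrix of $r$ at $\upsilon_0$. (ii) For $d\in\{0,1\}$, $\upsilon_0^{(0,d)}>0$, and the limiting share of true links among pairs with $\phi=d$, $\pi_d=\bar E\big[\frac{2}{n_s(n_s-1)}\sum_{i>j}G_{s,ij}1\{\phi_{s,ij}=d\}\big]\big/\upsilon_0^{(0,d)}$, exists, with $\pi_1>0$ and $\pi_1\ne\pi_0$. (iii) Over $s$, the entries of $Z_s'R_s(p)$, $Z_s'Z_s$ and $Z_s'\nabla_p[W_s(p)y_s]$ are uniformly integrable, and the entries of $Z_s'v_s$ are uniformly square-integrable (that is, uniformly integrable in $L^2$). **Rank condition (IV-R).** $A_0$ and $B_0$ have full column rank. **Proposition.** Let $\Sigma_0=(A_0'B_0^{-1}A_0)^{-1}A_0'B_0^{-1}$. Under these assumptions, as $S\to\infty$, $$\sqrt S(\hat\theta-\theta)\xrightarrow{d}N(0,\Sigma_0V\Sigma_0'),$$ where $V=E(\kappa_s\kappa_s')$ when this matrix does not depend on $s$. -/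

import Mathlib

open MeasureTheory ProbabilityTheory Filter Topology

/-! ### Random matrices -/

/-- The (product, equivalently Borel) σ-algebra on real matrices. -/
instance matrixMeasurableSpace {m n : Type*} : MeasurableSpace (Matrix m n ℝ) :=
  inferInstanceAs (MeasurableSpace (m → n → ℝ))

/-- The matrix of partial derivatives of `f : ℝᵏ → ℝᵐ` at `x`. -/
noncomputable def jacobian {κ ι : Type*} [Fintype κ] [DecidableEq κ] [Fintype ι]
    (f : (κ → ℝ) → (ι → ℝ)) (x : κ → ℝ) : Matrix ι κ ℝ :=
  LinearMap.toMatrix' (fderiv ℝ f x : (κ → ℝ) →ₗ[ℝ] (ι → ℝ))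

/-- The average over the first `S` groups of the expectations of `f s`. -/
noncomputable def avgE {Ω : Type*} [MeasurableSpace Ω] (P : Measure Ω) (f : ℕ → Ω → ℝ) (S : ℕ) :
    ℝ :=
  (∑ s ∈ Finset.range S, ∫ ω, f s ω ∂P) / S

/-! ### The network model of one group with `n` members and `K` covariates -/

/-- An adjacency matrix: binary entries and a zero diagonal. -/
def IsAdjacency {n : ℕ} (G : Matrix (Fin n) (Fin n) ℝ) : Prop :=
  (∀ i j, G i j = 0 ∨ G i j = 1) ∧ ∀ i, G i i = 0

/-- The adjusted measure `W(p) = (H - p₀ (ιι' - I)) / (1 - p₀ - p₁)`. -/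
noncomputable def adjusted {n : ℕ} (H : Matrix (Fin n) (Fin n) ℝ) (p : Fin 2 → ℝ) :
    Matrix (Fin n) (Fin n) ℝ :=
  (1 - p 0 - p 1)⁻¹ • (H - p 0 • (Matrix.of (fun _ _ => 1) - 1))

/-- The regressors `R(p) = (W(p) y, X)`. -/
noncomputable def regressors {n K : ℕ} (H : Matrix (Fin n) (Fin n) ℝ)
    (X : Matrix (Fin n) (Fin K) ℝ) (y : Fin n → ℝ) (p : Fin 2 → ℝ) :
    Matrix (Fin n) (Unit ⊕ Fin K) ℝ :=
  Matrix.fromCols (Matrix.replicateCol Unit (Matrix.mulVec (adjusted H p) y)) X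

/-- The instruments `Z = (H'X, X)`. -/
def instruments {n K : ℕ} (H : Matrix (Fin n) (Fin n) ℝ) (X : Matrix (Fin n) (Fin K) ℝ) :
    Matrix (Fin n) (Fin K ⊕ Fin K) ℝ :=
  Matrix.fromCols (H.transpose * X) X

/-- The structural coefficients `θ = (λ, β')'`. -/
def coefficients {K : ℕ} (lam : ℝ) (β : Fin K → ℝ) : Unit ⊕ Fin K → ℝ :=
  Sum.elim (fun _ => lam) β

/-- The composite error `v = ε + λ (G - W(p)) y`. -/
noncomputable def compositeError {n : ℕ} (lam : ℝ) (p : Fin 2 → ℝ)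
    (G H : Matrix (Fin n) (Fin n) ℝ) (y ε : Fin n → ℝ) : Fin n → ℝ :=
  ε + lam • Matrix.mulVec (G - adjusted H p) y

section Assumptions

variable {Ω : Type*} [MeasurableSpace Ω] {n K : ℕ}

/-- (A1): `E(H_ij | G, X) = E(H_ij | G_ij, X)` for all `i, j`. -/
def AssumptionA1 (P : Measure Ω) (G H : Ω → Matrix (Fin n) (Fin n) ℝ)
    (X : Ω → Matrix (Fin n) (Fin K) ℝ) : Prop :=
  ∀ i j,
    P[fun ω => H ω i j | MeasurableSpace.comap (fun ω => (G ω, X ω)) inferInstance] =ᵐ[P]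
      P[fun ω => H ω i j | MeasurableSpace.comap (fun ω => (G ω i j, X ω)) inferInstance]

/-- (A2): `E(H_ij | G_ij = 1, X) = 1 - p₁` and `E(H_ij | G_ij = 0, X) = p₀` for all `i ≠ j`,
and `p₀ + p₁ < 1`. -/
def AssumptionA2 (P : Measure Ω) (G H : Ω → Matrix (Fin n) (Fin n) ℝ)
    (X : Ω → Matrix (Fin n) (Fin K) ℝ) (p : Fin 2 → ℝ) : Prop :=
  (∀ i j, i ≠ j → ∀ᵐ ω ∂P,
    (G ω i j = 1 →
      (P[fun ω => H ω i j | MeasurableSpace.comap (fun ω => (G ω i j, X ω)) inferInstance]) ω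
        = 1 - p 1) ∧
    (G ω i j = 0 →
      (P[fun ω => H ω i j | MeasurableSpace.comap (fun ω => (G ω i j, X ω)) inferInstance]) ω
        = p 0)) ∧
  p 0 + p 1 < 1

/-- (A3): `E(ε | G, X, H) = 0` (for an integrable `ε`). -/
def AssumptionA3 (P : Measure Ω) (G H : Ω → Matrix (Fin n) (Fin n) ℝ)
    (X : Ω → Matrix (Fin n) (Fin K) ℝ) (ε : Ω → Fin n → ℝ) : Prop :=
  ∀ i, Integrable (fun ω => ε ω i) P ∧
    P[fun ω => ε ω i | MeasurableSpace.comap (fun ω => (G ω, X ω, H ω)) inferInstance] =ᵐ[P] 0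

/-- (A4): conditionally on `(G, X)`, the entries `H_ij` and `H_kl` are independent whenever
`(i, j) ≠ (k, l)`. -/
def AssumptionA4 (P : Measure Ω) (G H : Ω → Matrix (Fin n) (Fin n) ℝ)
    (X : Ω → Matrix (Fin n) (Fin K) ℝ) : Prop :=
  ∀ i j k l, (i, j) ≠ (k, l) → ∀ s t : Set ℝ, MeasurableSet s → MeasurableSet t →
    P⟦(fun ω => H ω i j) ⁻¹' s ∩ (fun ω => H ω k l) ⁻¹' t |
        MeasurableSpace.comap (fun ω => (G ω, X ω)) inferInstance⟧ =ᵐ[P]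
      P⟦(fun ω => H ω i j) ⁻¹' s |
          MeasurableSpace.comap (fun ω => (G ω, X ω)) inferInstance⟧ *
        P⟦(fun ω => H ω k l) ⁻¹' t |
          MeasurableSpace.comap (fun ω => (G ω, X ω)) inferInstance⟧

end Assumptions

/-! ### Closed-form estimation of the misclassification rates -/

/-- For an unordered pair `{i, j}` with `i > j`: the measures `H⁽¹⁾ = H_ij`, `H⁽²⁾ = H_ji` and
`H⁽³⁾ = max (H_ij, H_ji)`; the index `0` stands for the constant `1`, which counts the pair. -/
noncomputable def pairMeasure {n : ℕ} (H : Matrix (Fin n) (Fin n) ℝ) (t : Fin 4) (i j : Fin n) :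
    ℝ :=
  ![1, H i j, H j i, max (H i j) (H j i)] t

/-- The average `2 / (n (n - 1)) ∑_{i > j} f i j 1{φ_ij = d}` over unordered pairs. -/
noncomputable def pairAverage {n : ℕ} (φ : Fin n → Fin n → Fin 2) (d : Fin 2)
    (f : Fin n → Fin n → ℝ) : ℝ :=
  2 / ((n : ℝ) * ((n : ℝ) - 1)) *
    ∑ i, ∑ j, if j < i ∧ φ i j = d then f i j else 0

/-- The group moments `υ`; the entry `(t, d)`, `t = 1, 2, 3`, is the average of
`H⁽ᵗ⁾ 1{φ = d}` over unordered pairs, and the entry `(0, d)` is the average of `1{φ = d}`. -/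
noncomputable def groupMoments {n : ℕ} (φ : Fin n → Fin n → Fin 2)
    (H : Matrix (Fin n) (Fin n) ℝ) : Fin 4 × Fin 2 → ℝ :=
  fun q => pairAverage φ q.2 (pairMeasure H q.1)

/-- The share `ψ_d⁽ᵗ⁾` of linked pairs among those with `φ = d`, as a function of the (sample or
population) average `m` of the group moments. -/
noncomputable def linkShare (m : Fin 4 × Fin 2 → ℝ) (t : Fin 4) (d : Fin 2) : ℝ :=
  m (t, d) / m (0, d)

/-- The average of `ψ_1⁽¹⁾` and `ψ_1⁽²⁾`. -/
noncomputable def meanShare (m : Fin 4 × Fin 2 → ℝ) : ℝ :=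
  (linkShare m 1 1 + linkShare m 2 1) / 2

/-- `C₁` (with `C₂ = 1`). -/
noncomputable def coefC1 (m : Fin 4 × Fin 2 → ℝ) : ℝ :=
  meanShare m - 1
    + (linkShare m 3 0 - linkShare m 3 1) / (linkShare m 2 0 - meanShare m)
    - (1 - meanShare m)

/-- `C₀`. -/
noncomputable def coefC0 (m : Fin 4 × Fin 2 → ℝ) : ℝ :=
  meanShare m + meanShare m - meanShare m * meanShare m - linkShare m 3 1

/-- `ξ`, the positive root of `ξ² - C₁ ξ - C₀ = 0`. -/
noncomputable def rootXi (m : Fin 4 × Fin 2 → ℝ) : ℝ :=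
  (coefC1 m + √(coefC1 m ^ 2 + 4 * coefC0 m)) / 2

/-- `p₀`. -/
noncomputable def rate0 (m : Fin 4 × Fin 2 → ℝ) : ℝ := meanShare m - rootXi m

/-- `π₁`, the share of true links among the pairs with `φ = 1`. -/
noncomputable def trueShare (m : Fin 4 × Fin 2 → ℝ) : ℝ :=
  (meanShare m - rate0 m) * (meanShare m - rate0 m) /
    ((1 - rate0 m) * (meanShare m - rate0 m) + (1 - rate0 m) * (meanShare m - rate0 m)
      - (linkShare m 3 1 - (rate0 m + rate0 m - rate0 m * rate0 m)))

/-- `p₁`. -/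
noncomputable def rate1 (m : Fin 4 × Fin 2 → ℝ) : ℝ :=
  1 - rate0 m - (meanShare m - rate0 m) / trueShare m

/-- The closed form of `(p₀, p₁)` as a function of the averages of the group moments. -/
noncomputable def rates (m : Fin 4 × Fin 2 → ℝ) : Fin 2 → ℝ := ![rate0 m, rate1 m]

/-- The closed-form estimator `p̂` from the first `S` groups; `φ n X i j` is `φ_ij(X)` in a group of
size `n`. -/
noncomputable def ratesEstimator {K : ℕ}
    (φ : (n : ℕ) → Matrix (Fin n) (Fin K) ℝ → Fin n → Fin n → Fin 2) (n : ℕ → ℕ)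
    (H : (s : ℕ) → Matrix (Fin (n s)) (Fin (n s)) ℝ)
    (X : (s : ℕ) → Matrix (Fin (n s)) (Fin K) ℝ) (S : ℕ) : Fin 2 → ℝ :=
  rates (fun q => (∑ s ∈ Finset.range S, groupMoments (φ (n s) (X s)) (H s) q) / S)

/-! ### The adjusted two-stage least-squares estimator -/

/-- `(A' B⁻¹ A)⁻¹ A' B⁻¹`. -/
noncomputable def twoStageMatrix {ι κ : Type*} [Fintype ι] [DecidableEq ι] [Fintype κ]
    [DecidableEq κ] (A : Matrix ι κ ℝ) (B : Matrix ι ι ℝ) : Matrix κ ι ℝ :=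
  (A.transpose * B⁻¹ * A)⁻¹ * (A.transpose * B⁻¹)

/-- The adjusted 2SLS estimator from the first `S` groups with misclassification rates `q` plugged
in. Products of matrices stacked over groups are written as sums over groups. -/
noncomputable def adjusted2SLS {K : ℕ} (n : ℕ → ℕ)
    (H : (s : ℕ) → Matrix (Fin (n s)) (Fin (n s)) ℝ)
    (X : (s : ℕ) → Matrix (Fin (n s)) (Fin K) ℝ) (y : (s : ℕ) → Fin (n s) → ℝ)
    (q : Fin 2 → ℝ) (S : ℕ) : Unit ⊕ Fin K → ℝ :=
  Matrix.mulVec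
    (twoStageMatrix
      (∑ s ∈ Finset.range S,
        (instruments (H s) (X s)).transpose * regressors (H s) (X s) (y s) q)
      (∑ s ∈ Finset.range S, (instruments (H s) (X s)).transpose * instruments (H s) (X s)))
    (∑ s ∈ Finset.range S, Matrix.mulVec (instruments (H s) (X s)).transpose (y s))

/-- The two-step estimator `θ̂`, which plugs in `p̂`. -/
noncomputable def twoStepEstimator {K : ℕ}
    (φ : (n : ℕ) → Matrix (Fin n) (Fin K) ℝ → Fin n → Fin n → Fin 2) (n : ℕ → ℕ)
    (H : (s : ℕ) → Matrix (Fin (n s)) (Fin (n s)) ℝ)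
    (X : (s : ℕ) → Matrix (Fin (n s)) (Fin K) ℝ) (y : (s : ℕ) → Fin (n s) → ℝ) (S : ℕ) :
    Unit ⊕ Fin K → ℝ :=
  adjusted2SLS n H X y (ratesEstimator φ n H X S) S

/-- `Z' ∇_p [W(p) y]`: the part of `Z' ∇_p R(p)` that is not identically zero. -/
noncomputable def instrumentedGradient {n K : ℕ} (H : Matrix (Fin n) (Fin n) ℝ)
    (X : Matrix (Fin n) (Fin K) ℝ) (y : Fin n → ℝ) (p : Fin 2 → ℝ) :
    Matrix (Fin K ⊕ Fin K) (Fin 2) ℝ :=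
  (instruments H X).transpose * jacobian (fun q => Matrix.mulVec (adjusted H q) y) p

/-- `Z' ∇_p [R(p) θ]`. -/
noncomputable def momentGradient {n K : ℕ} (H : Matrix (Fin n) (Fin n) ℝ)
    (X : Matrix (Fin n) (Fin K) ℝ) (y : Fin n → ℝ) (θ : Unit ⊕ Fin K → ℝ) (p : Fin 2 → ℝ) :
    Matrix (Fin K ⊕ Fin K) (Fin 2) ℝ :=
  (instruments H X).transpose * jacobian (fun q => Matrix.mulVec (regressors H X y q) θ) p

/-- The first-stage influence function `τ = J₀ (υ - E υ)`. -/
noncomputable def firstStageInfluence {Ω : Type*} [MeasurableSpace Ω] (P : Measure Ω)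
    (J₀ : Matrix (Fin 2) (Fin 4 × Fin 2) ℝ) (υ : Ω → Fin 4 × Fin 2 → ℝ) (ω : Ω) : Fin 2 → ℝ :=
  Matrix.mulVec J₀ (fun q => υ ω q - ∫ ω', υ ω' q ∂P)

/-- The instrumented composite error `Z'v`. -/
noncomputable def instrumentedError {n K : ℕ} (lam : ℝ) (p : Fin 2 → ℝ)
    (G H : Matrix (Fin n) (Fin n) ℝ) (X : Matrix (Fin n) (Fin K) ℝ) (y ε : Fin n → ℝ) :
    Fin K ⊕ Fin K → ℝ :=
  Matrix.mulVec (instruments H X).transpose (compositeError lam p G H y ε)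

/-!
# Asymptotic normality of the two-step estimator

*First step.* Conditionally on the covariates, the expected moments of a group are mixtures of the
reports on linked and on unlinked pairs: a report has conditional mean `p₀ + (1 - p₀ - p₁) G`, and,
by conditional independence of the two reports on a pair, their maximum has a conditional mean that
is affine in `G` too (`LinkModel.integral_groupMoments`). A vector of moments with this structure,
`IsMixture`, determines the rates through the closed form (`IsMixture.rates_eq`). The structure is
linear, so the average expected moments of the first `S` groups have it as well, with the shares of
true links in those groups in place of the limiting ones. Hence `rates` maps the expected moments to
`p` *exactly* once `S` is large, and no assumption on the speed of convergence of the expected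
moments is needed: strict differentiability of `rates` at the limit `υ₀` linearizes the estimator
around the moving centre (`first_stage_expansion`).

*Second step.* The composite error is orthogonal to the instruments, `E (Z'v) = 0`
(`LinkModel.integral_instrumentedError_eq_zero`). Substituting the reduced form of `y` writes `Z'v`
as a sum of terms that are linear in `ε` or in the measurement error `G - W(p)`, multiplied by
functions of `(G, X)` and by entries of `H`; the latter are different from those in `G - W(p)` that
they multiply because `H` has a zero diagonal. The single terms need not be integrable, so the
identity is proved after truncation by a function of `(G, X)` and extended by dominated convergence.
The dependence on the plugged-in rates is explicit: with `c(q) = 1 - q₀ - q₁`,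
`W(q) y - W(p) y = c(p) / c(q) • ∇W(p) y (q - p)` (`adjusted_mulVec_sub`). The error of the
estimator is therefore an exact expression in sample averages and in `p̂ - p`
(`adjusted2SLS_sub_eq`).

*Limits.* The groups are independent but not identically distributed, so that sample averages
converge by a weak law under uniform integrability (`weak_law`) and the normalized sum of the
influence functions `κ` by a Lindeberg central limit theorem, proved through characteristic
functions (`tendsto_integral_cexp_normalized_sum`, `tendstoInDistribution_normalized_sum`).
Stochastic orders are handled by the filter `whp P` on `ℕ × Ω`, whose convergence is convergence in
probability; limits in probability thus obey the usual calculus of `Tendsto`, and Slutsky's theorem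
finishes the proof.
-/

/-! ### Expansions of the exponential -/

lemma norm_prod_sub_prod_le {ι : Type*} (s : Finset ι) (z w : ι → ℂ) (hz : ∀ i ∈ s, ‖z i‖ ≤ 1)
    (hw : ∀ i ∈ s, ‖w i‖ ≤ 1) : ‖∏ i ∈ s, z i - ∏ i ∈ s, w i‖ ≤ ∑ i ∈ s, ‖z i - w i‖ := by
  classical
  induction s using Finset.induction_on with
  | empty => simp
  | insert a s ha ih =>
    have hz' : ∀ i ∈ s, ‖z i‖ ≤ 1 := fun i hi => hz i (Finset.mem_insert_of_mem hi)
    have hw' : ∀ i ∈ s, ‖w i‖ ≤ 1 := fun i hi => hw i (Finset.mem_insert_of_mem hi)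
    rw [Finset.prod_insert ha, Finset.prod_insert ha, Finset.sum_insert ha]
    have hprod : ‖∏ i ∈ s, w i‖ ≤ 1 := by
      rw [norm_prod]; exact Finset.prod_le_one (fun _ _ => norm_nonneg _) hw'
    calc ‖z a * ∏ i ∈ s, z i - w a * ∏ i ∈ s, w i‖
        = ‖(z a - w a) * ∏ i ∈ s, w i + z a * (∏ i ∈ s, z i - ∏ i ∈ s, w i)‖ := by ring_nf
      _ ≤ ‖z a - w a‖ * ‖∏ i ∈ s, w i‖ + ‖z a‖ * ‖∏ i ∈ s, z i - ∏ i ∈ s, w i‖ := by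
          rw [← norm_mul, ← norm_mul]; exact norm_add_le _ _
      _ ≤ ‖z a - w a‖ * 1 + 1 * ∑ i ∈ s, ‖z i - w i‖ := by
          gcongr
          · exact hz a (Finset.mem_insert_self _ _)
          · exact ih hz' hw'
      _ = _ := by ring

/-- The Taylor remainder of order two of `exp (i x)` is both `O(x²)` and `O(|x|³)`. -/
lemma norm_cexp_sub_quadratic_le (x : ℝ) :
    ‖Complex.exp (x * Complex.I) - (1 + x * Complex.I - (x : ℂ) ^ 2 / 2)‖ ≤ 4 * x ^ 2 ∧
    ‖Complex.exp (x * Complex.I) - (1 + x * Complex.I - (x : ℂ) ^ 2 / 2)‖ ≤ 4 * |x| ^ 3 := by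
  have hx2 : |x| ^ 2 = x ^ 2 := sq_abs x
  rcases le_or_gt |x| 1 with h | h
  · have h1 := Complex.norm_exp_sub_sum_le_norm_mul_exp (x * Complex.I) 3
    have hsum : ∑ m ∈ Finset.range 3, ((x : ℂ) * Complex.I) ^ m / (m.factorial : ℂ)
        = 1 + x * Complex.I - (x : ℂ) ^ 2 / 2 := by
      simp [Finset.sum_range_succ, Nat.factorial, mul_pow]
      ring
    rw [hsum] at h1
    have hn : ‖(x : ℂ) * Complex.I‖ = |x| := by simp
    rw [hn] at h1
    have h2 : Real.exp |x| ≤ 4 := by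
      calc Real.exp |x| ≤ Real.exp 1 := Real.exp_le_exp.2 h
        _ ≤ 4 := by have := Real.exp_one_lt_d9; linarith
    have h3 : |x| ^ 3 * Real.exp |x| ≤ 4 * |x| ^ 3 := by
      nlinarith [pow_nonneg (abs_nonneg x) 3]
    refine ⟨?_, h1.trans h3⟩
    refine (h1.trans h3).trans ?_
    rw [← hx2]
    nlinarith [pow_nonneg (abs_nonneg x) 2]
  · have h1 : ‖Complex.exp (x * Complex.I) - (1 + x * Complex.I - (x : ℂ) ^ 2 / 2)‖
        ≤ 1 + (1 + |x| + |x| ^ 2 / 2) := by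
      refine (norm_sub_le _ _).trans ?_
      rw [Complex.norm_exp_ofReal_mul_I]
      gcongr
      refine (norm_sub_le _ _).trans ?_
      gcongr
      · refine (norm_add_le _ _).trans ?_
        simp
      · simp
    constructor
    · rw [← hx2]; nlinarith
    · have : |x| ^ 2 ≤ |x| ^ 3 := pow_le_pow_right₀ h.le (by norm_num)
      nlinarith

lemma abs_exp_neg_sub_le {u : ℝ} (hu : 0 ≤ u) : |Real.exp (-u) - (1 - u)| ≤ u ^ 2 := by
  rcases le_or_gt u 1 with h | h
  · have := Real.norm_exp_sub_one_sub_id_le (x :=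
      -u) (by rw [norm_neg, Real.norm_of_nonneg hu]; exact h)
    rw [norm_neg, Real.norm_of_nonneg hu, Real.norm_eq_abs] at this
    convert this using 2; ring
  · have h1 : Real.exp (-u) ≤ 1 := Real.exp_le_one_iff.2 (by linarith)
    have h2 := Real.exp_pos (-u)
    rw [abs_le]; constructor <;> nlinarith

/-! ### A central limit theorem for independent, uniformly square-integrable variables -/

section
variable {Ω : Type*} [MeasurableSpace Ω] {P : Measure Ω} [IsProbabilityMeasure P]

omit [IsProbabilityMeasure P] in
lemma integral_sq_le_of_eLpNorm_le {f : Ω → ℝ} (hf : MemLp f 2 P) {c : ℝ} (hc : 0 ≤ c)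
    (h : eLpNorm f 2 P ≤ ENNReal.ofReal c) : ∫ ω, f ω ^ 2 ∂P ≤ c ^ 2 := by
  rw [hf.eLpNorm_eq_integral_rpow_norm (by norm_num) (by norm_num)] at h
  have h' := (ENNReal.ofReal_le_ofReal_iff hc).1 h
  have hnn : 0 ≤ ∫ ω, f ω ^ 2 ∂P := integral_nonneg fun _ => sq_nonneg _
  have e : ∫ a, ‖f a‖ ^ (2 : ENNReal).toReal ∂P = ∫ ω, f ω ^ 2 ∂P := by
    congr 1; ext a; simp
  rw [e] at h'
  have h2 : (∫ ω, f ω ^ 2 ∂P) ^ ((2:ENNReal).toReal⁻¹) = √(∫ ω, f ω ^ 2 ∂P) := by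
    rw [Real.sqrt_eq_rpow]; norm_num
  rw [h2] at h'
  calc ∫ ω, f ω ^ 2 ∂P = √(∫ ω, f ω ^ 2 ∂P) ^ 2 := (Real.sq_sqrt hnn).symm
    _ ≤ c ^ 2 := by gcongr

omit [IsProbabilityMeasure P] in
lemma MeasureTheory.UniformIntegrable.exists_integral_sq_le
    {X : ℕ → Ω → ℝ} (h : UniformIntegrable X 2 P) :
    ∃ C : ℝ, 0 ≤ C ∧ ∀ s, ∫ ω, X s ω ^ 2 ∂P ≤ C := by
  obtain ⟨C, hC⟩ := h.2.2
  refine ⟨(C : ℝ) ^ 2, by positivity, fun s => ?_⟩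
  exact integral_sq_le_of_eLpNorm_le (h.memLp s) C.2 (by simpa using hC s)

omit [IsProbabilityMeasure P] in
lemma MeasureTheory.UniformIntegrable.exists_tail_sq_le
    {X : ℕ → Ω → ℝ} (h : UniformIntegrable X 2 P) {η : ℝ}
    (hη : 0 < η) : ∃ C : ℝ, 0 ≤ C ∧
      ∀ s, Integrable (fun ω => {ω | C ≤ |X s ω|}.indicator (X s) ω ^ 2) P ∧
      ∫ ω, {ω | C ≤ |X s ω|}.indicator (X s) ω ^ 2 ∂P ≤ η := by
  obtain ⟨C, hC⟩ := h.spec (by norm_num) (by norm_num) (Real.sqrt_pos.2 hη)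
  refine ⟨C, C.2, fun s => ?_⟩
  have hset : {ω | C ≤ ‖X s ω‖₊} = {ω | (C : ℝ) ≤ |X s ω|} := by
    ext ω; simp [← NNReal.coe_le_coe]
  have hm : MemLp ({ω | (C : ℝ) ≤ |X s ω|}.indicator (X s)) 2 P := by
    refine ⟨?_, ?_⟩
    · refine (h.1 s).indicator₀ ?_
      exact nullMeasurableSet_le aemeasurable_const (h.1 s).aemeasurable.abs
    · rw [← hset]; exact (hC s).trans_lt ENNReal.ofReal_lt_top
  refine ⟨hm.integrable_sq, ?_⟩
  have := integral_sq_le_of_eLpNorm_le hm (Real.sqrt_nonneg _) (by rw [← hset]; exact hC s)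
  rwa [Real.sq_sqrt hη.le] at this

/-- Second-order expansion of the characteristic function of a centred variable: the remainder is of
third order where `|X| < C` and of second order on the tail. -/
lemma norm_charFun_sub_quadratic_le {X : Ω → ℝ} (hX : MemLp X 2 P) (h0 : ∫ ω, X ω ∂P = 0)
    {a C : ℝ} (ha : 0 ≤ a) (hC : 0 ≤ C)
    (hi : Integrable (fun ω => {ω | C ≤ |X ω|}.indicator X ω ^ 2) P) :
    ‖(∫ ω, Complex.exp ((a * X ω : ℝ) * Complex.I) ∂P) -
      ((1 - a ^ 2 * (∫ ω, X ω ^ 2 ∂P) / 2 : ℝ) : ℂ)‖ ≤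
      4 * (a ^ 3 * C * ∫ ω, X ω ^ 2 ∂P) +
        4 * (a ^ 2 * ∫ ω, {ω | C ≤ |X ω|}.indicator X ω ^ 2 ∂P) := by
  have hint : Integrable X P := hX.integrable (by norm_num)
  have hsq : Integrable (fun ω => X ω ^ 2) P := hX.integrable_sq
  have hm : AEStronglyMeasurable X P := hX.1
  have hexp : Integrable (fun ω => Complex.exp ((a * X ω : ℝ) * Complex.I)) P := by
    refine Integrable.of_bound (C := 1) ?_ (ae_of_all _ fun ω => ?_)
    · have h1 : AEMeasurable X P := hm.aemeasurable
      exact (by fun_prop : AEMeasurable (fun ω =>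
        Complex.exp ((a * X ω : ℝ) * Complex.I)) P).aestronglyMeasurable
    · rw [Complex.norm_exp_ofReal_mul_I]
  have hR : Integrable (fun ω =>
      (1 + ((a * X ω : ℝ) : ℂ) * Complex.I - (((a * X ω) ^ 2 / 2 : ℝ) : ℂ))) P := by
    refine ((integrable_const _).add ?_).sub ?_
    · exact ((hint.const_mul a).ofReal).mul_const _
    · simp_rw [mul_pow]
      exact ((hsq.const_mul (a ^ 2)).div_const 2).ofReal
  have e : ((1 - a ^ 2 * (∫ ω, X ω ^ 2 ∂P) / 2 : ℝ) : ℂ) =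
      ∫ ω, (1 + ((a * X ω : ℝ) : ℂ) * Complex.I - (((a * X ω) ^ 2 / 2 : ℝ) : ℂ)) ∂P := by
    rw [integral_sub, integral_add (integrable_const _)]
    · rw [integral_mul_const, integral_complex_ofReal, integral_complex_ofReal, integral_const_mul,
        h0]
      simp_rw [mul_pow]
      rw [integral_div, integral_const_mul]
      simp
    · exact ((hint.const_mul a).ofReal).mul_const _
    · exact (integrable_const _).add (((hint.const_mul a).ofReal).mul_const _)
    · simp_rw [mul_pow]
      exact ((hsq.const_mul (a ^ 2)).div_const 2).ofReal
  rw [e, ← integral_sub hexp hR, ← integral_const_mul, ← integral_const_mul, ← integral_const_mul,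
    ← integral_const_mul,
      ← integral_add ((hsq.const_mul _).const_mul _) ((hi.const_mul _).const_mul _)]
  refine (norm_integral_le_integral_norm _).trans ?_
  refine integral_mono (hexp.sub hR).norm
    (((hsq.const_mul _).const_mul _).add ((hi.const_mul _).const_mul _)) fun ω => ?_
  have hb := norm_cexp_sub_quadratic_le (a * X ω)
  have eqn : Complex.exp ((a * X ω : ℝ) * Complex.I) -
    (1 + ((a * X ω : ℝ) : ℂ) * Complex.I - (((a * X ω) ^ 2 / 2 : ℝ) : ℂ))
      = Complex.exp ((a * X ω : ℝ) * Complex.I) -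
          (1 + ((a * X ω : ℝ) : ℂ) * Complex.I - ((a * X ω : ℝ) : ℂ) ^ 2 / 2) := by
    push_cast; ring
  rw [eqn]
  by_cases hω : C ≤ |X ω|
  · rw [Set.indicator_of_mem (by exact hω)]
    refine hb.1.trans ?_
    have : 0 ≤ a ^ 3 * C * X ω ^ 2 := by positivity
    nlinarith
  · rw [Set.indicator_of_notMem (by exact hω)]
    refine hb.2.trans ?_
    push Not at hω
    rw [abs_mul, abs_of_nonneg ha]
    have : |X ω| ^ 3 ≤ C * X ω ^ 2 := by
      rw [← sq_abs]; nlinarith [sq_nonneg |X ω|]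
    have h3 : 0 ≤ a ^ 3 := by positivity
    nlinarith [mul_le_mul_of_nonneg_left this h3]

/-- Lindeberg's central limit theorem, as convergence of the characteristic functions of the
normalized sums at the point `1`. The limiting variance `v` may vanish. -/
theorem tendsto_integral_cexp_normalized_sum {X : ℕ → Ω → ℝ} (hind : iIndepFun X P)
    (hUI : UniformIntegrable X 2 P) (h0 : ∀ s, ∫ ω, X s ω ∂P = 0) {v : ℝ}
    (hv : Tendsto (avgE P (fun s ω => X s ω ^ 2)) atTop (𝓝 v)) :
    Tendsto (fun S : ℕ => ∫ ω,
      Complex.exp (((√(S : ℝ))⁻¹ * ∑ s ∈ Finset.range S, X s ω : ℝ) * Complex.I) ∂P)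
      atTop (𝓝 (Complex.exp ((-(v / 2) : ℝ) : ℂ))) := by
  obtain ⟨D, hD0, hD⟩ := UniformIntegrable.exists_integral_sq_le hUI
  have hmeas : ∀ s, AEMeasurable (X s) P := fun s => (hUI.1 s).aemeasurable
  -- factorisation of the characteristic function
  have hfac : ∀ S : ℕ, ∫ ω,
    Complex.exp (((√(S : ℝ))⁻¹ * ∑ s ∈ Finset.range S, X s ω : ℝ) * Complex.I) ∂P
      = ∏ s ∈ Finset.range S, ∫ ω, Complex.exp (((√(S : ℝ))⁻¹ * X s ω : ℝ) * Complex.I) ∂P := by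
    intro S
    have h1 := (hind.restrict (Finset.range S)).charFun_map_fun_finsetSum_eq_prod (fun _ _ =>
      hmeas _)
    have h2 := congrFun h1 (√(S : ℝ))⁻¹
    rw [charFun_apply_real, integral_map (by fun_prop) (by fun_prop)] at h2
    simp only [Finset.prod_apply] at h2
    convert h2 using 1
    · congr 1; ext ω; push_cast; ring_nf
    · refine Finset.prod_congr rfl fun s _ => ?_
      rw [charFun_apply_real, integral_map (hmeas s) (by fun_prop)]
      congr 1; ext ω; push_cast; ring_nf
  -- the product of the Gaussian characteristic functions with the same variances
  have hG : Tendsto (fun S : ℕ => ∏ s ∈ Finset.range S,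
      Complex.exp ((-((√(S : ℝ))⁻¹ ^ 2 * (∫ ω, X s ω ^ 2 ∂P) / 2) : ℝ) : ℂ)) atTop
      (𝓝 (Complex.exp ((-(v / 2) : ℝ) : ℂ))) := by
    have : (fun S : ℕ => ∏ s ∈ Finset.range S,
      Complex.exp ((-((√(S : ℝ))⁻¹ ^ 2 * (∫ ω, X s ω ^ 2 ∂P) / 2) : ℝ) : ℂ)) =
        fun S : ℕ => Complex.exp ((-((avgE P (fun s ω => X s ω ^ 2) S) / 2) : ℝ) : ℂ) := by
      ext S
      rw [← Complex.exp_sum]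
      congr 1
      rw [← Complex.ofReal_sum]
      congr 1
      rw [avgE, Finset.sum_neg_distrib, ← Finset.sum_div, ← Finset.mul_sum, inv_pow,
        Real.sq_sqrt (Nat.cast_nonneg S)]
      ring
    rw [this]
    refine (Complex.continuous_exp.tendsto _).comp ?_
    refine (Complex.continuous_ofReal.tendsto _).comp ?_
    exact (hv.div_const 2).neg
  refine (tendsto_iff_of_dist ?_).2 hG
  rw [Metric.tendsto_atTop]
  intro η hη
  obtain ⟨C, hC0, hC⟩ := UniformIntegrable.exists_tail_sq_le hUI (η := η / 16) (by positivity)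
  -- the sum of the `S` differences of factors is at most the left-hand side below
  have hlim : Tendsto (fun S : ℕ => 4 * C * D * (√(S : ℝ))⁻¹ + D ^ 2 / 4 * (S : ℝ)⁻¹ + η / 4) atTop
      (𝓝 (4 * C * D * 0 + D ^ 2 / 4 * 0 + η / 4)) := by
    refine ((Tendsto.const_mul _ ?_).add (Tendsto.const_mul _ ?_)).add tendsto_const_nhds
    · exact tendsto_inv_atTop_zero.comp (Real.tendsto_sqrt_atTop.comp tendsto_natCast_atTop_atTop)
    · exact tendsto_inv_atTop_zero.comp tendsto_natCast_atTop_atTop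
  have hev := hlim.eventually
    (gt_mem_nhds (show 4 * C * D * 0 + D ^ 2 / 4 * 0 + η / 4 < η by linarith))
  obtain ⟨N, hN⟩ := eventually_atTop.1 (hev.and (eventually_gt_atTop 0))
  refine ⟨N, fun S hS => ?_⟩
  obtain ⟨hS1, hSpos⟩ := hN S hS
  have hSr : (0 : ℝ) < S := by exact_mod_cast hSpos
  rw [Real.dist_eq, sub_zero, abs_of_nonneg dist_nonneg]
  refine lt_of_le_of_lt ?_ hS1
  set a := (√(S : ℝ))⁻¹ with ha_def
  have ha : 0 ≤ a := by positivity
  have ha2 : a ^ 2 = (S : ℝ)⁻¹ := by rw [ha_def, inv_pow, Real.sq_sqrt hSr.le]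
  rw [hfac S, dist_eq_norm]
  refine (norm_prod_sub_prod_le _ _ _ ?_ ?_).trans ?_
  · intro s _
    refine (norm_integral_le_integral_norm _).trans ?_
    simp_rw [Complex.norm_exp_ofReal_mul_I]
    simp
  · intro s _
    rw [Complex.norm_exp_ofReal]
    refine Real.exp_le_one_iff.2 ?_
    have : 0 ≤ ∫ ω, X s ω ^ 2 ∂P := integral_nonneg fun _ => sq_nonneg _
    have := mul_nonneg (sq_nonneg a) this
    linarith
  have hterm : ∀ s ∈ Finset.range S,
      ‖(∫ ω, Complex.exp ((a * X s ω : ℝ) * Complex.I) ∂P)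
        - Complex.exp ((-(a ^ 2 * (∫ ω, X s ω ^ 2 ∂P) / 2) : ℝ) : ℂ)‖ ≤
      (S : ℝ)⁻¹ * (4 * C * D * a + D ^ 2 / 4 * (S : ℝ)⁻¹ + η / 4) := by
    intro s _
    set σ := ∫ ω, X s ω ^ 2 ∂P with hσ
    have hσ0 : 0 ≤ σ := integral_nonneg fun _ => sq_nonneg _
    have h1 := norm_charFun_sub_quadratic_le (hUI.memLp s) (h0 s) ha hC0 (hC s).1
    have h2 := abs_exp_neg_sub_le (u := a ^ 2 * σ / 2) (by positivity)
    have h3 : ‖Complex.exp ((-(a ^ 2 * σ / 2) : ℝ) : ℂ) - ((1 - a ^ 2 * σ / 2 : ℝ) : ℂ)‖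
        ≤ (a ^ 2 * σ / 2) ^ 2 := by
      rw [← Complex.ofReal_exp, ← Complex.ofReal_sub, Complex.norm_real]; exact h2
    have h4 := norm_sub_le_norm_sub_add_norm_sub (∫ ω, Complex.exp ((a * X s ω : ℝ) * Complex.I) ∂P)
      ((1 - a ^ 2 * σ / 2 : ℝ) : ℂ) (Complex.exp ((-(a ^ 2 * σ / 2) : ℝ) : ℂ))
    rw [norm_sub_rev ((1 - a ^ 2 * σ / 2 : ℝ) : ℂ)] at h4
    refine h4.trans ((add_le_add h1 h3).trans ?_)
    have h5 : a ^ 3 * C * σ ≤ a ^ 3 * C * D := by gcongr; exact hD s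
    have h6 : (a ^ 2 * σ / 2) ^ 2 ≤ (a ^ 2 * D / 2) ^ 2 := by gcongr; exact hD s
    have h7 := mul_le_mul_of_nonneg_left (hC s).2 (sq_nonneg a)
    calc _ ≤ 4 * (a ^ 3 * C * D) + 4 * (a ^ 2 * (η / 16)) + (a ^ 2 * D / 2) ^ 2 := by gcongr
      _ = a ^ 2 * (4 * C * D * a + D ^ 2 / 4 * a ^ 2 + η / 4) := by ring
      _ = _ := by rw [ha2]
  refine (Finset.sum_le_sum hterm).trans ?_
  rw [Finset.sum_const, Finset.card_range, nsmul_eq_mul, ← mul_assoc, mul_inv_cancel₀ hSr.ne',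
    one_mul]

end

/-! ### Convergence and boundedness in probability -/

section
variable {Ω : Type*} [MeasurableSpace Ω]

/-- The filter of events that hold with probability tending to one: a set of pairs `(S, ω)` belongs
to it if the (outer) probability that `(S, ω)` lies outside of it tends to zero as `S → ∞`.
Convergence along `whp P` is convergence in probability. -/
def whp (P : Measure Ω) : Filter (ℕ × Ω) where
  sets := {s | Tendsto (fun S : ℕ => P {ω | (S, ω) ∉ s}) atTop (𝓝 0)}
  univ_sets := by simp
  sets_of_superset := by
    intro s t hs hst
    refine tendsto_of_tendsto_of_tendsto_of_le_of_le tendsto_const_nhds hs (fun _ => zero_le) ?_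
    exact fun S => measure_mono fun ω hω h => hω (hst h)
  inter_sets := by
    intro s t hs ht
    have h := hs.add ht
    rw [add_zero] at h
    refine tendsto_of_tendsto_of_tendsto_of_le_of_le tendsto_const_nhds h (fun _ => zero_le) ?_
    intro S
    refine (measure_mono ?_).trans (measure_union_le _ _)
    intro ω hω
    simp only [Set.mem_inter_iff, Set.mem_ofPred_eq, not_and_or] at hω
    exact hω

variable {P : Measure Ω}

lemma eventually_whp_iff {p : ℕ × Ω → Prop} :
    (∀ᶠ x in whp P, p x) ↔ Tendsto (fun S : ℕ => P {ω | ¬ p (S, ω)}) atTop (𝓝 0) := Iff.rfl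

lemma eventually_whp_of_ae {p : ℕ × Ω → Prop} (h : ∀ S, ∀ᵐ ω ∂P, p (S, ω)) :
    ∀ᶠ x in whp P, p x := by
  rw [eventually_whp_iff]
  have : (fun S : ℕ => P {ω | ¬ p (S, ω)}) = fun _ => 0 := by
    ext S; exact ae_iff.1 (h S)
  rw [this]; exact tendsto_const_nhds

lemma tendsto_fst_whp : Tendsto Prod.fst (whp P) atTop := by
  rw [tendsto_atTop]
  intro N
  rw [eventually_whp_iff]
  refine tendsto_const_nhds.congr' ?_
  filter_upwards [eventually_ge_atTop N] with S hS
  simp [hS]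

lemma tendstoInMeasure_of_tendsto_whp {E : Type*} [SeminormedAddCommGroup E] {f : ℕ → Ω → E} {c : E}
    (h : Tendsto (fun x : ℕ × Ω => f x.1 x.2) (whp P) (𝓝 c)) :
    TendstoInMeasure P f atTop (fun _ => c) := by
  rw [tendstoInMeasure_iff_norm]
  intro ε hε
  have := (Metric.tendsto_nhds.1 h ε hε)
  rw [eventually_whp_iff] at this
  simpa [dist_eq_norm] using this

lemma tendsto_whp_zero_of_integral {f : ℕ → Ω → ℝ} (hf : ∀ S, Integrable (f S) P)
    (h : Tendsto (fun S => ∫ ω, |f S ω| ∂P) atTop (𝓝 0)) :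
    Tendsto (fun x : ℕ × Ω => f x.1 x.2) (whp P) (𝓝 0) := by
  rw [Metric.tendsto_nhds]
  intro ε hε
  rw [eventually_whp_iff]
  have h2 : Tendsto (fun S => ENNReal.ofReal ((∫ ω, |f S ω| ∂P) / ε)) atTop (𝓝 0) := by
    have := ENNReal.tendsto_ofReal (h.div_const ε)
    simpa using this
  refine tendsto_of_tendsto_of_tendsto_of_le_of_le tendsto_const_nhds h2 (fun _ => zero_le) ?_
  intro S
  have hset : {ω | ¬ dist (f S ω) 0 < ε} = {ω | ENNReal.ofReal ε ≤ ‖f S ω‖ₑ} := by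
    ext ω
    simp [← ofReal_norm, ENNReal.ofReal_le_ofReal_iff]
  change P {ω | ¬ dist (f S ω) 0 < ε} ≤ _
  rw [hset]
  refine (meas_ge_le_lintegral_div (hf S).1.enorm (by simpa using hε) (by simp)).trans ?_
  simp only [ENNReal.ofReal_div_of_pos hε]
  gcongr
  rw [← ofReal_integral_norm_eq_lintegral_enorm (hf S)]
  simp

/-- Boundedness in probability, `O_p(1)`. The bound is only required for large `S`. -/
def BoundedInProb {E : Type*} [Norm E] (P : Measure Ω) (f : ℕ × Ω → E) : Prop :=
  ∀ ε : ENNReal, 0 < ε → ∃ C : ℝ, 0 < C ∧ ∀ᶠ S : ℕ in atTop, P {ω | C < ‖f (S, ω)‖} ≤ ε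

lemma boundedInProb_of_integral {f : ℕ → Ω → ℝ} {D : ℝ} (hf : ∀ S, Integrable (f S) P)
    (h : ∀ S, ∫ ω, |f S ω| ∂P ≤ D) : BoundedInProb P (fun x => f x.1 x.2) := by
  intro ε hε
  have hlim : Tendsto (fun C : ℝ => ENNReal.ofReal (D / C)) atTop (𝓝 0) := by
    have := ENNReal.tendsto_ofReal
      (tendsto_const_nhds.div_atTop tendsto_id : Tendsto (fun C : ℝ => D / C) atTop (𝓝 0))
    simpa using this
  obtain ⟨C, hC, hC0⟩ := ((hlim.eventually (ge_mem_nhds hε)).and (eventually_gt_atTop 0)).exists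
  refine ⟨C, hC0, Eventually.of_forall fun S => le_trans ?_ hC⟩
  have hset : {ω | C < ‖f S ω‖} ⊆ {ω | ENNReal.ofReal C ≤ ‖f S ω‖ₑ} := by
    intro ω hω
    simp only [Set.mem_ofPred_eq] at hω ⊢
    rw [← ofReal_norm]
    exact ENNReal.ofReal_le_ofReal hω.le
  refine (measure_mono hset).trans ?_
  refine (meas_ge_le_lintegral_div (hf S).1.enorm (by simpa using hC0) (by simp)).trans ?_
  rw [ENNReal.ofReal_div_of_pos hC0]
  gcongr
  rw [← ofReal_integral_norm_eq_lintegral_enorm (hf S)]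
  exact ENNReal.ofReal_le_ofReal (by simpa using h S)

/-- `o(O_p(1)) = o_p(1)`. -/
lemma BoundedInProb.tendsto_zero_of_isLittleO {E F : Type*} [SeminormedAddCommGroup E]
    [SeminormedAddCommGroup F]
    {f : ℕ × Ω → E} {g : ℕ × Ω → F} (hf : BoundedInProb P f) (h : g =o[whp P] f) :
    Tendsto g (whp P) (𝓝 0) := by
  rw [Metric.tendsto_nhds]
  intro δ hδ
  rw [eventually_whp_iff, ENNReal.tendsto_nhds_zero]
  intro ε hε
  have hε2 : 0 < ε / 2 := ENNReal.half_pos hε.ne'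
  obtain ⟨C, hC0, hC⟩ := hf (ε / 2) hε2
  have h1 := h.def (show 0 < δ / (2 * C) by positivity)
  rw [eventually_whp_iff, ENNReal.tendsto_nhds_zero] at h1
  filter_upwards [hC, h1 _ hε2] with S hS1 hS2
  calc P {ω | ¬ dist (g (S, ω)) 0 < δ} ≤
      P ({ω | C < ‖f (S, ω)‖} ∪ {ω | ¬ ‖g (S, ω)‖ ≤ δ / (2 * C) * ‖f (S, ω)‖}) := by
        refine measure_mono fun ω hω => ?_
        simp only [Set.mem_ofPred_eq, Set.mem_union, dist_zero_right] at hω ⊢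
        by_contra hcon
        push Not at hcon hω
        have : δ / (2 * C) * ‖f (S, ω)‖ ≤ δ / (2 * C) * C := by gcongr; exact hcon.1
        have e : δ / (2 * C) * C = δ / 2 := by field_simp
        linarith [hcon.2]
    _ ≤ ε / 2 + ε / 2 := (measure_union_le _ _).trans (add_le_add hS1 hS2)
    _ = ε := ENNReal.add_halves ε

lemma BoundedInProb.zero_mul {f g : ℕ × Ω → ℝ} (hf : BoundedInProb P f)
    (hg : Tendsto g (whp P) (𝓝 0)) : Tendsto (fun x => g x * f x) (whp P) (𝓝 0) := by
  refine hf.tendsto_zero_of_isLittleO ?_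
  have : (fun x => g x * f x) =o[whp P] fun x => 1 * f x :=
    ((Asymptotics.isLittleO_one_iff ℝ).2 hg).mul_isBigO (Asymptotics.isBigO_refl _ _)
  simpa using this

variable [IsProbabilityMeasure P]

/-- The inequality `|x| ≤ δ + x² / δ`, integrated. -/
lemma integral_abs_le_of_sq
    {f : Ω → ℝ} (hf : Integrable f P) (hf2 : Integrable (fun ω => f ω ^ 2) P) {δ : ℝ}
    (hδ : 0 < δ) : ∫ ω, |f ω| ∂P ≤ δ + δ⁻¹ * ∫ ω, f ω ^ 2 ∂P := by
  have : ∫ ω, |f ω| ∂P ≤ ∫ ω, (δ + δ⁻¹ * f ω ^ 2) ∂P := by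
    refine integral_mono hf.abs ((integrable_const _).add (hf2.const_mul _)) fun ω => ?_
    simp only
    rw [← sq_abs (f ω)]
    have h1 : δ⁻¹ * |f ω| ^ 2 - 2 * |f ω| + δ = δ⁻¹ * (|f ω| - δ) ^ 2 := by field_simp; ring
    have h2 : 0 ≤ δ⁻¹ * (|f ω| - δ) ^ 2 := by positivity
    have := abs_nonneg (f ω)
    linarith
  refine this.trans_eq ?_
  rw [integral_add (integrable_const _) (hf2.const_mul _), integral_const_mul]
  simp

/-- The variance of a sum of independent variables with second moments at most `D`. -/
lemma integral_sq_sum_le {X : ℕ → Ω → ℝ} (hind : iIndepFun X P) (hX : ∀ s, MemLp (X s) 2 P)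
    {D : ℝ} (hD : ∀ s, ∫ ω, X s ω ^ 2 ∂P ≤ D) (S : ℕ) :
    ∫ ω, (∑ s ∈ Finset.range S, (X s ω - ∫ ω', X s ω' ∂P)) ^ 2 ∂P ≤ S * D := by
  have h1 : Var[∑ s ∈ Finset.range S, X s; P] = ∑ s ∈ Finset.range S, Var[X s; P] :=
    IndepFun.variance_sum (fun i _ => hX i) (fun i _ j _ hij => hind.indepFun hij)
  have hint : ∀ s, Integrable (X s) P := fun s => (hX s).integrable (by norm_num)
  rw [variance_eq_integral (Finset.aemeasurable_sum _ fun s _ => (hX s).1.aemeasurable)] at h1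
  have e : ∫ ω, (∑ s ∈ Finset.range S, (X s ω - ∫ ω', X s ω' ∂P)) ^ 2 ∂P
      = ∑ s ∈ Finset.range S, Var[X s; P] := by
    rw [← h1]
    congr 1; ext ω
    congr 1
    simp only [Finset.sum_apply]
    rw [integral_finsetSum _ fun s _ => hint s, Finset.sum_sub_distrib]
  rw [e]
  calc ∑ s ∈ Finset.range S, Var[X s; P] ≤ ∑ s ∈ Finset.range S, D :=
        Finset.sum_le_sum fun s _ => (variance_le_expectation_sq (hX s).1).trans (hD s)
    _ = S * D := by simp

lemma memLp_centered {X : Ω → ℝ} (hX : MemLp X 2 P) (c : ℝ) : MemLp (fun ω => X ω - c) 2 P :=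
  hX.sub (memLp_const c)

lemma boundedInProb_normalized_sum
    {X : ℕ → Ω → ℝ} (hind : iIndepFun X P) (hX : ∀ s, MemLp (X s) 2 P)
    {D : ℝ} (hD : ∀ s, ∫ ω, X s ω ^ 2 ∂P ≤ D) :
    BoundedInProb P (fun x : ℕ × Ω =>
      (√(x.1 : ℝ))⁻¹ * ∑ s ∈ Finset.range x.1, (X s x.2 - ∫ ω', X s ω' ∂P)) := by
  have hD0 : 0 ≤ D := (integral_nonneg fun _ => sq_nonneg _).trans (hD 0)
  have hm : ∀ S : ℕ, MemLp (fun ω => (√(S : ℝ))⁻¹ * ∑ s ∈ Finset.range S,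
    (X s ω - ∫ ω', X s ω' ∂P)) 2 P :=
    fun S => (memLp_finsetSum _ fun s _ => memLp_centered (hX s) _).const_mul _
  refine boundedInProb_of_integral (f := fun (S : ℕ) ω =>
    (√(S : ℝ))⁻¹ * ∑ s ∈ Finset.range S, (X s ω - ∫ ω', X s ω' ∂P)) (D := 1 + D)
    (fun S => (hm S).integrable (by norm_num)) fun S => ?_
  refine (integral_abs_le_of_sq ((hm S).integrable (by norm_num))
      (hm S).integrable_sq one_pos).trans ?_
  rw [inv_one, one_mul]
  gcongr
  simp_rw [mul_pow]
  rw [integral_const_mul, inv_pow, Real.sq_sqrt (Nat.cast_nonneg S)]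
  refine (mul_le_mul_of_nonneg_left (integral_sq_sum_le hind hX hD S) (by positivity)).trans ?_
  rcases Nat.eq_zero_or_pos S with rfl | h
  · simpa using hD0
  · have : (S : ℝ) ≠ 0 := by positivity
    rw [← mul_assoc, inv_mul_cancel₀ this, one_mul]

omit [IsProbabilityMeasure P] in
lemma MeasureTheory.UniformIntegrable.exists_integral_abs_le
    {X : ℕ → Ω → ℝ} (h : UniformIntegrable X 1 P) :
    ∃ C : ℝ, 0 ≤ C ∧ ∀ s, ∫ ω, |X s ω| ∂P ≤ C := by
  obtain ⟨C, hC⟩ := h.2.2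
  refine ⟨C, C.2, fun s => ?_⟩
  have h1 := hC s
  rw [eLpNorm_one_eq_lintegral_enorm, ← ofReal_integral_norm_eq_lintegral_enorm
    (memLp_one_iff_integrable.1 (h.memLp s))] at h1
  have := ENNReal.toReal_mono ENNReal.coe_ne_top h1
  rwa [ENNReal.toReal_ofReal (integral_nonneg fun _ => norm_nonneg _)] at this

lemma boundedInProb_average {f : ℕ → Ω → ℝ} (hf : UniformIntegrable f 1 P) :
    BoundedInProb P (fun x : ℕ × Ω => (∑ s ∈ Finset.range x.1, f s x.2) / x.1) := by
  obtain ⟨C, hC0, hC⟩ := UniformIntegrable.exists_integral_abs_le hf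
  have hi : ∀ s, Integrable (f s) P := fun s => memLp_one_iff_integrable.1 (hf.memLp s)
  refine boundedInProb_of_integral (D := C)
    (f := fun (S : ℕ) ω => (∑ s ∈ Finset.range S, f s ω) / S)
    (fun S => (integrable_finsetSum _ fun s _ => hi s).div_const _) fun S => ?_
  calc ∫ ω, |(∑ s ∈ Finset.range S, f s ω) / S| ∂P
      ≤ ∫ ω, (∑ s ∈ Finset.range S, |f s ω|) / S ∂P := by
        refine integral_mono ((integrable_finsetSum _ fun s _ => hi s).div_const _).abs
          ((integrable_finsetSum _ fun s _ => (hi s).abs).div_const _) fun ω => ?_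
        simp only [abs_div, Nat.abs_cast]
        gcongr
        exact Finset.abs_sum_le_sum_abs _ _
    _ = (∑ s ∈ Finset.range S, ∫ ω, |f s ω| ∂P) / S := by
        rw [integral_div, integral_finsetSum _ fun s _ => (hi s).abs]
    _ ≤ (∑ s ∈ Finset.range S, C) / S := by gcongr with s _; exact hC s
    _ ≤ C := by
        rw [Finset.sum_const, Finset.card_range, nsmul_eq_mul]
        rcases Nat.eq_zero_or_pos S with h | h
        · simpa [h] using hC0
        · rw [mul_div_cancel_left₀]; positivity

/-- Weak law of large numbers for independent, uniformly integrable variables. -/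
theorem weak_law {X : ℕ → Ω → ℝ} (hind : iIndepFun X P) (hUI : UniformIntegrable X 1 P) :
    Tendsto (fun x : ℕ × Ω => (∑ s ∈ Finset.range x.1, X s x.2) / x.1 - avgE P X x.1)
      (whp P) (𝓝 0) := by
  have hint : ∀ s, Integrable (X s) P := fun s => memLp_one_iff_integrable.1 (hUI.memLp s)
  have havg : ∀ S : ℕ, Integrable (fun ω => (∑ s ∈ Finset.range S, X s ω) / S - avgE P X S) P :=
    fun S => ((integrable_finsetSum _ fun s _ => hint s).div_const _).sub (integrable_const _)
  refine tendsto_whp_zero_of_integral (f :=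
    fun (S : ℕ) ω => (∑ s ∈ Finset.range S, X s ω) / S - avgE P X S)
    havg ?_
  rw [Metric.tendsto_atTop]
  intro η hη
  obtain ⟨C, hC⟩ := hUI.spec (by norm_num) (by norm_num) (show 0 < η / 8 by positivity)
  -- truncation at level `C`
  let T : ℝ → ℝ := fun x => if |x| < C then x else 0
  have hT : Measurable T :=
    Measurable.ite (measurableSet_lt measurable_id.abs measurable_const) measurable_id
      measurable_const
  have hTb : ∀ x, |T x| ≤ C := by
    intro x; simp only [T]; split_ifs with h
    · exact h.le
    · simp
  have hY : ∀ s, MemLp (fun ω => T (X s ω)) 2 P := fun s =>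
    MemLp.of_bound (hT.comp_aemeasurable (hint s).1.aemeasurable).aestronglyMeasurable C
      (ae_of_all _ fun ω => hTb _)
  have hYint : ∀ s, Integrable (fun ω => T (X s ω)) P := fun s => (hY s).integrable (by norm_num)
  have hYind : iIndepFun (fun s ω => T (X s ω)) P := hind.comp (fun _ => T) fun _ => hT
  have hYsq : ∀ s, ∫ ω, T (X s ω) ^ 2 ∂P ≤ (C : ℝ) ^ 2 := by
    intro s
    calc ∫ ω, T (X s ω) ^ 2 ∂P ≤ ∫ _, (C : ℝ) ^ 2 ∂P := by
          refine integral_mono (hY s).integrable_sq (integrable_const _) fun ω => ?_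
          simp only; rw [← sq_abs]; gcongr; exact hTb _
      _ = (C : ℝ) ^ 2 := by simp
  have htail : ∀ s, ∫ ω, |X s ω - T (X s ω)| ∂P ≤ η / 8 := by
    intro s
    have e : (fun ω => X s ω - T (X s ω)) = {ω | C ≤ ‖X s ω‖₊}.indicator (X s) := by
      ext ω
      by_cases h : |X s ω| < C
      · rw [Set.indicator_of_notMem]
        · simp [T, h]
        · simp only [Set.mem_ofPred_eq, not_le, ← NNReal.coe_lt_coe]; simpa using h
      · rw [Set.indicator_of_mem]
        · simp [T, h]
        · simp only [Set.mem_ofPred_eq, ← NNReal.coe_le_coe]; simpa using h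
    have h1 := hC s
    rw [← e, eLpNorm_one_eq_lintegral_enorm, ← ofReal_integral_norm_eq_lintegral_enorm (f :=
      fun ω => X s ω - T (X s ω)) ((hint s).sub (hYint s))] at h1
    exact (ENNReal.ofReal_le_ofReal_iff (by positivity)).1 h1
  have hlim : Tendsto (fun S : ℕ => η / 8 + (η / 8)⁻¹ * ((S : ℝ)⁻¹ * (C : ℝ) ^ 2) + η / 4) atTop
      (𝓝 (η / 8 + (η / 8)⁻¹ * (0 * (C : ℝ) ^ 2) + η / 4)) := by
    refine (tendsto_const_nhds.add (Tendsto.const_mul _ (Tendsto.mul_const _ ?_))).add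
      tendsto_const_nhds
    exact tendsto_inv_atTop_zero.comp tendsto_natCast_atTop_atTop
  have hev := hlim.eventually
    (gt_mem_nhds (show η / 8 + (η / 8)⁻¹ * (0 * (C : ℝ) ^ 2) + η / 4 < η by simp; linarith))
  obtain ⟨N, hN⟩ := eventually_atTop.1 (hev.and (eventually_gt_atTop 0))
  refine ⟨N, fun S hS => ?_⟩
  obtain ⟨hS1, hSpos⟩ := hN S hS
  have hSr : (0 : ℝ) < S := by exact_mod_cast hSpos
  rw [Real.dist_eq, sub_zero, abs_of_nonneg (integral_nonneg fun _ => abs_nonneg _)]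
  refine lt_of_le_of_lt ?_ hS1
  let Yc : Ω → ℝ := fun ω => (S : ℝ)⁻¹ * ∑ s ∈ Finset.range S, (T (X s ω) - ∫ ω', T (X s ω') ∂P)
  let Z : ℕ → Ω → ℝ := fun s ω => X s ω - T (X s ω)
  have hZint : ∀ s, Integrable (Z s) P := fun s => (hint s).sub (hYint s)
  have hYc : MemLp Yc 2 P := (memLp_finsetSum _ fun s _ => memLp_centered (hY s) _).const_mul _
  have hYcint : Integrable Yc P := hYc.integrable (by norm_num)
  have hpt : ∀ ω, |(∑ s ∈ Finset.range S, X s ω) / S - avgE P X S| ≤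
      |Yc ω| + (S : ℝ)⁻¹ * ∑ s ∈ Finset.range S, (|Z s ω| + ∫ ω', |Z s ω'| ∂P) := by
    intro ω
    have e : (∑ s ∈ Finset.range S, X s ω) / S - avgE P X S =
        Yc ω + (S : ℝ)⁻¹ * ∑ s ∈ Finset.range S, (Z s ω - ∫ ω', Z s ω' ∂P) := by
      simp only [avgE, Yc, Z]
      rw [← mul_add, ← Finset.sum_add_distrib, div_sub_div_same, div_eq_inv_mul,
        ← Finset.sum_sub_distrib]
      congr 1
      refine Finset.sum_congr rfl fun s _ => ?_
      rw [integral_sub (hint s) (hYint s)]; ring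
    rw [e]
    refine (abs_add_le _ _).trans ?_
    gcongr
    rw [abs_mul, abs_of_nonneg (by positivity : (0 : ℝ) ≤ (S : ℝ)⁻¹)]
    gcongr
    refine (Finset.abs_sum_le_sum_abs _ _).trans (Finset.sum_le_sum fun s _ => ?_)
    refine (abs_sub _ _).trans ?_
    gcongr
    exact abs_integral_le_integral_abs
  have hsumint : Integrable (fun ω => (S : ℝ)⁻¹ * ∑ s ∈ Finset.range S,
    (|Z s ω| + ∫ ω', |Z s ω'| ∂P)) P :=
    (integrable_finsetSum _ fun s _ => (hZint s).abs.add (integrable_const _)).const_mul _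
  calc ∫ ω, |(∑ s ∈ Finset.range S, X s ω) / S - avgE P X S| ∂P
      ≤ ∫ ω, (|Yc ω| + (S : ℝ)⁻¹ * ∑ s ∈ Finset.range S, (|Z s ω| + ∫ ω', |Z s ω'| ∂P)) ∂P :=
        integral_mono (havg S).abs (hYcint.abs.add hsumint) hpt
    _ = ∫ ω, |Yc ω| ∂P + (S : ℝ)⁻¹ * ∑ s ∈ Finset.range S,
        (∫ ω, |Z s ω| ∂P + ∫ ω', |Z s ω'| ∂P) := by
        rw [integral_add hYcint.abs hsumint, integral_const_mul, integral_finsetSum]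
        · congr 2
          refine Finset.sum_congr rfl fun s _ => ?_
          rw [integral_add (hZint s).abs (integrable_const _)]; simp
        · exact fun s _ => (hZint s).abs.add (integrable_const _)
    _ ≤ (η / 8 + (η / 8)⁻¹ * ((S : ℝ)⁻¹ * (C : ℝ) ^ 2)) + (S : ℝ)⁻¹ * ∑ s ∈ Finset.range S,
        (η / 8 + η / 8) := by
        gcongr with s _ s _
        · refine (integral_abs_le_of_sq hYcint hYc.integrable_sq
            (show 0 < η / 8 by positivity)).trans ?_
          gcongr
          simp only [Yc, mul_pow]
          rw [integral_const_mul]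
          refine (mul_le_mul_of_nonneg_left (integral_sq_sum_le hYind hY hYsq S)
              (by positivity)).trans_eq ?_
          field_simp
        · exact htail s
        · exact htail s
    _ = _ := by
        rw [Finset.sum_const, Finset.card_range, nsmul_eq_mul, inv_mul_cancel_left₀ hSr.ne']
        ring

end

/-! ### The closed form of the misclassification rates -/

/-- The moments `m` are those of a population with misclassification rates `p` and with a share
`π d` of true links among the pairs with `φ = d`: the reports `H⁽¹⁾` and `H⁽²⁾` have mean `p₀` on
unlinked and `1 - p₁` on linked pairs, and `H⁽³⁾` has mean `1 - (1 - p₀)²` and `1 - p₁²`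
respectively. The identities are multiplied by the frequency `m (0, d)`, which makes them linear in
`m` and in the frequencies `π d * m (0, d)` of true links. -/
structure IsMixture (p : Fin 2 → ℝ) (π : Fin 2 → ℝ) (m : Fin 4 × Fin 2 → ℝ) : Prop where
  one : ∀ d, m (1, d) = p 0 * m (0, d) + (1 - p 0 - p 1) * (π d * m (0, d))
  two : ∀ d, m (2, d) = p 0 * m (0, d) + (1 - p 0 - p 1) * (π d * m (0, d))
  three : ∀ d, m (3, d) = (2 * p 0 - p 0 ^ 2) * m (0, d) +
    (1 - p 0 - p 1) * (1 - p 0 + p 1) * (π d * m (0, d))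

section
variable {p π : Fin 2 → ℝ} {m : Fin 4 × Fin 2 → ℝ}

lemma IsMixture.linkShare_one (h : IsMixture p π m) {d : Fin 2} (hm : m (0, d) ≠ 0) :
    linkShare m 1 d = p 0 + (1 - p 0 - p 1) * π d := by
  rw [linkShare, h.one]; field_simp

lemma IsMixture.linkShare_two (h : IsMixture p π m) {d : Fin 2} (hm : m (0, d) ≠ 0) :
    linkShare m 2 d = p 0 + (1 - p 0 - p 1) * π d := by
  rw [linkShare, h.two]; field_simp

lemma IsMixture.linkShare_three (h : IsMixture p π m) {d : Fin 2} (hm : m (0, d) ≠ 0) :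
    linkShare m 3 d = 2 * p 0 - p 0 ^ 2 + (1 - p 0 - p 1) * (1 - p 0 + p 1) * π d := by
  rw [linkShare, h.three]; field_simp

lemma IsMixture.meanShare_eq (h : IsMixture p π m) (hm : ∀ d, m (0, d) ≠ 0) :
    meanShare m = p 0 + (1 - p 0 - p 1) * π 1 := by
  rw [meanShare, h.linkShare_one (hm 1), h.linkShare_two (hm 1)]; ring

lemma IsMixture.two_sub_mean (h : IsMixture p π m) (hm : ∀ d, m (0, d) ≠ 0) :
    linkShare m 2 0 - meanShare m = (1 - p 0 - p 1) * (π 0 - π 1) := by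
  rw [h.linkShare_two (hm 0), h.meanShare_eq hm]; ring

lemma IsMixture.coefC1_eq (h : IsMixture p π m) (hm : ∀ d, m (0, d) ≠ 0) (hp : p 0 + p 1 < 1)
    (hne : π 1 ≠ π 0) : coefC1 m = (1 - p 0 - p 1) * (2 * π 1 - 1) := by
  have hc : 1 - p 0 - p 1 ≠ 0 := by linarith
  have hd : π 0 - π 1 ≠ 0 := sub_ne_zero.2 hne.symm
  rw [coefC1, h.two_sub_mean hm, h.linkShare_three (hm 0), h.linkShare_three (hm 1),
    h.meanShare_eq hm]
  have : (2 * p 0 - p 0 ^ 2 + (1 - p 0 - p 1) * (1 - p 0 + p 1) * π 0 -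
      (2 * p 0 - p 0 ^ 2 + (1 - p 0 - p 1) * (1 - p 0 + p 1) * π 1)) /
        ((1 - p 0 - p 1) * (π 0 - π 1))
      = 1 - p 0 + p 1 := by
    rw [div_eq_iff (mul_ne_zero hc hd)]; ring
  rw [this]; ring

lemma IsMixture.coefC0_eq (h : IsMixture p π m) (hm : ∀ d, m (0, d) ≠ 0) :
    coefC0 m = (1 - p 0 - p 1) ^ 2 * (π 1 * (1 - π 1)) := by
  rw [coefC0, h.meanShare_eq hm, h.linkShare_three (hm 1)]; ring

/-- The discriminant is a perfect square, so that the root in `rootXi` is `1 - p₀ - p₁ > 0`. -/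
lemma IsMixture.disc_eq (h : IsMixture p π m) (hm : ∀ d, m (0, d) ≠ 0) (hp : p 0 + p 1 < 1)
    (hne : π 1 ≠ π 0) : coefC1 m ^ 2 + 4 * coefC0 m = (1 - p 0 - p 1) ^ 2 := by
  rw [h.coefC1_eq hm hp hne, h.coefC0_eq hm]; ring

lemma IsMixture.rate0_eq (h : IsMixture p π m) (hm : ∀ d, m (0, d) ≠ 0) (hp : p 0 + p 1 < 1)
    (hne : π 1 ≠ π 0) : rate0 m = p 0 := by
  rw [rate0, rootXi, h.disc_eq hm hp hne, Real.sqrt_sq (by linarith), h.meanShare_eq hm,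
    h.coefC1_eq hm hp hne]
  ring

lemma IsMixture.trueShare_denom_eq (h : IsMixture p π m) (hm : ∀ d,
    m (0, d) ≠ 0) (hp : p 0 + p 1 < 1)
    (hne : π 1 ≠ π 0) :
    (1 - rate0 m) * (meanShare m - rate0 m) + (1 - rate0 m) * (meanShare m - rate0 m)
      - (linkShare m 3 1 - (rate0 m + rate0 m - rate0 m * rate0 m)) =
          (1 - p 0 - p 1) ^ 2 * π 1 := by
  rw [h.rate0_eq hm hp hne, h.meanShare_eq hm, h.linkShare_three (hm 1)]; ring

lemma IsMixture.trueShare_eq (h : IsMixture p π m) (hm : ∀ d, m (0, d) ≠ 0) (hp : p 0 + p 1 < 1)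
    (hne : π 1 ≠ π 0) (hpos : π 1 ≠ 0) : trueShare m = π 1 := by
  have hc : 1 - p 0 - p 1 ≠ 0 := by linarith
  rw [trueShare, h.trueShare_denom_eq hm hp hne, h.rate0_eq hm hp hne, h.meanShare_eq hm]
  field_simp
  ring

/-- The closed form recovers the misclassification rates of a mixture. -/
lemma IsMixture.rates_eq (h : IsMixture p π m) (hm : ∀ d, m (0, d) ≠ 0) (hp : p 0 + p 1 < 1)
    (hne : π 1 ≠ π 0) (hpos : π 1 ≠ 0) : rates m = p := by
  have h1 : rate1 m = p 1 := by
    rw [rate1, h.trueShare_eq hm hp hne hpos, h.rate0_eq hm hp hne, h.meanShare_eq hm]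
    field_simp; ring
  ext i
  fin_cases i
  · simp [rates, h.rate0_eq hm hp hne]
  · simp [rates, h1]

/-- At a mixture all denominators and the radicand in the closed form are nonzero. -/
lemma IsMixture.hasStrictFDerivAt_rates (h : IsMixture p π m) (hm : ∀ d, m (0, d) ≠ 0)
    (hp : p 0 + p 1 < 1) (hne : π 1 ≠ π 0) (hpos : π 1 ≠ 0) :
    HasStrictFDerivAt rates (fderiv ℝ rates m) m := by
  have hc : 1 - p 0 - p 1 ≠ 0 := by linarith
  have hl : ∀ t d, ContDiffAt ℝ 1 (fun m => linkShare m t d) m := fun t d => by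
    unfold linkShare
    exact ContDiffAt.div (by fun_prop) (by fun_prop) (hm d)
  have hmean : ContDiffAt ℝ 1 meanShare m := by
    unfold meanShare
    exact ((hl 1 1).add (hl 2 1)).div_const 2
  have hC1 : ContDiffAt ℝ 1 coefC1 m := by
    unfold coefC1
    refine ((hmean.sub contDiffAt_const).add
      (((hl 3 0).sub (hl 3 1)).div ((hl 2 0).sub hmean) ?_)).sub
      (contDiffAt_const.sub hmean)
    rw [h.two_sub_mean hm]
    exact mul_ne_zero hc (sub_ne_zero.2 hne.symm)
  have hC0 : ContDiffAt ℝ 1 coefC0 m := by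
    unfold coefC0
    exact ((hmean.add hmean).sub (hmean.mul hmean)).sub (hl 3 1)
  have hxi : ContDiffAt ℝ 1 rootXi m := by
    unfold rootXi
    refine (hC1.add (((hC1.pow 2).add (contDiffAt_const.mul hC0)).sqrt ?_)).div_const 2
    rw [h.disc_eq hm hp hne]
    exact pow_ne_zero 2 hc
  have h0 : ContDiffAt ℝ 1 rate0 m := by
    unfold rate0
    exact hmean.sub hxi
  have hts : ContDiffAt ℝ 1 trueShare m := by
    unfold trueShare
    have h1 := (contDiffAt_const (c := (1 : ℝ)).sub h0).mul (hmean.sub h0)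
    refine ((hmean.sub h0).mul (hmean.sub h0)).div ((h1.add h1).sub ((hl 3 1).sub
      ((h0.add h0).sub (h0.mul h0)))) ?_
    rw [h.trueShare_denom_eq hm hp hne]
    exact mul_ne_zero (pow_ne_zero 2 hc) hpos
  have h1 : ContDiffAt ℝ 1 rate1 m := by
    unfold rate1
    refine (contDiffAt_const.sub h0).sub ((hmean.sub h0).div hts ?_)
    rw [h.trueShare_eq hm hp hne hpos]; exact hpos
  have hr : ContDiffAt ℝ 1 rates m := by
    rw [contDiffAt_pi]
    intro i
    fin_cases i
    · exact h0
    · exact h1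
  exact hr.hasStrictFDerivAt (by norm_num)

lemma jacobian_mulVec {κ ι : Type*} [Fintype κ] [DecidableEq κ] [Fintype ι]
    (f : (κ → ℝ) → (ι → ℝ)) (x δ : κ → ℝ) : Matrix.mulVec (jacobian f x) δ = fderiv ℝ f x δ := by
  rw [jacobian, LinearMap.toMatrix'_mulVec]; rfl

end

/-! ### Measurability of random matrices -/

section
variable {α : Type*} {_mα : MeasurableSpace α}

lemma measurable_matrix_iff {m n : Type*} [Countable m] [Countable n] {f : α → Matrix m n ℝ} :
    Measurable f ↔ ∀ i j, Measurable fun a => f a i j := by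
  constructor
  · intro h i j
    exact (measurable_pi_apply j).comp ((measurable_pi_apply i).comp h)
  · intro h
    exact measurable_pi_iff.2 fun i => measurable_pi_iff.2 fun j => h i j

lemma Measurable.matrix_apply {m n : Type*} {f : α → Matrix m n ℝ}
    (h : Measurable f) (i : m) (j : n) : Measurable fun a => f a i j :=
  (measurable_pi_apply j).comp ((measurable_pi_apply i).comp h)

variable {ι κ μ : Type*} [Fintype ι] [Fintype κ] [Fintype μ]

lemma measurable_matrix_mul {f : α → Matrix ι κ ℝ} {g : α → Matrix κ μ ℝ} (hf : Measurable f)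
    (hg : Measurable g) : Measurable fun a => f a * g a := by
  refine measurable_matrix_iff.2 fun i j => ?_
  simp only [Matrix.mul_apply]
  exact Finset.measurable_sum _ fun k _ => (hf.matrix_apply i k).mul (hg.matrix_apply k j)

lemma measurable_matrix_transpose {f : α → Matrix ι κ ℝ} (hf : Measurable f) :
    Measurable fun a => (f a).transpose :=
  measurable_matrix_iff.2 fun i j => hf.matrix_apply j i

omit [Fintype ι] in
lemma measurable_matrix_mulVec {f : α → Matrix ι κ ℝ} {g : α → κ → ℝ} (hf : Measurable f)
    (hg : Measurable g) : Measurable fun a => Matrix.mulVec (f a) (g a) := by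
  refine measurable_pi_iff.2 fun i => ?_
  simp only [Matrix.mulVec, dotProduct]
  exact Finset.measurable_sum _ fun k _ =>
    (hf.matrix_apply i k).mul ((measurable_pi_apply k).comp hg)

variable [DecidableEq ι]

lemma measurable_matrix_det {f : α → Matrix ι ι ℝ} (hf : Measurable f) :
    Measurable fun a => (f a).det := by
  simp only [Matrix.det_apply]
  refine Finset.measurable_sum _ fun σ _ => ?_
  exact (Finset.measurable_prod _ fun i _ => hf.matrix_apply _ _).const_smul (Equiv.Perm.sign σ)

lemma measurable_matrix_inv {f : α → Matrix ι ι ℝ} (hf : Measurable f) :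
    Measurable fun a => (f a)⁻¹ := by
  refine measurable_matrix_iff.2 fun i j => ?_
  simp only [Matrix.inv_def, Ring.inverse_eq_inv', Matrix.smul_apply, smul_eq_mul,
    Matrix.adjugate_apply]
  refine (measurable_matrix_det hf).inv.mul (measurable_matrix_det ?_)
  refine measurable_matrix_iff.2 fun k l => ?_
  simp only [Matrix.updateRow_apply]
  split_ifs
  · exact measurable_const
  · exact hf.matrix_apply k l

end

/-! ### Bounded multipliers and conditional means of the reports -/

/-- A bounded function, measurable with respect to the σ-algebra `m` (in most uses a sub-σ-algebra
of the ambient one). -/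
structure IsBddMeas {Ω : Type*} (m : MeasurableSpace Ω) (f : Ω → ℝ) : Prop where
  meas : Measurable[m] f
  bdd : ∃ C, ∀ ω, |f ω| ≤ C

namespace IsBddMeas
variable {Ω : Type*} {m m' : MeasurableSpace Ω} {f g : Ω → ℝ}

lemma const (c : ℝ) : IsBddMeas m (fun _ => c) := ⟨measurable_const, |c|, fun _ => le_rfl⟩

lemma mul (hf : IsBddMeas m f) (hg : IsBddMeas m g) : IsBddMeas m (fun ω => f ω * g ω) := by
  obtain ⟨C, hC⟩ := hf.bdd
  obtain ⟨D, hD⟩ := hg.bdd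
  refine ⟨hf.meas.mul hg.meas, C * D, fun ω => ?_⟩
  rw [abs_mul]
  exact mul_le_mul (hC ω) (hD ω) (abs_nonneg _) ((abs_nonneg _).trans (hC ω))

lemma add (hf : IsBddMeas m f) (hg : IsBddMeas m g) : IsBddMeas m (fun ω => f ω + g ω) := by
  obtain ⟨C, hC⟩ := hf.bdd
  obtain ⟨D, hD⟩ := hg.bdd
  exact ⟨hf.meas.add hg.meas, C + D, fun ω => (abs_add_le _ _).trans (add_le_add (hC ω) (hD ω))⟩

lemma sub (hf : IsBddMeas m f) (hg : IsBddMeas m g) : IsBddMeas m (fun ω => f ω - g ω) := by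
  simpa [sub_eq_add_neg] using hf.add ((const (-1)).mul hg)

lemma sum {ι : Type*} (s : Finset ι) {f : ι → Ω → ℝ} (hf : ∀ i ∈ s, IsBddMeas m (f i)) :
    IsBddMeas m (fun ω => ∑ i ∈ s, f i ω) := by
  classical
  induction s using Finset.induction_on with
  | empty => simpa using const 0
  | insert a s ha ih =>
    simp only [Finset.sum_insert ha]
    exact (hf a (Finset.mem_insert_self _ _)).add (ih fun i hi =>
      hf i (Finset.mem_insert_of_mem hi))

lemma mono (hf : IsBddMeas m f) (h : m ≤ m') : IsBddMeas m' f := ⟨hf.meas.mono h le_rfl, hf.bdd⟩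

lemma integrable_mul [mΩ : MeasurableSpace Ω] {P : Measure Ω} (hf : IsBddMeas m f) (h : m ≤ mΩ)
    (hg : Integrable g P) : Integrable (fun ω => f ω * g ω) P := by
  obtain ⟨C, hC⟩ := hf.bdd
  exact hg.bdd_mul (hf.meas.mono h le_rfl).aestronglyMeasurable (ae_of_all _ hC)

lemma integrable [mΩ : MeasurableSpace Ω] {P : Measure Ω} [IsFiniteMeasure P] (hf : IsBddMeas m f)
    (h : m ≤ mΩ) :
    Integrable f P := by
  simpa using hf.integrable_mul (P := P) h (integrable_const (1 : ℝ))

end IsBddMeas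

lemma integral_mul_condExp_eq {Ω : Type*} {m : MeasurableSpace Ω} [mΩ : MeasurableSpace Ω]
    {P : Measure Ω} [IsFiniteMeasure P] (hm : m ≤ mΩ) {f g h : Ω → ℝ}
    (hg : IsBddMeas m g) (hf : Integrable f P) (hfh : P[f | m] =ᵐ[P] h) : ∫ ω, g ω * f ω ∂P = ∫ ω, g ω * h ω ∂P := by
  have h1 := condExp_mul_of_stronglyMeasurable_left (μ := P) (hg.meas.stronglyMeasurable)
    (hg.integrable_mul hm hf) hf
  rw [← integral_condExp hm]
  refine integral_congr_ae ?_
  filter_upwards [h1, hfh] with ω e1 e2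
  rw [← e2]; exact e1

section group
variable {Ω : Type*} [mΩ : MeasurableSpace Ω] {P : Measure Ω} [IsProbabilityMeasure P] {n K : ℕ}

/-- The σ-algebra generated by the actual network and the covariates. -/
abbrev sigmaGX (G : Ω → Matrix (Fin n) (Fin n) ℝ) (X : Ω → Matrix (Fin n) (Fin K) ℝ) :
    MeasurableSpace Ω := MeasurableSpace.comap (fun ω => (G ω, X ω)) inferInstance

/-- The σ-algebra generated by the actual network, the covariates and the reported network. -/
abbrev sigmaGXH (G H : Ω → Matrix (Fin n) (Fin n) ℝ) (X : Ω → Matrix (Fin n) (Fin K) ℝ) :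
    MeasurableSpace Ω := MeasurableSpace.comap (fun ω => (G ω, X ω, H ω)) inferInstance

variable {G H : Ω → Matrix (Fin n) (Fin n) ℝ} {X : Ω → Matrix (Fin n) (Fin K) ℝ} {p : Fin 2 → ℝ}

lemma sigmaGX_le (hG : Measurable G) (hX : Measurable X) : sigmaGX G X ≤ mΩ :=
  (hG.prodMk hX).comap_le

lemma sigmaGXH_le (hG : Measurable G) (hH : Measurable H) (hX : Measurable X) : sigmaGXH G H X ≤
    mΩ :=
  (hG.prodMk (hX.prodMk hH)).comap_le

omit mΩ in
lemma measurable_sigmaGX (G : Ω → Matrix (Fin n) (Fin n) ℝ) (X : Ω → Matrix (Fin n) (Fin K) ℝ) :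
    Measurable[sigmaGX G X] G ∧ Measurable[sigmaGX G X] X := by
  have := comap_measurable (m := inferInstance) (fun ω => (G ω, X ω))
  exact ⟨measurable_fst.comp this, measurable_snd.comp this⟩

omit mΩ in
lemma measurable_sigmaGXH (G H : Ω → Matrix (Fin n) (Fin n) ℝ) (X : Ω → Matrix (Fin n) (Fin K) ℝ) :
    Measurable[sigmaGXH G H X] G ∧ Measurable[sigmaGXH G H X] X ∧ Measurable[sigmaGXH G H X] H := by
  have := comap_measurable (m := inferInstance) (fun ω => (G ω, X ω, H ω))
  exact ⟨measurable_fst.comp this, (measurable_fst.comp measurable_snd).comp this,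
    (measurable_snd.comp measurable_snd).comp this⟩

omit mΩ in
lemma sigmaGX_le_sigmaGXH : sigmaGX G X ≤ sigmaGXH G H X := by
  have h := measurable_sigmaGXH G H X
  exact (h.1.prodMk h.2.1).comap_le

omit mΩ in
lemma isBddMeas_adjacency {m : MeasurableSpace Ω} {A : Ω →
    Matrix (Fin n) (Fin n) ℝ} (hA : Measurable[m] A)
    (hadj : ∀ ω, IsAdjacency (A ω)) (i j : Fin n) : IsBddMeas m (fun ω => A ω i j) := by
  refine ⟨hA.matrix_apply i j, 1, fun ω => ?_⟩
  rcases (hadj ω).1 i j with h | h <;> simp [h]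

omit [IsProbabilityMeasure P] in
/-- The conditional probability of a reported link, in the form that is affine in the link. -/
lemma condExp_link (hGadj : ∀ ω, IsAdjacency (G ω)) (hA1 : AssumptionA1 P G H X)
    (hA2 : AssumptionA2 P G H X p)
    {i j : Fin n} (hij : i ≠ j) :
    P[fun ω => H ω i j | sigmaGX G X] =ᵐ[P] fun ω => p 0 + (1 - p 0 - p 1) * G ω i j := by
  filter_upwards [hA1 i j, hA2.1 i j hij] with ω h1 h2
  rw [h1]
  rcases (hGadj ω).1 i j with h | h
  · rw [h2.2 h, h]; ring
  · rw [h2.1 h, h]; ring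

omit mΩ in
lemma indicator_eq_entry (hHadj : ∀ ω, IsAdjacency (H ω)) (i j : Fin n) :
    ((fun ω => H ω i j) ⁻¹' {1}).indicator (fun _ => (1 : ℝ)) = fun ω => H ω i j := by
  ext ω
  rcases (hHadj ω).1 i j with h | h <;> simp [h]

omit mΩ in
lemma indicator_inter_eq_mul (hHadj : ∀ ω, IsAdjacency (H ω)) (i j k l : Fin n) :
    ((fun ω => H ω i j) ⁻¹' {1} ∩ (fun ω => H ω k l) ⁻¹' {1}).indicator (fun _ => (1 : ℝ)) =
      fun ω => H ω i j * H ω k l := by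
  ext ω
  rcases (hHadj ω).1 i j with h | h <;> rcases (hHadj ω).1 k l with h' | h' <;>
    simp [h, h']

omit [IsProbabilityMeasure P] in
lemma condExp_two_links (hGadj : ∀ ω, IsAdjacency (G ω)) (hHadj : ∀ ω, IsAdjacency (H ω))
    (hA1 : AssumptionA1 P G H X) (hA2 : AssumptionA2 P G H X p) (hA4 : AssumptionA4 P G H X)
    {i j k l : Fin n} (hij : i ≠ j) (hkl : k ≠ l) (hne : (i, j) ≠ (k, l)) :
    P[fun ω => H ω i j * H ω k l | sigmaGX G X] =ᵐ[P]
      fun ω => (p 0 + (1 - p 0 - p 1) * G ω i j) * (p 0 + (1 - p 0 - p 1) * G ω k l) := by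
  have h := hA4 i j k l hne {1} {1} (measurableSet_singleton _) (measurableSet_singleton _)
  rw [indicator_inter_eq_mul hHadj, indicator_eq_entry hHadj, indicator_eq_entry hHadj] at h
  filter_upwards [h, condExp_link hGadj hA1 hA2 hij, condExp_link hGadj hA1 hA2 hkl]
    with ω e e1 e2
  rw [e, Pi.mul_apply, e1, e2]

end group

/-! ### Expected moments of the reports -/

section group
variable {Ω : Type*} [mΩ : MeasurableSpace Ω] {P : Measure Ω} [IsProbabilityMeasure P] {n K : ℕ}
  {G H : Ω → Matrix (Fin n) (Fin n) ℝ} {X : Ω → Matrix (Fin n) (Fin K) ℝ} {p : Fin 2 → ℝ}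

/-- The standing assumptions on the actual network `G`, the reported network `H` and the covariates
`X` of one group: measurability, binary entries with a zero diagonal, undirected actual links, and
the assumptions (A1), (A2) and (A4) on the reports. The outcome and its error do not enter. -/
structure LinkModel (P : Measure Ω) (G H : Ω → Matrix (Fin n) (Fin n) ℝ)
    (X : Ω → Matrix (Fin n) (Fin K) ℝ) (p : Fin 2 → ℝ) : Prop where
  measG : Measurable G
  measH : Measurable H
  measX : Measurable X
  adjG : ∀ ω, IsAdjacency (G ω)
  adjH : ∀ ω, IsAdjacency (H ω)
  symmG : ∀ᵐ ω ∂P, (G ω).IsSymm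
  a1 : AssumptionA1 P G H X
  a2 : AssumptionA2 P G H X p
  a4 : AssumptionA4 P G H X

namespace LinkModel
variable (h : LinkModel P G H X p)
include h

omit [IsProbabilityMeasure P] in
lemma bddG (i j : Fin n) : IsBddMeas (sigmaGX G X) (fun ω => G ω i j) :=
  isBddMeas_adjacency (measurable_sigmaGX G X).1 h.adjG i j

omit [IsProbabilityMeasure P] in
lemma bddH (i j : Fin n) : IsBddMeas (sigmaGXH G H X) (fun ω => H ω i j) :=
  isBddMeas_adjacency (measurable_sigmaGXH G H X).2.2 h.adjH i j

omit [IsProbabilityMeasure P] in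
lemma le : sigmaGX G X ≤ mΩ := sigmaGX_le h.measG h.measX

omit [IsProbabilityMeasure P] in
lemma leH : sigmaGXH G H X ≤ mΩ := sigmaGXH_le h.measG h.measH h.measX

lemma integral_mul_link {g : Ω → ℝ} (hg : IsBddMeas (sigmaGX G X) g) {i j : Fin n} (hij : i ≠ j) :
    ∫ ω, g ω * H ω i j ∂P = ∫ ω, g ω * (p 0 + (1 - p 0 - p 1) * G ω i j) ∂P :=
  integral_mul_condExp_eq h.le hg ((h.bddH i j).integrable h.leH)
    (condExp_link h.adjG h.a1 h.a2 hij)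

lemma integral_mul_two_links {g : Ω → ℝ} (hg : IsBddMeas (sigmaGX G X) g) {i j k l : Fin n}
    (hij : i ≠ j) (hkl : k ≠ l) (hne : (i, j) ≠ (k, l)) :
    ∫ ω, g ω * (H ω i j * H ω k l) ∂P = ∫ ω, g ω *
      ((p 0 + (1 - p 0 - p 1) * G ω i j) * (p 0 + (1 - p 0 - p 1) * G ω k l)) ∂P :=
  integral_mul_condExp_eq h.le hg (((h.bddH i j).mul (h.bddH k l)).integrable h.leH)
    (condExp_two_links h.adjG h.adjH h.a1 h.a2 h.a4 hij hkl hne)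

/-- The maximum of the two reports on a pair has a conditional mean that is affine in the true link.
This is where conditional independence of the two reports and symmetry of `G` are used. -/
lemma integral_mul_pair {g : Ω → ℝ} (hg : IsBddMeas (sigmaGX G X) g) {i j : Fin n} (hij : i ≠ j) :
    ∫ ω, g ω * max (H ω i j) (H ω j i) ∂P = (2 * p 0 - p 0 ^ 2) * ∫ ω, g ω ∂P +
      (1 - p 0 - p 1) * (1 - p 0 + p 1) * ∫ ω, g ω * G ω i j ∂P := by
  have hmax : ∀ ω, g ω * max (H ω i j) (H ω j i) =
      g ω * H ω i j + g ω * H ω j i - g ω * (H ω i j * H ω j i) := by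
    intro ω
    rcases (h.adjH ω).1 i j with e | e <;> rcases (h.adjH ω).1 j i with e' | e' <;> simp [e, e']
  have hgi := hg.mono (m' := sigmaGXH G H X) sigmaGX_le_sigmaGXH
  have iL : ∀ {f : Ω → ℝ}, IsBddMeas (sigmaGXH G H X) f → Integrable f P :=
    fun hf => hf.integrable h.leH
  have iG : ∀ {f : Ω → ℝ}, IsBddMeas (sigmaGX G X) f → Integrable f P :=
    fun hf => hf.integrable h.le
  have bl : ∀ a b : Fin n, IsBddMeas (sigmaGX G X) (fun ω => p 0 + (1 - p 0 - p 1) * G ω a b) :=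
    fun a b => (IsBddMeas.const _).add ((IsBddMeas.const _).mul (h.bddG a b))
  simp_rw [hmax]
  rw [integral_sub (iL ((hgi.mul (h.bddH i j)).add (hgi.mul (h.bddH j i))))
    (iL (hgi.mul ((h.bddH i j).mul (h.bddH j i)))),
    integral_add (iL (hgi.mul (h.bddH i j))) (iL (hgi.mul (h.bddH j i))),
    h.integral_mul_link hg hij, h.integral_mul_link hg hij.symm,
    h.integral_mul_two_links hg hij hij.symm (by simp [hij]),
    ← integral_add (iG (hg.mul (bl i j))) (iG (hg.mul (bl j i))),
    ← integral_sub (iG ((hg.mul (bl i j)).add (hg.mul (bl j i))))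
      (iG (hg.mul ((bl i j).mul (bl j i)))), ← integral_const_mul, ← integral_const_mul,
    ← integral_add ((iG hg).const_mul _) ((iG (hg.mul (h.bddG i j))).const_mul _)]
  refine integral_congr_ae ?_
  filter_upwards [h.symmG] with ω hs
  have e : G ω j i = G ω i j := hs.apply i j
  rcases (h.adjG ω).1 i j with e' | e' <;> rw [e, e'] <;> ring

/-- The adjusted measure is conditionally unbiased: `E (W(p) | G, X) = G`. -/
lemma integral_mul_sub_adjusted {g : Ω → ℝ} (hg : IsBddMeas (sigmaGX G X) g) (k j : Fin n) :
    ∫ ω, g ω * (G ω - adjusted (H ω) p) k j ∂P = 0 := by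
  have hc : 1 - p 0 - p 1 ≠ 0 := by linarith [h.a2.2]
  rcases eq_or_ne k j with rfl | hkj
  · have : ∀ ω, (G ω - adjusted (H ω) p) k k = 0 := fun ω => by
      simp [adjusted, (h.adjG ω).2 k, (h.adjH ω).2 k]
    simp [this]
  have hgi := hg.mono (m' := sigmaGXH G H X) sigmaGX_le_sigmaGXH
  have e : ∀ ω, g ω * (G ω - adjusted (H ω) p) k j =
      g ω * (G ω k j + (1 - p 0 - p 1)⁻¹ * p 0) - (1 - p 0 - p 1)⁻¹ * (g ω * H ω k j) := by
    intro ω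
    simp [adjusted, Matrix.one_apply_ne hkj]; ring
  have b1 := hg.mul ((h.bddG k j).add (IsBddMeas.const ((1 - p 0 - p 1)⁻¹ * p 0)))
  simp_rw [e]
  rw [integral_sub (b1.integrable h.le) (((hgi.mul (h.bddH k j)).integrable h.leH).const_mul _),
    integral_const_mul, h.integral_mul_link hg hkj, ← integral_const_mul, sub_eq_zero]
  congr 1; ext ω; field_simp; ring

/-- The measurement error of one pair is conditionally uncorrelated with the report on another pair.
The entries `(i, k)` and `(k, j)` coincide only on the diagonal, where `H` vanishes. -/
lemma integral_mul_link_mul_sub_adjusted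
    {g : Ω → ℝ} (hg : IsBddMeas (sigmaGX G X) g) (i k j : Fin n) :
    ∫ ω, g ω * (H ω i k * (G ω - adjusted (H ω) p) k j) ∂P = 0 := by
  have hc : 1 - p 0 - p 1 ≠ 0 := by linarith [h.a2.2]
  rcases eq_or_ne k j with rfl | hkj
  · have : ∀ ω, (G ω - adjusted (H ω) p) k k = 0 := fun ω => by
      simp [adjusted, (h.adjG ω).2 k, (h.adjH ω).2 k]
    simp [this]
  rcases eq_or_ne i k with rfl | hik
  · have : ∀ ω, H ω i i = 0 := fun ω => (h.adjH ω).2 i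
    simp [this]
  have hgi := hg.mono (m' := sigmaGXH G H X) sigmaGX_le_sigmaGXH
  have e : ∀ ω, g ω * (H ω i k * (G ω - adjusted (H ω) p) k j) =
      g ω * (G ω k j + (1 - p 0 - p 1)⁻¹ * p 0) * H ω i k
        - (1 - p 0 - p 1)⁻¹ * (g ω * (H ω i k * H ω k j)) := by
    intro ω
    simp [adjusted, Matrix.one_apply_ne hkj]; ring
  have b1 := hg.mul ((h.bddG k j).add (IsBddMeas.const ((1 - p 0 - p 1)⁻¹ * p 0)))
  have b1' := b1.mono (m' := sigmaGXH G H X) sigmaGX_le_sigmaGXH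
  simp_rw [e]
  rw [integral_sub ((b1'.mul (h.bddH i k)).integrable h.leH)
    (((hgi.mul ((h.bddH i k).mul (h.bddH k j))).integrable h.leH).const_mul _),
    integral_const_mul, h.integral_mul_link b1 hik,
    h.integral_mul_two_links hg hik hkj (by simp [hik]), ← integral_const_mul, sub_eq_zero]
  congr 1; ext ω; field_simp; ring

end LinkModel

lemma integral_pairAverage {φ : Ω → Fin n → Fin n → Fin 2} {d : Fin 2} {f : Ω → Fin n → Fin n → ℝ}
    (hf : ∀ i j, Integrable (fun ω => (if φ ω i j = d then (1 : ℝ) else 0) * f ω i j) P) :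
    ∫ ω, pairAverage (φ ω) d (f ω) ∂P = 2 / ((n : ℝ) * ((n : ℝ) - 1)) * ∑ i, ∑ j,
      if j < i then ∫ ω, (if φ ω i j = d then (1 : ℝ) else 0) * f ω i j ∂P else 0 := by
  have e : ∀ i j ω, (if j < i ∧ φ ω i j = d then f ω i j else 0) =
      if j < i then (if φ ω i j = d then (1 : ℝ) else 0) * f ω i j else 0 := by
    intro i j ω
    by_cases h1 : j < i <;> by_cases h2 : φ ω i j = d <;> simp [h1, h2]
  simp only [pairAverage, e]
  have hint : ∀ i j, Integrable (fun ω =>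
      if j < i then (if φ ω i j = d then (1 : ℝ) else 0) * f ω i j else 0) P := by
    intro i j
    by_cases h1 : j < i
    · simpa [h1] using hf i j
    · simp [h1]
  rw [integral_const_mul, integral_finsetSum _ fun i _ => integrable_finsetSum _ fun j _ =>
    hint i j]
  congr 1
  refine Finset.sum_congr rfl fun i _ => ?_
  rw [integral_finsetSum _ fun j _ => hint i j]
  refine Finset.sum_congr rfl fun j _ => ?_
  by_cases h1 : j < i <;> simp [h1]

omit mΩ in
lemma isBddMeas_pairType {φ : Matrix (Fin n) (Fin K) ℝ → Fin n → Fin n → Fin 2}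
    (hφ : ∀ i j, Measurable (fun x => φ x i j)) (d : Fin 2) (i j : Fin n) :
    IsBddMeas (sigmaGX G X) (fun ω => if φ (X ω) i j = d then (1 : ℝ) else 0) := by
  refine ⟨?_, 1, fun ω => ?_⟩
  · have : Measurable (fun x => if φ x i j = d then (1 : ℝ) else 0) :=
      Measurable.ite ((hφ i j) (measurableSet_singleton d)) measurable_const measurable_const
    exact this.comp (measurable_sigmaGX G X).2
  · split_ifs <;> simp

section
variable (h : LinkModel P G H X p) {φ : Matrix (Fin n) (Fin K) ℝ → Fin n → Fin n → Fin 2}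
  (hφ : ∀ i j, Measurable (fun x => φ x i j))
include h hφ

/-- The expected moments of a group have the mixture structure, with the expected frequencies of
true links in the role of `π d * m (0, d)`. -/
lemma LinkModel.integral_groupMoments (d : Fin 2) :
    ∫ ω, groupMoments (φ (X ω)) (H ω) (1, d) ∂P =
      p 0 * ∫ ω, groupMoments (φ (X ω)) (H ω) (0, d) ∂P +
        (1 - p 0 - p 1) * ∫ ω, pairAverage (φ (X ω)) d (G ω) ∂P ∧
    ∫ ω, groupMoments (φ (X ω)) (H ω) (2, d) ∂P =
      p 0 * ∫ ω, groupMoments (φ (X ω)) (H ω) (0, d) ∂P +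
        (1 - p 0 - p 1) * ∫ ω, pairAverage (φ (X ω)) d (G ω) ∂P ∧
    ∫ ω, groupMoments (φ (X ω)) (H ω) (3, d) ∂P =
      (2 * p 0 - p 0 ^ 2) * ∫ ω, groupMoments (φ (X ω)) (H ω) (0, d) ∂P +
        (1 - p 0 - p 1) * (1 - p 0 + p 1) * ∫ ω, pairAverage (φ (X ω)) d (G ω) ∂P := by
  have hg := isBddMeas_pairType (G := G) (X := X) hφ d
  have hgi := fun i j => (hg i j).mono (m' := sigmaGXH G H X) sigmaGX_le_sigmaGXH
  have iL : ∀ {f : Ω → ℝ}, IsBddMeas (sigmaGXH G H X) f → Integrable f P :=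
    fun hf => hf.integrable h.leH
  have iG : ∀ {f : Ω → ℝ}, IsBddMeas (sigmaGX G X) f → Integrable f P :=
    fun hf => hf.integrable h.le
  have hmaxb : ∀ i j, IsBddMeas (sigmaGXH G H X) (fun ω => max (H ω i j) (H ω j i)) := by
    intro i j
    refine ⟨(h.bddH i j).meas.max (h.bddH j i).meas, 1, fun ω => ?_⟩
    rcases (h.adjH ω).1 i j with e | e <;> rcases (h.adjH ω).1 j i with e' | e' <;> simp [e, e']
  -- a conditional mean that is affine in the true link, pair by pair, is so on average
  have key : ∀ (f : Ω → Fin n → Fin n → ℝ) (a b : ℝ),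
      (∀ i j, IsBddMeas (sigmaGXH G H X) (fun ω => f ω i j)) →
      (∀ i j, j < i → ∫ ω, (if φ (X ω) i j = d then (1 : ℝ) else 0) * f ω i j ∂P =
        a * ∫ ω, (if φ (X ω) i j = d then (1 : ℝ) else 0) ∂P +
        b * ∫ ω, (if φ (X ω) i j = d then (1 : ℝ) else 0) * G ω i j ∂P) →
      ∫ ω, pairAverage (φ (X ω)) d (f ω) ∂P =
        a * ∫ ω, groupMoments (φ (X ω)) (H ω) (0, d) ∂P +
        b * ∫ ω, pairAverage (φ (X ω)) d (G ω) ∂P := by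
    intro f a b hf hab
    rw [integral_pairAverage fun i j => iL ((hgi i j).mul (hf i j))]
    have e0 : ∫ ω, groupMoments (φ (X ω)) (H ω) (0, d) ∂P = _ :=
      integral_pairAverage (P := P) (φ := fun ω => φ (X ω)) (d := d) (f :=
        fun ω => pairMeasure (H ω) 0)
        (fun i j => by simpa [pairMeasure] using iG (hg i j))
    rw [e0, integral_pairAverage (f := fun ω => G ω) fun i j => iG ((hg i j).mul (h.bddG i j))]
    simp only [pairMeasure, Matrix.cons_val_zero, mul_one]
    rw [mul_left_comm a, mul_left_comm b, ← mul_add, Finset.mul_sum _ _ a, Finset.mul_sum _ _ b,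
      ← Finset.sum_add_distrib]
    congr 1
    refine Finset.sum_congr rfl fun i _ => ?_
    rw [Finset.mul_sum _ _ a, Finset.mul_sum _ _ b, ← Finset.sum_add_distrib]
    refine Finset.sum_congr rfl fun j _ => ?_
    by_cases hji : j < i
    · simpa [hji] using hab i j hji
    · simp [hji]
  have lin : ∀ i j : Fin n, ∫ ω, (if φ (X ω) i j =
    d then (1 : ℝ) else 0) * (p 0 + (1 - p 0 - p 1) * G ω i j) ∂P
      = p 0 * ∫ ω, (if φ (X ω) i j = d then (1 : ℝ) else 0) ∂P +
        (1 - p 0 - p 1) * ∫ ω, (if φ (X ω) i j = d then (1 : ℝ) else 0) * G ω i j ∂P := by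
    intro i j
    rw [← integral_const_mul, ← integral_const_mul, ← integral_add ((iG (hg i j)).const_mul _)
      ((iG ((hg i j).mul (h.bddG i j))).const_mul _)]
    congr 1; ext ω; ring
  refine ⟨?_, ?_, ?_⟩
  · refine key (fun ω => pairMeasure (H ω) 1) _ _ (fun i j =>
      by simpa [pairMeasure] using h.bddH i j) ?_
    intro i j hji
    simp only [pairMeasure, Matrix.cons_val_one, Matrix.cons_val_zero]
    rw [h.integral_mul_link (hg i j) hji.ne', lin]
  · refine key (fun ω => pairMeasure (H ω) 2) _ _ (fun i j =>
      by simpa [pairMeasure] using h.bddH j i) ?_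
    intro i j hji
    simp only [pairMeasure, Matrix.cons_val]
    rw [h.integral_mul_link (hg i j) hji.ne, ← lin]
    refine integral_congr_ae ?_
    filter_upwards [h.symmG] with ω hs
    rw [hs.apply i j]
  · refine key (fun ω => pairMeasure (H ω) 3) _ _ (fun i j =>
      by simpa [pairMeasure] using hmaxb i j) ?_
    intro i j hji
    simp only [pairMeasure, Matrix.cons_val]
    exact h.integral_mul_pair (hg i j) hji.ne'

end
end group

/-! ### Orthogonality of the instruments and the composite error -/

/-- An integrable function with vanishing mean. -/
structure IsCentered {Ω : Type*} [MeasurableSpace Ω] (P : Measure Ω) (f : Ω → ℝ) : Prop where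
  integrable : Integrable f P
  mean : ∫ ω, f ω ∂P = 0

namespace IsCentered
variable {Ω : Type*} [MeasurableSpace Ω] {P : Measure Ω} {f g : Ω → ℝ}

lemma add (hf : IsCentered P f) (hg : IsCentered P g) : IsCentered P (fun ω => f ω + g ω) :=
  ⟨hf.1.add hg.1, by rw [integral_add hf.1 hg.1, hf.2, hg.2, add_zero]⟩

lemma const_mul (c : ℝ) (hf : IsCentered P f) : IsCentered P (fun ω => c * f ω) :=
  ⟨hf.1.const_mul c, by rw [integral_const_mul, hf.2, mul_zero]⟩

lemma sum {ι : Type*} (s : Finset ι) {f : ι → Ω → ℝ} (hf : ∀ i ∈ s, IsCentered P (f i)) :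
    IsCentered P (fun ω => ∑ i ∈ s, f i ω) :=
  ⟨integrable_finsetSum _ fun i hi => (hf i hi).1, by
    rw [integral_finsetSum _ fun i hi => (hf i hi).1]
    exact Finset.sum_eq_zero fun i hi => (hf i hi).2⟩

lemma congr (hf : IsCentered P f) (h : f =ᵐ[P] g) : IsCentered P g :=
  ⟨hf.1.congr h, by rw [← integral_congr_ae h, hf.2]⟩

end IsCentered

section group
variable {Ω : Type*} [mΩ : MeasurableSpace Ω] {P : Measure Ω} [IsProbabilityMeasure P] {n K : ℕ}
  {G H : Ω → Matrix (Fin n) (Fin n) ℝ} {X : Ω → Matrix (Fin n) (Fin K) ℝ} {p : Fin 2 → ℝ}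
  {ε y : Ω → Fin n → ℝ} {lam : ℝ} {β : Fin K → ℝ}

lemma reduced_form {G : Matrix (Fin n) (Fin n) ℝ} {y u : Fin n → ℝ} (hinv : IsUnit (1 - lam • G))
    (hy : y = lam • Matrix.mulVec G y + u) : y = Matrix.mulVec (1 - lam • G)⁻¹ u := by
  have h1 : Matrix.mulVec (1 - lam • G) y = u := by
    rw [Matrix.sub_mulVec, Matrix.one_mulVec, Matrix.smul_mulVec]
    nth_rewrite 1 [hy]; simp
  have hdet : IsUnit (1 - lam • G).det := (Matrix.isUnit_iff_isUnit_det _).1 hinv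
  rw [← h1, Matrix.mulVec_mulVec, Matrix.nonsing_inv_mul _ hdet, Matrix.one_mulVec]

lemma integral_mul_error (hG : Measurable G) (hH : Measurable H) (hX : Measurable X)
    (hA3 : AssumptionA3 P G H X ε) {g : Ω → ℝ}
    (hg : IsBddMeas (sigmaGXH G H X) g) (l : Fin n) : IsCentered P (fun ω => g ω * ε ω l) := by
  have hle : sigmaGXH G H X ≤ mΩ := sigmaGXH_le hG hH hX
  refine ⟨hg.integrable_mul hle (hA3 l).1, ?_⟩
  rw [integral_mul_condExp_eq hle hg (hA3 l).1 (hA3 l).2]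
  simp

/-- The indicator of the event that all entries of `X` and of `(1 - lam • G)⁻¹` are at most `M` in
absolute value. It is a function of `(G, X)`, and multiplication by it makes every factor in the
expansion of the instrumented error bounded, apart from `ε`. -/
noncomputable def truncWeight (lam M : ℝ) (G : Matrix (Fin n) (Fin n) ℝ)
    (X : Matrix (Fin n) (Fin K) ℝ) : ℝ :=
  open Classical in
  if (∀ i c, |X i c| ≤ M) ∧ (∀ j l, |(1 - lam • G)⁻¹ j l| ≤ M) then 1 else 0

lemma measurable_truncWeight (lam M : ℝ) :
    Measurable fun z : Matrix (Fin n) (Fin n) ℝ × Matrix (Fin n) (Fin K) ℝ =>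
        truncWeight lam M z.1 z.2 := by
  classical
  unfold truncWeight
  refine Measurable.ite ?_ measurable_const measurable_const
  have hN : Measurable fun z : Matrix (Fin n) (Fin n) ℝ × Matrix (Fin n) (Fin K) ℝ =>
      (1 - lam • z.1)⁻¹ := by
    refine measurable_matrix_inv (measurable_matrix_iff.2 fun i j => ?_)
    simp only [Matrix.sub_apply, Matrix.smul_apply, smul_eq_mul]
    exact measurable_const.sub ((measurable_fst.matrix_apply i j).const_mul lam)
  refine MeasurableSet.inter ?_ ?_
  · exact measurableSet_setOfPred.2 <| Measurable.forall fun i => Measurable.forall fun c =>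
      measurableSet_setOfPred.1 <| measurableSet_le
        (measurable_snd.matrix_apply i c).abs measurable_const
  · exact measurableSet_setOfPred.2 <| Measurable.forall fun i => Measurable.forall fun c =>
      measurableSet_setOfPred.1 <| measurableSet_le (hN.matrix_apply i c).abs measurable_const

lemma eventually_truncWeight_eq_one (lam : ℝ) (G : Matrix (Fin n) (Fin n) ℝ)
    (X : Matrix (Fin n) (Fin K) ℝ) :
    ∀ᶠ M : ℕ in atTop, truncWeight lam M G X = 1 := by
  have h1 : ∀ᶠ M : ℕ in atTop, ∀ i c, |X i c| ≤ M :=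
    eventually_all.2 fun i => eventually_all.2 fun c =>
      tendsto_natCast_atTop_atTop.eventually_ge_atTop _
  have h2 : ∀ᶠ M : ℕ in atTop, ∀ j l, |(1 - lam • G)⁻¹ j l| ≤ M :=
    eventually_all.2 fun i => eventually_all.2 fun c =>
      tendsto_natCast_atTop_atTop.eventually_ge_atTop _
  filter_upwards [h1, h2] with M e1 e2
  unfold truncWeight
  rw [if_pos ⟨e1, e2⟩]

omit mΩ in
lemma isBddMeas_truncWeight (lam M : ℝ) :
    IsBddMeas (sigmaGX G X) (fun ω => truncWeight lam M (G ω) (X ω)) := by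
  refine ⟨(measurable_truncWeight lam M).comp
    ((measurable_sigmaGX G X).1.prodMk (measurable_sigmaGX G X).2), 1, fun ω => ?_⟩
  unfold truncWeight; split_ifs <;> simp

omit mΩ in
lemma isBddMeas_truncWeight_mul_covariate (lam M : ℝ) (i : Fin n) (c : Fin K) :
    IsBddMeas (sigmaGX G X) (fun ω => truncWeight lam M (G ω) (X ω) * X ω i c) := by
  refine ⟨(isBddMeas_truncWeight lam M).meas.mul ((measurable_sigmaGX G X).2.matrix_apply i c), |M|,
    fun ω => ?_⟩
  unfold truncWeight; split_ifs with h1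
  · rw [one_mul]; exact (h1.1 i c).trans (le_abs_self M)
  · simp

omit mΩ in
lemma isBddMeas_truncWeight_mul_inv (lam M : ℝ) (j l : Fin n) :
    IsBddMeas (sigmaGX G X) (fun ω => truncWeight lam M (G ω) (X ω) * (1 - lam • G ω)⁻¹ j l) := by
  have hN : Measurable[sigmaGX G X] fun ω => (1 - lam • G ω)⁻¹ := by
    refine measurable_matrix_inv (measurable_matrix_iff.2 fun i j => ?_)
    simp only [Matrix.sub_apply, Matrix.smul_apply, smul_eq_mul]
    exact measurable_const.sub (((measurable_sigmaGX G X).1.matrix_apply i j).const_mul lam)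
  refine ⟨(isBddMeas_truncWeight lam M).meas.mul (hN.matrix_apply j l), |M|, fun ω => ?_⟩
  unfold truncWeight; split_ifs with h1
  · rw [one_mul]; exact (h1.2 j l).trans (le_abs_self M)
  · simp

namespace LinkModel
variable (h : LinkModel P G H X p)
include h

omit [IsProbabilityMeasure P] in
lemma bdd_sub_adjusted (k j : Fin n) :
    IsBddMeas (sigmaGXH G H X) (fun ω => (G ω - adjusted (H ω) p) k j) := by
  have e : (fun ω => (G ω - adjusted (H ω) p) k j) = fun ω => G ω k j - (1 - p 0 - p 1)⁻¹ *
      (H ω k j - p 0 * (1 - (1 : Matrix (Fin n) (Fin n) ℝ) k j)) := by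
    ext ω; simp [adjusted]
  rw [e]
  exact ((h.bddG k j).mono sigmaGX_le_sigmaGXH).sub
    ((IsBddMeas.const _).mul ((h.bddH k j).sub (IsBddMeas.const _)))

/-- A truncated summand `X i c * q * v k` of the instrumented error has mean zero. The multiplier
`q` is a report or the constant `1`; `hqD` says that it is conditionally uncorrelated with the
measurement errors that enter `v k`. -/
lemma isCentered_truncated_term (hA3 : AssumptionA3 P G H X ε)
    (hy : ∀ᵐ ω ∂P, y ω = Matrix.mulVec (1 - lam • G ω)⁻¹ (Matrix.mulVec (X ω) β + ε ω))
    {q : Ω → ℝ} (hq : IsBddMeas (sigmaGXH G H X) q) (k : Fin n)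
    (hqD : ∀ (g : Ω → ℝ) (j : Fin n), IsBddMeas (sigmaGX G X) g →
      ∫ ω, g ω * (q ω * (G ω - adjusted (H ω) p) k j) ∂P = 0) (M : ℝ) (i : Fin n) (c : Fin K) :
    IsCentered P (fun ω => truncWeight lam M (G ω) (X ω) *
      (X ω i c * q ω * compositeError lam p (G ω) (H ω) (y ω) (ε ω) k)) := by
  set b : Ω → ℝ := fun ω => truncWeight lam M (G ω) (X ω) with hb
  have hbX : ∀ i c, IsBddMeas (sigmaGX G X) (fun ω => b ω * X ω i c) :=
    isBddMeas_truncWeight_mul_covariate lam M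
  have hbN := fun j l => isBddMeas_truncWeight_mul_inv (G := G) (X := X) lam M j l
  have up : ∀ {f : Ω → ℝ}, IsBddMeas (sigmaGX G X) f → IsBddMeas (sigmaGXH G H X) f :=
    fun hf => hf.mono sigmaGX_le_sigmaGXH
  have hD := h.bdd_sub_adjusted
  have err : ∀ {g : Ω → ℝ}, IsBddMeas (sigmaGXH G H X) g →
    ∀ l, IsCentered P (fun ω => g ω * ε ω l) :=
    fun hg l => integral_mul_error h.measG h.measH h.measX hA3 hg l
  have t1 : IsCentered P (fun ω => b ω * X ω i c * q ω * ε ω k) := err ((up (hbX i c)).mul hq) k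
  have t2 : IsCentered P (fun ω => lam * ∑ j, ∑ l,
    b ω * X ω i c * q ω * (G ω - adjusted (H ω) p) k j *
      (b ω * (1 - lam • G ω)⁻¹ j l) * ε ω l) :=
    (IsCentered.sum _ fun j _ => IsCentered.sum _ fun l _ =>
      err ((((up (hbX i c)).mul hq).mul (hD k j)).mul (up (hbN j l))) l).const_mul lam
  have t3 : IsCentered P (fun ω => lam * ∑ j, (b ω * X ω i c * ∑ l, (b ω * (1 - lam • G ω)⁻¹ j l) *
      ∑ m, (b ω * X ω l m) * β m) * (q ω * (G ω - adjusted (H ω) p) k j)) := by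
    refine (IsCentered.sum _ fun j _ => ?_).const_mul lam
    have hg : IsBddMeas (sigmaGX G X) (fun ω => b ω * X ω i c * ∑ l, (b ω * (1 - lam • G ω)⁻¹ j l) *
      ∑ m, (b ω * X ω l m) * β m) :=
      (hbX i c).mul (IsBddMeas.sum _ fun l _ => (hbN j l).mul
        (IsBddMeas.sum _ fun m _ => (hbX l m).mul (IsBddMeas.const _)))
    exact ⟨((up hg).mul (hq.mul (hD k j))).integrable h.leH, hqD _ j hg⟩
  -- the three terms come from `ε k`, and from the parts of `y` due to `ε` and to `X β`; the weight
  -- `b` is repeated in every factor, which is harmless since it is an indicator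
  refine ((t1.add t2).add t3).congr ?_
  filter_upwards [hy] with ω hyω
  have hb0 : b ω = 0 ∨ b ω = 1 := by
    rw [hb]; simp only; unfold truncWeight; split_ifs <;> simp
  change _ = b ω * _
  rcases hb0 with e | e
  · simp only [e]; simp
  · have hyj : ∀ j, y ω j = ∑ l, (1 - lam • G ω)⁻¹ j l * (∑ m, X ω l m * β m + ε ω l) := by
      intro j; rw [hyω]; rfl
    have hv : compositeError lam p (G ω) (H ω) (y ω) (ε ω) k = ε ω k + lam * ∑ j,
        (G ω - adjusted (H ω) p) k j * y ω j := rfl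
    rw [hv]
    simp only [e, one_mul, hyj]
    rw [add_assoc, ← mul_add, ← Finset.sum_add_distrib, mul_add, ← mul_assoc _ lam, mul_comm _ lam,
      mul_assoc lam,
      Finset.mul_sum (a := X ω i c * q ω)]
    congr 2
    refine Finset.sum_congr rfl fun j _ => ?_
    simp only [mul_add, Finset.sum_add_distrib, Finset.mul_sum, Finset.sum_mul]
    rw [add_comm]
    congr 1
    · refine Finset.sum_congr rfl fun l _ => ?_
      refine Finset.sum_congr rfl fun m _ => ?_
      ring
    · refine Finset.sum_congr rfl fun l _ => ?_
      ring

/-- The instruments are orthogonal to the composite error: `E (Z'v) = 0`. -/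
theorem integral_instrumentedError_eq_zero (hA3 : AssumptionA3 P G H X ε)
    (hy : ∀ᵐ ω ∂P, y ω = Matrix.mulVec (1 - lam • G ω)⁻¹ (Matrix.mulVec (X ω) β + ε ω))
    (a : Fin K ⊕ Fin K)
    (hint : Integrable (fun ω => instrumentedError lam p (G ω) (H ω) (X ω) (y ω) (ε ω) a) P) :
    ∫ ω, instrumentedError lam p (G ω) (H ω) (X ω) (y ω) (ε ω) a ∂P = 0 := by
  have htr : ∀ M : ℕ, ∫ ω, truncWeight lam M (G ω) (X ω) *
      instrumentedError lam p (G ω) (H ω) (X ω) (y ω) (ε ω) a ∂P = 0 := by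
    intro M
    rcases a with c | c
    · have hc : IsCentered P (fun ω => ∑ k, ∑ i, truncWeight lam M (G ω) (X ω) *
          (X ω i c * H ω i k * compositeError lam p (G ω) (H ω) (y ω) (ε ω) k)) :=
        IsCentered.sum _ fun k _ => IsCentered.sum _ fun i _ =>
          h.isCentered_truncated_term hA3 hy (h.bddH i k) k
            (fun g j hg => h.integral_mul_link_mul_sub_adjusted hg i k j) M i c
      rw [← hc.mean]
      congr 1; ext ω
      simp only [instrumentedError, instruments, Matrix.mulVec, dotProduct, Matrix.transpose_apply,
        Matrix.fromCols_apply_inl, Matrix.mul_apply, Finset.mul_sum, Finset.sum_mul]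
      refine Finset.sum_congr rfl fun k _ => Finset.sum_congr rfl fun i _ => ?_
      ring
    · have hc : IsCentered P (fun ω => ∑ k, truncWeight lam M (G ω) (X ω) *
          (X ω k c * 1 * compositeError lam p (G ω) (H ω) (y ω) (ε ω) k)) :=
        IsCentered.sum _ fun k _ =>
          h.isCentered_truncated_term hA3 hy (IsBddMeas.const 1) k
            (fun g j hg => by simpa using h.integral_mul_sub_adjusted hg k j) M k c
      rw [← hc.mean]
      congr 1; ext ω
      simp only [instrumentedError, instruments, Matrix.mulVec, dotProduct, Matrix.transpose_apply,
        Matrix.fromCols_apply_inr, Finset.mul_sum]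
      refine Finset.sum_congr rfl fun k _ => ?_
      ring
  have hlim : Tendsto (fun M : ℕ => ∫ ω, truncWeight lam M (G ω) (X ω) *
      instrumentedError lam p (G ω) (H ω) (X ω) (y ω) (ε ω) a ∂P) atTop
      (𝓝 (∫ ω, instrumentedError lam p (G ω) (H ω) (X ω) (y ω) (ε ω) a ∂P)) := by
    refine tendsto_integral_of_dominated_convergence
      (fun ω => |instrumentedError lam p (G ω) (H ω) (X ω) (y ω) (ε ω) a|) (fun M => ?_) hint.abs
      (fun M => ae_of_all _ fun ω => ?_) (ae_of_all _ fun ω => ?_)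
    · exact ((isBddMeas_truncWeight lam M).integrable_mul h.le hint).1
    · rw [norm_mul, Real.norm_eq_abs, Real.norm_eq_abs]
      refine mul_le_of_le_one_left (abs_nonneg _) ?_
      unfold truncWeight; split_ifs <;> simp
    · refine tendsto_const_nhds.congr' ?_
      filter_upwards [eventually_truncWeight_eq_one lam (G ω) (X ω)] with M hM
      rw [hM, one_mul]
  simp_rw [htr] at hlim
  exact tendsto_nhds_unique hlim tendsto_const_nhds |>.symm ▸ rfl

end LinkModel
end group

/-! ### Linear algebra of two-stage least squares -/

section linalg
variable {ι κ : Type*} [Fintype ι] [DecidableEq ι] [Fintype κ] [DecidableEq κ]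

omit [Fintype ι] [DecidableEq ι] [DecidableEq κ] in
lemma mulVec_injective_of_rank (A : Matrix ι κ ℝ) (h : A.rank = Fintype.card κ) :
    Function.Injective A.mulVec := by
  have h1 := A.mulVecLin.finrank_range_add_finrank_ker
  rw [Module.finrank_fintype_fun_eq_card, ← h, Matrix.rank] at h1
  have h2 : Module.finrank ℝ (LinearMap.ker A.mulVecLin) = 0 := by omega
  exact LinearMap.ker_eq_bot.1 (Submodule.finrank_eq_zero.1 h2)

lemma twoStageMatrix_mul_self {A : Matrix ι κ ℝ} {B : Matrix ι ι ℝ}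
    (h : IsUnit (A.transpose * B⁻¹ * A)) : twoStageMatrix A B * A = 1 := by
  rw [twoStageMatrix, Matrix.mul_assoc]
  exact Matrix.nonsing_inv_mul _ ((Matrix.isUnit_iff_isUnit_det _).1 h)

lemma matrix_inv_smul (M : Matrix κ κ ℝ) {c : ℝ} (hc : c ≠ 0) : (c • M)⁻¹ = c⁻¹ • M⁻¹ := by
  by_cases hM : IsUnit M.det
  · have := Matrix.inv_smul' M (Units.mk0 c hc) hM
    simpa [Units.smul_def] using this
  · rw [Matrix.nonsing_inv_apply_not_isUnit _ hM, smul_zero, Matrix.nonsing_inv_apply_not_isUnit]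
    rw [Matrix.det_smul, IsUnit.mul_iff]
    tauto

lemma twoStageMatrix_smul (A : Matrix ι κ ℝ) (B : Matrix ι ι ℝ) {c : ℝ} (hc : c ≠ 0) :
    twoStageMatrix (c • A) (c • B) = c⁻¹ • twoStageMatrix A B := by
  simp only [twoStageMatrix, Matrix.transpose_smul]
  rw [matrix_inv_smul B hc]
  simp only [Matrix.smul_mul, Matrix.mul_smul, smul_smul, inv_mul_cancel₀ hc, one_smul]
  rw [matrix_inv_smul _ hc]
  simp [Matrix.smul_mul]

/-- Under the rank condition, a limit `B` of Gram matrices makes the two-stage inverses genuine. -/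
lemma isUnit_twoStage {A : Matrix ι κ ℝ} {B : Matrix ι ι ℝ} (hB : B.PosSemidef)
    (hrB : B.rank = Fintype.card ι) (hrA : A.rank = Fintype.card κ) :
    IsUnit B.det ∧ IsUnit (A.transpose * B⁻¹ * A).det := by
  have hBu : IsUnit B := Matrix.mulVec_injective_iff_isUnit.1 (mulVec_injective_of_rank B hrB)
  have hBp : B.PosDef := hB.posDef_iff_isUnit.2 hBu
  refine ⟨(Matrix.isUnit_iff_isUnit_det _).1 hBu, ?_⟩
  have := hBp.inv.conjTranspose_mul_mul_same (mulVec_injective_of_rank A hrA)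
  rw [Matrix.conjTranspose_eq_transpose_of_trivial] at this
  exact (Matrix.isUnit_iff_isUnit_det _).1 this.isUnit

lemma Filter.Tendsto.matrix_inv {α : Type*} {l : Filter α} {f : α → Matrix ι ι ℝ} {A : Matrix ι ι ℝ}
    (hf : Tendsto f l (𝓝 A)) (hA : IsUnit A.det) : Tendsto (fun a => (f a)⁻¹) l (𝓝 A⁻¹) := by
  refine (continuousAt_matrix_inv A ?_).tendsto.comp hf
  rw [Ring.inverse_eq_inv']
  exact continuousAt_inv₀ hA.ne_zero

omit [DecidableEq ι] [Fintype κ] [DecidableEq κ] in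
lemma Filter.Tendsto.matrix_mul {α μ : Type*} {l : Filter α} {f : α → Matrix μ ι ℝ} {g : α →
    Matrix ι κ ℝ}
    {A : Matrix μ ι ℝ} {B : Matrix ι κ ℝ} (hf : Tendsto f l (𝓝 A)) (hg : Tendsto g l (𝓝 B)) :
    Tendsto (fun a => f a * g a) l (𝓝 (A * B)) :=
  ((Continuous.matrix_mul continuous_fst continuous_snd).tendsto (A, B)).comp (hf.prodMk_nhds hg)

omit [Fintype ι] [DecidableEq ι] in
lemma Filter.Tendsto.matrix_transpose {α μ : Type*} {l : Filter α} {f : α → Matrix μ ι ℝ}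
    {A : Matrix μ ι ℝ} (hf : Tendsto f l (𝓝 A)) :
    Tendsto (fun a => (f a).transpose) l (𝓝 A.transpose) :=
  (continuous_id.matrix_transpose.tendsto A).comp hf

lemma tendsto_twoStage {α : Type*} {l : Filter α} {f : α → Matrix ι κ ℝ} {g : α → Matrix ι ι ℝ}
    {A : Matrix ι κ ℝ} {B : Matrix ι ι ℝ} (hf : Tendsto f l (𝓝 A)) (hg : Tendsto g l (𝓝 B))
    (hB : IsUnit B.det) (hA : IsUnit (A.transpose * B⁻¹ * A).det) :
    Tendsto (fun a => twoStageMatrix (f a) (g a)) l (𝓝 (twoStageMatrix A B)) ∧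
      ∀ᶠ a in l, IsUnit ((f a).transpose * (g a)⁻¹ * f a) := by
  have h1 := (hf.matrix_transpose).matrix_mul (hg.matrix_inv hB)
  have h2 := h1.matrix_mul hf
  refine ⟨(h2.matrix_inv hA).matrix_mul h1, ?_⟩
  have h3 := (continuous_id.matrix_det.tendsto _).comp h2
  filter_upwards [h3.eventually_ne hA.ne_zero] with a ha
  exact (Matrix.isUnit_iff_isUnit_det _).2 (isUnit_iff_ne_zero.2 ha)

end linalg

/-- A function whose increments are a linear map up to a scalar factor tending to `1` is
differentiable. -/
lemma hasFDerivAt_of_eventually_sub_eq_smul {E F : Type*} [NormedAddCommGroup E] [NormedSpace ℝ E]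
    [NormedAddCommGroup F] [NormedSpace ℝ F] {f : E → F} {L : E →L[ℝ] F} {x : E} {r : E → ℝ}
    (h : ∀ᶠ z in 𝓝 x, f z - f x = r z • L (z - x)) (hr : Tendsto r (𝓝 x) (𝓝 1)) :
    HasFDerivAt f L x := by
  rw [hasFDerivAt_iff_isLittleO]
  have h1 : (fun z => (r z - 1) • L (z - x)) =o[𝓝 x] fun z => (1 : ℝ) • (z - x) := by
    refine Asymptotics.IsLittleO.smul_isBigO ?_ (L.isBigO_sub _ _)
    rw [Asymptotics.isLittleO_one_iff]
    simpa using hr.sub_const 1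
  simp only [one_smul] at h1
  refine h1.congr' ?_ EventuallyEq.rfl
  filter_upwards [h] with z hz
  rw [hz, sub_smul, one_smul]

/-! ### Dependence of the second step on the plugged-in rates -/

section group
variable {n K : ℕ}

/-- The derivative of `q ↦ W(q) y` at a point `p` with `p₀ + p₁ ≠ 1`. -/
noncomputable def adjustedDeriv (H : Matrix (Fin n) (Fin n) ℝ) (y : Fin n → ℝ) (p : Fin 2 → ℝ) :
    (Fin 2 → ℝ) →L[ℝ] (Fin n → ℝ) :=
  (1 - p 0 - p 1)⁻¹ • (
    (ContinuousLinearMap.proj (R := ℝ) (φ :=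
      fun _ : Fin 2 => ℝ) 0 + ContinuousLinearMap.proj 1).smulRight
      (Matrix.mulVec (adjusted H p) y) -
    (ContinuousLinearMap.proj (R := ℝ) (φ := fun _ : Fin 2 => ℝ) 0).smulRight
      (Matrix.mulVec (Matrix.of (fun _ _ => 1) - 1 : Matrix (Fin n) (Fin n) ℝ) y))

lemma adjustedDeriv_apply (H : Matrix (Fin n) (Fin n) ℝ) (y : Fin n → ℝ) (p δ : Fin 2 → ℝ) :
    adjustedDeriv H y p δ = (1 - p 0 - p 1)⁻¹ • ((δ 0 + δ 1) • Matrix.mulVec (adjusted H p) y -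
      δ 0 • Matrix.mulVec (Matrix.of (fun _ _ => 1) - 1 : Matrix (Fin n) (Fin n) ℝ) y) := rfl

/-- The increment of `q ↦ W(q) y` is exactly its differential, rescaled by the ratio of the
denominators. -/
lemma adjusted_mulVec_sub (H : Matrix (Fin n) (Fin n) ℝ) (y : Fin n → ℝ) {p q : Fin 2 → ℝ}
    (hp : 1 - p 0 - p 1 ≠ 0) (hq : 1 - q 0 - q 1 ≠ 0) :
    Matrix.mulVec (adjusted H q) y - Matrix.mulVec (adjusted H p) y =
      ((1 - p 0 - p 1) / (1 - q 0 - q 1)) • adjustedDeriv H y p (q - p) := by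
  rw [adjustedDeriv_apply]
  ext i
  simp only [adjusted, Matrix.smul_mulVec, Matrix.sub_mulVec, Pi.sub_apply, Pi.smul_apply,
    smul_eq_mul]
  field_simp
  ring

lemma hasFDerivAt_adjusted_mulVec (H : Matrix (Fin n) (Fin n) ℝ) (y : Fin n → ℝ) {p : Fin 2 → ℝ}
    (hp : 1 - p 0 - p 1 ≠ 0) :
    HasFDerivAt (fun q => Matrix.mulVec (adjusted H q) y) (adjustedDeriv H y p) p := by
  have hc : Continuous fun q : Fin 2 → ℝ => 1 - q 0 - q 1 := by fun_prop
  refine hasFDerivAt_of_eventually_sub_eq_smul (r :=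
      fun q => (1 - p 0 - p 1) / (1 - q 0 - q 1)) ?_ ?_
  · filter_upwards [(hc.tendsto p).eventually_ne hp] with q hq
    exact adjusted_mulVec_sub H y hp hq
  · have := (tendsto_const_nhds (x := 1 - p 0 - p 1)).div (hc.tendsto p) hp
    rwa [div_self hp] at this

lemma jacobian_adjusted_apply (H : Matrix (Fin n) (Fin n) ℝ) (y : Fin n → ℝ) {p : Fin 2 → ℝ}
    (hp : 1 - p 0 - p 1 ≠ 0) (δ : Fin 2 → ℝ) :
    Matrix.mulVec (jacobian (fun q => Matrix.mulVec (adjusted H q) y) p) δ =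
        adjustedDeriv H y p δ := by
  rw [jacobian_mulVec, (hasFDerivAt_adjusted_mulVec H y hp).fderiv]

lemma regressors_mulVec (H : Matrix (Fin n) (Fin n) ℝ) (X : Matrix (Fin n) (Fin K) ℝ)
    (y : Fin n → ℝ)
    (p : Fin 2 → ℝ) (lam : ℝ) (β : Fin K → ℝ) :
    Matrix.mulVec (regressors H X y p) (coefficients lam β) =
      lam • Matrix.mulVec (adjusted H p) y + Matrix.mulVec X β := by
  rw [regressors, coefficients, Matrix.fromCols_mulVec_sumElim]
  congr 1
  ext i
  simp [Matrix.mulVec, dotProduct, mul_comm]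

lemma momentGradient_eq (H : Matrix (Fin n) (Fin n) ℝ) (X : Matrix (Fin n) (Fin K) ℝ)
    (y : Fin n → ℝ)
    {p : Fin 2 → ℝ} (hp : 1 - p 0 - p 1 ≠ 0) (lam : ℝ) (β : Fin K → ℝ) :
    momentGradient H X y (coefficients lam β) p = lam • instrumentedGradient H X y p := by
  have h1 := ((hasFDerivAt_adjusted_mulVec H y hp).const_smul lam).add_const (Matrix.mulVec X β)
  have h2 : jacobian (fun q => Matrix.mulVec (regressors H X y q) (coefficients lam β)) p =
      lam • jacobian (fun q => Matrix.mulVec (adjusted H q) y) p := by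
    simp only [regressors_mulVec]
    rw [jacobian, jacobian]
    have e : fderiv ℝ (fun q => lam • Matrix.mulVec (adjusted H q) y + Matrix.mulVec X β) p =
      lam • fderiv ℝ (fun q => Matrix.mulVec (adjusted H q) y) p := by
      rw [(hasFDerivAt_adjusted_mulVec H y hp).fderiv]; exact h1.fderiv
    rw [e]
    simp
  rw [momentGradient, instrumentedGradient, h2, Matrix.mul_smul]

lemma instrumentedGradient_mulVec (H : Matrix (Fin n) (Fin n) ℝ) (X : Matrix (Fin n) (Fin K) ℝ)
    (y : Fin n → ℝ)
    {p : Fin 2 → ℝ} (hp : 1 - p 0 - p 1 ≠ 0) (δ : Fin 2 → ℝ) :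
    Matrix.mulVec (instrumentedGradient H X y p) δ =
      Matrix.mulVec (instruments H X).transpose (adjustedDeriv H y p δ) := by
  rw [instrumentedGradient, ← Matrix.mulVec_mulVec, jacobian_adjusted_apply H y hp]

lemma outcome_eq {G H : Matrix (Fin n) (Fin n) ℝ} {X : Matrix (Fin n) (Fin K) ℝ} {y ε : Fin n → ℝ}
    {lam : ℝ} {β : Fin K → ℝ} (p : Fin 2 → ℝ)
    (hy : y = lam • Matrix.mulVec G y + Matrix.mulVec X β + ε) :
    y = Matrix.mulVec (regressors H X y p) (coefficients lam β) + compositeError lam p G H y ε := by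
  rw [regressors_mulVec, compositeError, Matrix.sub_mulVec]
  nth_rewrite 1 [hy]
  module

/-- Only the first column of the regressors depends on the rates. -/
lemma instruments_mul_regressors_apply (H : Matrix (Fin n) (Fin n) ℝ) (X : Matrix (Fin n) (Fin K) ℝ)
    (y : Fin n → ℝ) {p q : Fin 2 → ℝ} (hp : 1 - p 0 - p 1 ≠ 0) (hq : 1 - q 0 - q 1 ≠ 0)
    (a : Fin K ⊕ Fin K) (b : Unit ⊕ Fin K) :
    ((instruments H X).transpose * regressors H X y q) a b =
      ((instruments H X).transpose * regressors H X y p) a b +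
        Sum.elim (fun _ => (1 : ℝ)) (fun _ => 0) b * (((1 - p 0 - p 1) / (1 - q 0 - q 1)) *
          Matrix.mulVec (instrumentedGradient H X y p) (q - p) a) := by
  rcases b with b | b
  · have h1 : ∀ q, ((instruments H X).transpose * regressors H X y q) a (Sum.inl b) =
        Matrix.mulVec (instruments H X).transpose (Matrix.mulVec (adjusted H q) y) a := by
      intro q
      simp [Matrix.mul_apply, regressors, Matrix.mulVec, dotProduct]
    rw [h1, h1, instrumentedGradient_mulVec H X y hp, Sum.elim_inl, one_mul, ← smul_eq_mul,
      ← Pi.smul_apply,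
      ← Matrix.mulVec_smul, ← adjusted_mulVec_sub H y hp hq, Matrix.mulVec_sub, Pi.sub_apply]
    ring
  · simp [Matrix.mul_apply, regressors]

lemma instruments_mulVec_outcome {G H : Matrix (Fin n) (Fin n) ℝ} {X : Matrix (Fin n) (Fin K) ℝ}
    {y ε : Fin n → ℝ}
    {lam : ℝ} {β : Fin K → ℝ} {p q : Fin 2 → ℝ} (hp : 1 - p 0 - p 1 ≠ 0) (hq : 1 - q 0 - q 1 ≠ 0)
    (hy : y = lam • Matrix.mulVec G y + Matrix.mulVec X β + ε) :
    Matrix.mulVec (instruments H X).transpose y =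
      Matrix.mulVec ((instruments H X).transpose * regressors H X y q) (coefficients lam β) +
      (instrumentedError lam p G H X y ε - ((1 - p 0 - p 1) / (1 - q 0 - q 1)) •
        Matrix.mulVec (momentGradient H X y (coefficients lam β) p) (q - p)) := by
  rw [momentGradient_eq H X y hp, Matrix.smul_mulVec, instrumentedGradient_mulVec H X y hp,
    smul_comm, ← Matrix.mulVec_smul, ← Matrix.mulVec_smul, ← adjusted_mulVec_sub H y hp hq,
    ← Matrix.mulVec_mulVec, instrumentedError, ← Matrix.mulVec_sub, ← Matrix.mulVec_add]
  congr 1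
  nth_rewrite 1 [outcome_eq (H := H) p hy]
  rw [regressors_mulVec, regressors_mulVec]
  module

end group

section estimator
variable {K : ℕ}

/-- The error of the estimator with plugged-in rates `q`, as an exact expression in the averages of
the instrumented errors and of the gradients of the moments. -/
lemma adjusted2SLS_sub_eq {n : ℕ → ℕ} {G H : (s : ℕ) → Matrix (Fin (n s)) (Fin (n s)) ℝ}
    {X : (s : ℕ) → Matrix (Fin (n s)) (Fin K) ℝ} {y ε : (s : ℕ) → Fin (n s) → ℝ}
    {lam : ℝ} {β : Fin K → ℝ} {p q : Fin 2 → ℝ} (hp : 1 - p 0 - p 1 ≠ 0) (hq : 1 - q 0 - q 1 ≠ 0)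
    (hy : ∀ s, y s = lam • Matrix.mulVec (G s) (y s) + Matrix.mulVec (X s) β + ε s) {S : ℕ}
      (hS : 0 < S)
    {A : Matrix (Fin K ⊕ Fin K) (Unit ⊕ Fin K) ℝ} {B : Matrix (Fin K ⊕ Fin K) (Fin K ⊕ Fin K) ℝ}
    (hA : A = (S : ℝ)⁻¹ • ∑ s ∈ Finset.range S,
      (instruments (H s) (X s)).transpose * regressors (H s) (X s) (y s) q)
    (hB : B = (S : ℝ)⁻¹ • ∑ s ∈ Finset.range S,
      (instruments (H s) (X s)).transpose * instruments (H s) (X s))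
    (hu : IsUnit (A.transpose * B⁻¹ * A)) :
    adjusted2SLS n H X y q S - coefficients lam β =
      Matrix.mulVec (twoStageMatrix A B) ((S : ℝ)⁻¹ • (∑ s ∈ Finset.range S,
          instrumentedError lam p (G s) (H s) (X s) (y s) (ε s)) -
        ((1 - p 0 - p 1) / (1 - q 0 - q 1)) • Matrix.mulVec ((S : ℝ)⁻¹ • ∑ s ∈ Finset.range S,
          momentGradient (H s) (X s) (y s) (coefficients lam β) p) (q - p)) := by
  have hSr : (S : ℝ) ≠ 0 := by positivity
  have hA' : ∑ s ∈ Finset.range S,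
      (instruments (H s) (X s)).transpose * regressors (H s) (X s) (y s) q = (S : ℝ) • A := by
    rw [hA, smul_smul, mul_inv_cancel₀ hSr, one_smul]
  have hB' : ∑ s ∈ Finset.range S, (instruments (H s) (X s)).transpose * instruments (H s) (X s) =
      (S : ℝ) • B := by
    rw [hB, smul_smul, mul_inv_cancel₀ hSr, one_smul]
  have hsum : ∑ s ∈ Finset.range S, Matrix.mulVec (instruments (H s) (X s)).transpose (y s) =
      Matrix.mulVec ((S : ℝ) • A) (coefficients lam β) + (∑ s ∈ Finset.range S,
          instrumentedError lam p (G s) (H s) (X s) (y s) (ε s) -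
        ((1 - p 0 - p 1) / (1 - q 0 - q 1)) • Matrix.mulVec (∑ s ∈ Finset.range S,
          momentGradient (H s) (X s) (y s) (coefficients lam β) p) (q - p)) := by
    rw [← hA', Matrix.sum_mulVec, Matrix.sum_mulVec, Finset.smul_sum, ← Finset.sum_sub_distrib,
      ← Finset.sum_add_distrib]
    exact Finset.sum_congr rfl fun s _ => instruments_mulVec_outcome hp hq (hy s)
  rw [adjusted2SLS, hsum, hA', hB', twoStageMatrix_smul A B hSr, Matrix.mulVec_add,
    Matrix.smul_mulVec,
    Matrix.smul_mulVec (S : ℝ) A, Matrix.mulVec_smul, smul_smul, inv_mul_cancel₀ hSr, one_smul,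
    Matrix.mulVec_mulVec, twoStageMatrix_mul_self hu, Matrix.one_mulVec, add_sub_cancel_left]
  simp only [Matrix.smul_mulVec]
  rw [smul_comm ((1 - p 0 - p 1) / (1 - q 0 - q 1)), ← smul_sub, Matrix.mulVec_smul]

end estimator

/-! ### Operations on uniformly integrable sequences -/

section UI
variable {Ω : Type*} [MeasurableSpace Ω] {P : Measure Ω} {r : ENNReal}

lemma uniformIntegrable_of_bounded [IsFiniteMeasure P] (hr : 1 ≤ r) (hr' : r ≠ ⊤) {f : ℕ → Ω → ℝ}
    (hm : ∀ s, AEStronglyMeasurable (f s) P) {C : ℝ} (h : ∀ s ω, |f s ω| ≤ C) :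
    UniformIntegrable f r P := by
  refine uniformIntegrable_of hr hr' hm fun ε _ => ⟨(C + 1).toNNReal, fun s => ?_⟩
  have : {ω | (C + 1).toNNReal ≤ ‖f s ω‖₊}.indicator (f s) = 0 := by
    refine Set.indicator_eq_zero.2 ?_
    refine Set.disjoint_left.2 fun ω _ hω => ?_
    have hω' : (C + 1).toNNReal ≤ ‖f s ω‖₊ := hω
    rw [Real.toNNReal_le_iff_le_coe, coe_nnnorm, Real.norm_eq_abs] at hω'
    linarith [h s ω]
  rw [this]; simp

lemma MeasureTheory.UniformIntegrable.add {f g : ℕ → Ω → ℝ} (hr : 1 ≤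
    r) (hf : UniformIntegrable f r P)
    (hg : UniformIntegrable g r P) : UniformIntegrable (fun s ω => f s ω + g s ω) r P := by
  refine ⟨fun s => (hf.1 s).add (hg.1 s), hf.2.1.add hg.2.1 hr hf.1 hg.1, ?_⟩
  obtain ⟨C, hC⟩ := hf.2.2
  obtain ⟨D, hD⟩ := hg.2.2
  refine ⟨C + D, fun s => ?_⟩
  refine (eLpNorm_add_le (hf.1 s) (hg.1 s) hr).trans ?_
  rw [ENNReal.coe_add]
  exact add_le_add (hC s) (hD s)

lemma MeasureTheory.UniformIntegrable.const_mul
    {f : ℕ → Ω → ℝ} (c : ℝ) (hf : UniformIntegrable f r P) :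
    UniformIntegrable (fun s ω => c * f s ω) r P := by
  refine ⟨fun s => (hf.1 s).const_mul c, ?_, ?_⟩
  · intro ε hε
    obtain ⟨δ, hδ, h⟩ := hf.2.1 (show 0 < ε / (|c| + 1) by positivity)
    refine ⟨δ, hδ, fun s t ht hμ => ?_⟩
    have e : t.indicator (fun ω => c * f s ω) = c • t.indicator (f s) := by
      ext ω; by_cases hω : ω ∈ t <;> simp [hω]
    rw [e, eLpNorm_const_smul]
    refine (mul_le_mul_right (h s t ht hμ) _).trans ?_
    rw [← ofReal_norm, ← ENNReal.ofReal_mul (norm_nonneg _), Real.norm_eq_abs]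
    refine ENNReal.ofReal_le_ofReal ?_
    rw [mul_div_assoc', div_le_iff₀ (by positivity)]
    nlinarith [abs_nonneg c]
  · obtain ⟨C, hC⟩ := hf.2.2
    refine ⟨‖c‖₊ * C, fun s => ?_⟩
    have e : (fun ω => c * f s ω) = c • f s := rfl
    change eLpNorm (fun ω => c * f s ω) r P ≤ _
    rw [e, eLpNorm_const_smul, ENNReal.coe_mul]
    exact mul_le_mul_right (hC s) _

lemma MeasureTheory.UniformIntegrable.finsetSum [IsFiniteMeasure P] (hr : 1 ≤
    r) (hr' : r ≠ ⊤) {ι : Type*} (t : Finset ι) {f : ι → ℕ → Ω → ℝ}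
    (hf : ∀ i ∈ t, UniformIntegrable (f i) r P) :
    UniformIntegrable (fun s ω => ∑ i ∈ t, f i s ω) r P := by
  classical
  induction t using Finset.induction_on with
  | empty => simpa using uniformIntegrable_of_bounded (P := P) hr hr' (f :=
    fun _ _ => (0 : ℝ)) (fun _ => aestronglyMeasurable_const) (C := 0) (by simp)
  | insert a t ha ih =>
    simp only [Finset.sum_insert ha]
    exact (hf a (Finset.mem_insert_self _ _)).add hr (ih fun i hi =>
      hf i (Finset.mem_insert_of_mem hi))

end UI

/-! ### Stochastic orders of vectors -/

section OP
variable {Ω : Type*} [MeasurableSpace Ω] {P : Measure Ω}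

lemma boundedInProb_pi {ι : Type*} [Fintype ι] {f : ℕ × Ω → ι → ℝ}
    (h : ∀ i, BoundedInProb P (fun x => f x i)) : BoundedInProb P f := by
  intro ε hε
  rcases isEmpty_or_nonempty ι with hι | hι
  · refine ⟨1, one_pos, Eventually.of_forall fun S => ?_⟩
    have : ∀ ω, ¬ (1 : ℝ) < ‖f (S, ω)‖ := fun ω => by
      rw [Subsingleton.elim (f (S, ω)) 0, norm_zero]; norm_num
    simp [this]
  have hpos : 0 < ε / Fintype.card ι := ENNReal.div_pos hε.ne' (by simp)
  choose C hC0 hC using fun i => h i _ hpos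
  have hle : ∀ i, C i ≤ ∑ j, C j :=
    fun i => Finset.single_le_sum (fun j _ => (hC0 j).le) (Finset.mem_univ i)
  refine ⟨∑ i, C i, Finset.sum_pos (fun i _ => hC0 i) Finset.univ_nonempty, ?_⟩
  filter_upwards [eventually_all.2 hC] with S hS
  calc P {ω | ∑ i, C i < ‖f (S, ω)‖} ≤ P (⋃ i, {ω | C i < ‖f (S, ω) i‖}) := by
        refine measure_mono fun ω hω => ?_
        by_contra hcon
        simp only [Set.mem_iUnion, not_exists] at hcon
        have hω' : ∑ i, C i < ‖f (S, ω)‖ := hω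
        refine absurd hω' (not_lt.2 ?_)
        refine (pi_norm_le_iff_of_nonneg (Finset.sum_nonneg fun i _ => (hC0 i).le)).2 fun i => ?_
        exact (not_lt.1 (hcon i)).trans (hle i)
    _ ≤ ∑ i, P {ω | C i < ‖f (S, ω) i‖} := measure_iUnion_fintype_le _ _
    _ ≤ ∑ _i : ι, ε / Fintype.card ι := Finset.sum_le_sum fun i _ => hS i
    _ = ε := by
        rw [Finset.sum_const, Finset.card_univ, nsmul_eq_mul]
        exact ENNReal.mul_div_cancel (by simp) (by simp)

lemma tendsto_mulVec_zero_of_boundedInProb {ι κ : Type*} [Fintype ι] [Fintype κ]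
    {M : ℕ × Ω → Matrix ι κ ℝ} {v : ℕ × Ω → κ → ℝ}
    (hM : Tendsto M (whp P) (𝓝 0)) (hv : ∀ k, BoundedInProb P (fun x => v x k)) :
    Tendsto (fun x => Matrix.mulVec (M x) (v x)) (whp P) (𝓝 0) := by
  refine tendsto_pi_nhds.2 fun i => ?_
  simp only [Matrix.mulVec, dotProduct, Pi.zero_apply]
  rw [show (0 : ℝ) = ∑ _k : κ, (0 : ℝ) by simp]
  refine tendsto_finsetSum _ fun k _ => (hv k).zero_mul ?_
  exact tendsto_pi_nhds.1 (tendsto_pi_nhds.1 hM i) k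

lemma Filter.Tendsto.matrix_mulVec {α ι κ : Type*} [Fintype κ] {l : Filter α} {f : α →
    Matrix ι κ ℝ} {g : α → κ → ℝ}
    {A : Matrix ι κ ℝ} {b : κ → ℝ} (hf : Tendsto f l (𝓝 A)) (hg : Tendsto g l (𝓝 b)) :
    Tendsto (fun a => Matrix.mulVec (f a) (g a)) l (𝓝 (Matrix.mulVec A b)) :=
  ((Continuous.matrix_mulVec continuous_fst continuous_snd).tendsto (A, b)).comp (hf.prodMk_nhds hg)

end OP

/-! ### Measurability and independence of the group statistics -/

section meas
variable {α : Type*} [MeasurableSpace α] {n K : ℕ} {G H : α → Matrix (Fin n) (Fin n) ℝ}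
  {X : α → Matrix (Fin n) (Fin K) ℝ} {ε y : α → Fin n → ℝ} {q : α → Fin 2 → ℝ}

lemma measurable_adjusted (hH : Measurable H) (hq : Measurable q) :
    Measurable fun a => adjusted (H a) (q a) := by
  have h0 : Measurable fun a => q a 0 := (measurable_pi_apply 0).comp hq
  have h1 : Measurable fun a => q a 1 := (measurable_pi_apply 1).comp hq
  refine measurable_matrix_iff.2 fun i j => ?_
  simp only [adjusted, Matrix.smul_apply, Matrix.sub_apply, smul_eq_mul]
  exact ((measurable_const.sub h0).sub h1).inv.mul
    ((hH.matrix_apply i j).sub (h0.mul measurable_const))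

lemma measurable_instruments (hH : Measurable H) (hX : Measurable X) :
    Measurable fun a => instruments (H a) (X a) := by
  refine measurable_matrix_iff.2 fun i j => ?_
  rcases j with c | c
  · exact (measurable_matrix_mul (measurable_matrix_transpose hH) hX).matrix_apply i c
  · exact hX.matrix_apply i c

lemma measurable_regressors (hH : Measurable H) (hX : Measurable X) (hy : Measurable y)
    (hq : Measurable q) :
    Measurable fun a => regressors (H a) (X a) (y a) (q a) := by
  refine measurable_matrix_iff.2 fun i j => ?_
  rcases j with c | c
  · exact (measurable_pi_apply i).comp (measurable_matrix_mulVec (measurable_adjusted hH hq) hy)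
  · exact hX.matrix_apply i c

lemma measurable_instrumentedError (hG : Measurable G) (hH : Measurable H) (hX : Measurable X)
    (hε : Measurable ε) (hy : Measurable y) (lam : ℝ) (p : Fin 2 → ℝ) :
    Measurable fun a => instrumentedError lam p (G a) (H a) (X a) (y a) (ε a) := by
  refine measurable_matrix_mulVec (measurable_matrix_transpose (measurable_instruments hH hX)) ?_
  refine hε.add (Measurable.const_smul ?_ lam)
  refine measurable_matrix_mulVec ?_ hy
  refine measurable_matrix_iff.2 fun i j => ?_
  exact (hG.matrix_apply i j).sub ((measurable_adjusted hH measurable_const).matrix_apply i j)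

lemma measurable_instrumentedGradient (hH : Measurable H) (hX : Measurable X) (hy : Measurable y)
    {p : Fin 2 → ℝ} (hp : 1 - p 0 - p 1 ≠ 0) :
    Measurable fun a => instrumentedGradient (H a) (X a) (y a) p := by
  refine measurable_matrix_iff.2 fun i j => ?_
  have e : ∀ a, instrumentedGradient (H a) (X a) (y a) p i j =
      Matrix.mulVec (instruments (H a) (X a)).transpose
          (adjustedDeriv (H a) (y a) p (Pi.single j 1)) i := by
    intro a
    rw [← instrumentedGradient_mulVec _ _ _ hp]
    simp
  have hd : Measurable fun a => adjustedDeriv (H a) (y a) p (Pi.single j 1) := by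
    have h1 := measurable_matrix_mulVec (measurable_adjusted hH (measurable_const (a := p))) hy
    have h2 := measurable_matrix_mulVec
      (measurable_const (a := (Matrix.of (fun _ _ => 1) - 1 : Matrix (Fin n) (Fin n) ℝ))) hy
    have h1' := h1.const_smul (((Pi.single j 1 : Fin 2 → ℝ) 0) + (Pi.single j 1 : Fin 2 → ℝ) 1)
    have h2' := h2.const_smul ((Pi.single j 1 : Fin 2 → ℝ) 0)
    exact (h1'.sub h2').const_smul (1 - p 0 - p 1)⁻¹
  simp only [e]
  exact (measurable_pi_apply i).comp (measurable_matrix_mulVec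
    (measurable_matrix_transpose (measurable_instruments hH hX)) hd)

lemma measurable_pairAverage {φ : Matrix (Fin n) (Fin K) ℝ → Fin n → Fin n → Fin 2}
    (hφ : ∀ i j, Measurable (fun x => φ x i j)) (hX : Measurable X) (d : Fin 2) {f : α → Fin n →
      Fin n → ℝ}
    (hf : ∀ i j, Measurable fun a => f a i j) :
    Measurable fun a => pairAverage (φ (X a)) d (f a) := by
  unfold pairAverage
  refine (Finset.measurable_sum _ fun i _ => Finset.measurable_sum _ fun j _ => ?_).const_mul _
  refine Measurable.ite ?_ (hf i j) measurable_const
  by_cases hji : j < i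
  · simp only [hji, true_and]
    exact ((hφ i j).comp hX) (measurableSet_singleton d)
  · simp [hji]

lemma measurable_groupMoments {φ : Matrix (Fin n) (Fin K) ℝ → Fin n → Fin n → Fin 2}
    (hφ : ∀ i j, Measurable (fun x => φ x i j)) (hH : Measurable H) (hX : Measurable X) :
    Measurable fun a => groupMoments (φ (X a)) (H a) := by
  refine measurable_pi_iff.2 fun ⟨t, d⟩ => measurable_pairAverage hφ hX d fun i j => ?_
  fin_cases t
  · exact measurable_const
  · exact hH.matrix_apply i j
  · exact hH.matrix_apply j i
  · exact (hH.matrix_apply i j).max (hH.matrix_apply j i)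

lemma measurable_rates : Measurable rates := by
  have hl : ∀ t d, Measurable (fun m => linkShare m t d) := fun t d =>
    (measurable_pi_apply _).div (measurable_pi_apply _)
  have hm : Measurable meanShare := ((hl 1 1).add (hl 2 1)).div_const 2
  have h1 : Measurable coefC1 :=
    ((hm.sub measurable_const).add (((hl 3 0).sub (hl 3 1)).div ((hl 2 0).sub hm))).sub
      (measurable_const.sub hm)
  have h0 : Measurable coefC0 := ((hm.add hm).sub (hm.mul hm)).sub (hl 3 1)
  have hxi : Measurable rootXi := (h1.add ((h1.pow_const 2).add (h0.const_mul 4)).sqrt).div_const 2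
  have hr0 : Measurable rate0 := hm.sub hxi
  have hd := (measurable_const (a := (1 : ℝ)).sub hr0).mul (hm.sub hr0)
  have hts : Measurable trueShare := ((hm.sub hr0).mul (hm.sub hr0)).div
    ((hd.add hd).sub ((hl 3 1).sub ((hr0.add hr0).sub (hr0.mul hr0))))
  have hr1 : Measurable rate1 := (measurable_const.sub hr0).sub ((hm.sub hr0).div hts)
  refine measurable_pi_iff.2 fun i => ?_
  fin_cases i
  · exact hr0
  · exact hr1

lemma measurable_matrix_sum {ι μ κ : Type*} [Countable μ] [Countable κ] (s : Finset ι) {f : ι → α →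
    Matrix μ κ ℝ} (hf : ∀ i, Measurable (f i)) :
    Measurable fun a => ∑ i ∈ s, f i a := by
  refine measurable_matrix_iff.2 fun i j => ?_
  simp only [Matrix.sum_apply]
  exact Finset.measurable_sum _ fun k _ => (hf k).matrix_apply i j

lemma measurable_twoStepEstimator {n : ℕ → ℕ} {H : (s : ℕ) → α → Matrix (Fin (n s)) (Fin (n s)) ℝ}
    {X : (s : ℕ) → α → Matrix (Fin (n s)) (Fin K) ℝ} {y : (s : ℕ) → α → Fin (n s) → ℝ}
    (hH : ∀ s, Measurable (H s)) (hX : ∀ s, Measurable (X s)) (hy : ∀ s, Measurable (y s))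
    {φ : (m : ℕ) → Matrix (Fin m) (Fin K) ℝ → Fin m → Fin m → Fin 2}
    (hφ : ∀ m i j, Measurable (fun x => φ m x i j)) (S : ℕ) :
    Measurable fun a => twoStepEstimator φ n (fun s => H s a) (fun s => X s a) (fun s =>
        y s a) S := by
  have hq : Measurable fun a => ratesEstimator φ n (fun s => H s a) (fun s => X s a) S := by
    refine measurable_rates.comp (measurable_pi_iff.2 fun q => ?_)
    refine (Finset.measurable_sum _ fun s _ => ?_).div_const _
    exact (measurable_pi_apply q).comp (measurable_groupMoments (hφ (n s)) (hH s) (hX s))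
  have hA : Measurable fun a => ∑ s ∈ Finset.range S, (instruments (H s a) (X s a)).transpose *
      regressors (H s a) (X s a) (y s a) (ratesEstimator φ n (fun s => H s a) (fun s => X s a) S) :=
    measurable_matrix_sum _ fun s => measurable_matrix_mul
      (measurable_matrix_transpose (measurable_instruments (hH s) (hX s)))
      (measurable_regressors (hH s) (hX s) (hy s) hq)
  have hB : Measurable fun a => ∑ s ∈ Finset.range S, (instruments (H s a) (X s a)).transpose *
      instruments (H s a) (X s a) :=
    measurable_matrix_sum _ fun s => measurable_matrix_mul
      (measurable_matrix_transpose (measurable_instruments (hH s) (hX s)))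
        (measurable_instruments (hH s) (hX s))
  have h1 := measurable_matrix_mul (measurable_matrix_transpose hA) (measurable_matrix_inv hB)
  refine measurable_matrix_mulVec
      (measurable_matrix_mul (measurable_matrix_inv (measurable_matrix_mul h1 hA)) h1) ?_
  exact Finset.measurable_sum _ fun s _ => measurable_matrix_mulVec
    (measurable_matrix_transpose (measurable_instruments (hH s) (hX s))) (hy s)

end meas

/-- Bounding the number of pairs by `n²` gives `2 n / (n - 1)`, which is `3` at `n = 3`. -/
lemma abs_pairAverage_le {n : ℕ} (hn : 3 ≤ n) (φ : Fin n → Fin n → Fin 2) (d : Fin 2)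
    {f : Fin n → Fin n → ℝ} (hf : ∀ i j, |f i j| ≤ 1) : |pairAverage φ d f| ≤ 3 := by
  have hn' : (3 : ℝ) ≤ n := by exact_mod_cast hn
  have hpos : 0 < (n : ℝ) * ((n : ℝ) - 1) := by nlinarith
  have hs : |∑ i, ∑ j, if j < i ∧ φ i j = d then f i j else 0| ≤ (n : ℝ) * n := by
    calc |∑ i, ∑ j, if j < i ∧ φ i j = d then f i j else 0| ≤
        ∑ i : Fin n, ∑ j : Fin n, (1 : ℝ) := by
          refine (Finset.abs_sum_le_sum_abs _ _).trans (Finset.sum_le_sum fun i _ => ?_)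
          refine (Finset.abs_sum_le_sum_abs _ _).trans (Finset.sum_le_sum fun j _ => ?_)
          split_ifs
          · exact hf i j
          · simp
      _ = (n : ℝ) * n := by simp
  rw [pairAverage, abs_mul, abs_of_pos (div_pos two_pos hpos)]
  refine (mul_le_mul_of_nonneg_left hs (div_pos two_pos hpos).le).trans ?_
  rw [div_mul_eq_mul_div, div_le_iff₀ hpos]
  nlinarith

lemma abs_groupMoments_le {n : ℕ} (hn : 3 ≤ n) (φ : Fin n → Fin n → Fin 2)
    {H : Matrix (Fin n) (Fin n) ℝ} (hH : IsAdjacency H) (q : Fin 4 × Fin 2) :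
    |groupMoments φ H q| ≤ 3 := by
  refine abs_pairAverage_le hn φ q.2 fun i j => ?_
  obtain ⟨t, d⟩ := q
  rcases hH.1 i j with e | e <;> rcases hH.1 j i with e' | e' <;> fin_cases t <;> simp [pairMeasure,
    e, e']

/-- Independence across groups extends to the outcomes, which the reduced form determines. -/
lemma iIndepFun_with_outcome {Ω : Type*} [MeasurableSpace Ω] {P : Measure Ω} {K : ℕ} {n : ℕ →
    ℕ} {lam : ℝ}
    {β : Fin K → ℝ} {G H : (s : ℕ) → Ω → Matrix (Fin (n s)) (Fin (n s)) ℝ}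
    {X : (s : ℕ) → Ω → Matrix (Fin (n s)) (Fin K) ℝ} {ε y : (s : ℕ) → Ω → Fin (n s) → ℝ}
    (hindep : iIndepFun (fun s ω => (G s ω, H s ω, X s ω, ε s ω)) P)
    (hy : ∀ s, ∀ᵐ ω ∂P, y s ω =
      Matrix.mulVec (1 - lam • G s ω)⁻¹ (Matrix.mulVec (X s ω) β + ε s ω)) :
    iIndepFun (fun s ω => (G s ω, H s ω, X s ω, ε s ω, y s ω)) P := by
  have h := hindep.comp (fun s z => (z.1, z.2.1, z.2.2.1, z.2.2.2,
    Matrix.mulVec (1 - lam • z.1)⁻¹ (Matrix.mulVec z.2.2.1 β + z.2.2.2))) fun s => by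
      have hN : Measurable
        fun z : Matrix (Fin (n s)) (Fin (n s)) ℝ × Matrix (Fin (n s)) (Fin (n s)) ℝ ×
          Matrix (Fin (n s)) (Fin K) ℝ × (Fin (n s) → ℝ) => (1 - lam • z.1)⁻¹ := by
        refine measurable_matrix_inv (measurable_matrix_iff.2 fun i j => ?_)
        simp only [Matrix.sub_apply, Matrix.smul_apply, smul_eq_mul]
        exact measurable_const.sub ((measurable_fst.matrix_apply i j).const_mul lam)
      refine measurable_fst.prodMk (measurable_snd.fst.prodMk (measurable_snd.snd.fst.prodMk
        (measurable_snd.snd.snd.prodMk (measurable_matrix_mulVec hN ?_))))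
      exact (measurable_matrix_mulVec measurable_snd.snd.fst measurable_const).add
        measurable_snd.snd.snd
  refine h.congr fun s => ?_
  filter_upwards [hy s] with ω hω
  simp only [Function.comp_apply]
  rw [← hω]

/-! ### The multivariate central limit theorem -/

section quad
variable {Ω : Type*} [MeasurableSpace Ω] {P : Measure Ω} {ι : Type*} [Fintype ι]

lemma tendsto_avgE_quadratic {f : ℕ → Ω → Matrix ι ι ℝ} {V : Matrix ι ι ℝ}
    (hf : ∀ s a b, Integrable (fun ω => f s ω a b) P)
    (hV : ∀ a b, Tendsto (avgE P (fun s ω => f s ω a b)) atTop (𝓝 (V a b))) (u : ι → ℝ) :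
    Tendsto (avgE P (fun s ω => u ⬝ᵥ Matrix.mulVec (f s ω) u)) atTop
        (𝓝 (u ⬝ᵥ Matrix.mulVec V u)) := by
  have e : avgE P (fun s ω => u ⬝ᵥ Matrix.mulVec (f s ω) u) = fun S =>
      u ⬝ᵥ Matrix.mulVec (fun a b => avgE P (fun s ω => f s ω a b) S) u := by
    ext S
    simp only [avgE, Matrix.mulVec, dotProduct]
    have h1 : ∀ s, ∫ ω, ∑ a, u a * ∑ b, f s ω a b * u b ∂P =
        ∑ a, u a * ∑ b, (∫ ω, f s ω a b ∂P) * u b := by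
      intro s
      rw [integral_finsetSum _ fun a _ =>
        (integrable_finsetSum _ fun b _ => (hf s a b).mul_const _).const_mul _]
      refine Finset.sum_congr rfl fun a _ => ?_
      rw [integral_const_mul, integral_finsetSum _ fun b _ => (hf s a b).mul_const _]
      simp_rw [integral_mul_const]
    simp_rw [h1]
    rw [Finset.sum_comm, Finset.sum_div]
    refine Finset.sum_congr rfl fun a _ => ?_
    rw [← Finset.mul_sum, mul_div_assoc, Finset.sum_comm, Finset.sum_div]
    congr 1
    refine Finset.sum_congr rfl fun b _ => ?_
    rw [← Finset.sum_mul]; ring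
  rw [e]
  simp only [Matrix.mulVec, dotProduct]
  exact tendsto_finsetSum _ fun a _ =>
    (tendsto_finsetSum _ fun b _ => (hV a b).mul_const _).const_mul _

lemma posSemidef_of_tendsto_avgE {f : ℕ → Ω → Matrix ι ι ℝ} {V : Matrix ι ι ℝ}
    (hf : ∀ s a b, Integrable (fun ω => f s ω a b) P)
    (hV : ∀ a b, Tendsto (avgE P (fun s ω => f s ω a b)) atTop (𝓝 (V a b)))
    (hps : ∀ s ω, (f s ω).PosSemidef) : V.PosSemidef := by
  refine Matrix.PosSemidef.of_dotProduct_mulVec_nonneg ?_ fun u => ?_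
  · ext a b
    rw [Matrix.conjTranspose_apply, star_trivial]
    refine tendsto_nhds_unique (hV b a) ((hV a b).congr fun S => ?_)
    simp only [avgE]
    congr 1
    refine Finset.sum_congr rfl fun s _ => ?_
    congr 1; ext ω
    have := (hps s ω).1.apply b a
    simpa using this
  · rw [star_trivial]
    refine ge_of_tendsto' (tendsto_avgE_quadratic hf hV u) fun S => ?_
    refine div_nonneg (Finset.sum_nonneg fun s _ => integral_nonneg fun ω => ?_) (Nat.cast_nonneg S)
    have := (hps s ω).dotProduct_mulVec_nonneg u
    simpa using this

end quad

section clt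
variable {Ω : Type*} [MeasurableSpace Ω] {P : Measure Ω} [IsProbabilityMeasure P] {ι μ : Type*}
    [Fintype ι]
  [Fintype μ] [DecidableEq μ]

lemma dotProduct_vecMulVec_mulVec (k u : ι → ℝ) :
    u ⬝ᵥ Matrix.mulVec (Matrix.vecMulVec k k) u = (∑ a, u a * k a) ^ 2 := by
  rw [Matrix.vecMulVec_mulVec, sq]
  simp [dotProduct, mul_comm, mul_left_comm, Finset.mul_sum]

/-- Central limit theorem for a linear image of the normalized sum of independent, centred and
uniformly square-integrable vectors, by the Cramér–Wold device. -/
theorem tendstoInDistribution_normalized_sum {κ : ℕ → Ω → ι → ℝ} (hind : iIndepFun κ P)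
    (hUI : ∀ a, UniformIntegrable (fun s ω => κ s ω a) 2 P) (h0 : ∀ s a, ∫ ω, κ s ω a ∂P = 0)
    {V : Matrix ι ι ℝ} (hV : ∀ a b,
      Tendsto (avgE P (fun s ω => κ s ω a * κ s ω b)) atTop (𝓝 (V a b)))
    (M : Matrix μ ι ℝ) :
    TendstoInDistribution (fun (S : ℕ) ω => WithLp.toLp 2
        (Matrix.mulVec M ((√(S : ℝ))⁻¹ • ∑ s ∈ Finset.range S, κ s ω)))
      atTop id (fun _ => P) (multivariateGaussian 0 (M * V * M.transpose)) := by
  have hL2 : ∀ s a, MemLp (fun ω => κ s ω a) 2 P := fun s a => (hUI a).memLp s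
  have hint : ∀ s a b, Integrable (fun ω => Matrix.vecMulVec (κ s ω) (κ s ω) a b) P :=
    fun s a b => (hL2 s a).integrable_mul (hL2 s b)
  have hps : V.PosSemidef := posSemidef_of_tendsto_avgE (P := P)
    (f := fun s ω => Matrix.vecMulVec (κ s ω) (κ s ω)) hint hV
    fun s ω => by simpa using Matrix.posSemidef_vecMulVec_self_star (κ s ω)
  have hpsM : (M * V * M.transpose).PosSemidef := by
    simpa using hps.mul_mul_conjTranspose_same M
  have hmeas : ∀ s, AEMeasurable (κ s) P :=
    fun s => aemeasurable_pi_iff.2 fun a => (hL2 s a).1.aemeasurable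
  have hmeasS : ∀ S : ℕ, AEMeasurable (fun ω => WithLp.toLp 2
      (Matrix.mulVec M ((√(S : ℝ))⁻¹ • ∑ s ∈ Finset.range S, κ s ω))) P := by
    intro S
    have h1 : AEMeasurable (fun ω => (√(S : ℝ))⁻¹ • ∑ s ∈ Finset.range S, κ s ω) P :=
      AEMeasurable.const_smul (g := fun ω => ∑ s ∈ Finset.range S, κ s ω)
        (Finset.aemeasurable_fun_sum _ fun s _ => hmeas s) (√(S : ℝ))⁻¹
    have h2 : Continuous fun v : ι → ℝ => WithLp.toLp 2 (Matrix.mulVec M v) := by fun_prop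
    exact h2.measurable.comp_aemeasurable h1
  refine ⟨hmeasS, by fun_prop, ?_⟩
  refine ProbabilityMeasure.tendsto_iff_tendsto_charFun.2 fun t => ?_
  simp only [Measure.map_id, ProbabilityMeasure.coe_mk]
  rw [charFun_multivariateGaussian hpsM]
  -- the scalar central limit theorem along the direction `Mᵀ t`
  set u : ι → ℝ := Matrix.mulVec M.transpose t.ofLp with hu
  have hX := tendsto_integral_cexp_normalized_sum (P := P) (X := fun s ω => ∑ a, u a * κ s ω a)
    (v := u ⬝ᵥ Matrix.mulVec V u) ?_ ?_ ?_ ?_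
  · convert hX using 2 with S
    · rw [charFun_apply, integral_map (hmeasS S) (by fun_prop)]
      congr 1; ext ω
      congr 3
      rw [EuclideanSpace.inner_eq_star_dotProduct]
      simp only [star_trivial]
      rw [Matrix.dotProduct_mulVec, ← Matrix.mulVec_transpose, ← hu, dotProduct_smul, smul_eq_mul]
      congr 1
      simp only [dotProduct, Finset.sum_apply, Finset.mul_sum]
      rw [Finset.sum_comm]
    · have e : t.ofLp ⬝ᵥ Matrix.mulVec (M * V * M.transpose) t.ofLp = u ⬝ᵥ Matrix.mulVec V u := by
        rw [← Matrix.mulVec_mulVec, ← Matrix.mulVec_mulVec, ← hu, Matrix.dotProduct_mulVec,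
          ← Matrix.mulVec_transpose, ← hu]
      rw [e]
      simp
  · refine hind.comp (fun s k => ∑ a, u a * k a) fun s => ?_
    exact Finset.measurable_sum _ fun a _ => (measurable_pi_apply a).const_mul _
  · exact UniformIntegrable.finsetSum (by norm_num) (by norm_num) _ fun a _ =>
      UniformIntegrable.const_mul _ (hUI a)
  · intro s
    rw [integral_finsetSum _ fun a _ => ((hL2 s a).integrable (by norm_num)).const_mul _]
    refine Finset.sum_eq_zero fun a _ => ?_
    rw [integral_const_mul, h0, mul_zero]
  · have := tendsto_avgE_quadratic hint hV u
    simpa only [dotProduct_vecMulVec_mulVec] using this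

end clt

/-! ### Asymptotic linearity of the first step -/

section
variable {Ω : Type*} [MeasurableSpace Ω] {P : Measure Ω} [IsProbabilityMeasure P]

omit [IsProbabilityMeasure P] in
lemma avgE_congr_linear {f g h : ℕ → Ω → ℝ} {a b : ℝ}
    (hfgh : ∀ s, ∫ ω, f s ω ∂P = a * ∫ ω, g s ω ∂P + b * ∫ ω, h s ω ∂P) (S : ℕ) :
    avgE P f S = a * avgE P g S + b * avgE P h S := by
  simp only [avgE, hfgh, Finset.sum_add_distrib, ← Finset.mul_sum]
  ring

/-- The limiting moments are those of a mixture, and the average expected moments of the first `S`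
groups identify `p` exactly, for large `S`. -/
theorem isMixture_limit_and_eventually_rates_eq {K : ℕ} {n : ℕ → ℕ} {p : Fin 2 → ℝ}
    {G H : (s : ℕ) → Ω → Matrix (Fin (n s)) (Fin (n s)) ℝ}
    {X : (s : ℕ) → Ω → Matrix (Fin (n s)) (Fin K) ℝ}
    (hmodel : ∀ s, LinkModel P (G s) (H s) (X s) p)
    {φ : (m : ℕ) → Matrix (Fin m) (Fin K) ℝ → Fin m → Fin m → Fin 2}
    (hφ : ∀ m i j, Measurable (fun x => φ m x i j))
    {υ₀ : Fin 4 × Fin 2 → ℝ}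
    (hυ₀ : ∀ q, Tendsto (avgE P (fun s ω => groupMoments (φ (n s) (X s ω)) (H s ω) q)) atTop
      (𝓝 (υ₀ q)))
    (hφpos : ∀ d, 0 < υ₀ (0, d)) {π : Fin 2 → ℝ}
    (hπ : ∀ d, Tendsto (avgE P (fun s ω => pairAverage (φ (n s) (X s ω)) d (G s ω))) atTop
      (𝓝 (π d * υ₀ (0, d))))
    (hπpos : 0 < π 1) (hπne : π 1 ≠ π 0) :
    IsMixture p π υ₀ ∧ ∀ᶠ S in atTop,
      rates (fun q => avgE P (fun s ω => groupMoments (φ (n s) (X s ω)) (H s ω) q) S) = p := by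
  have hp : p 0 + p 1 < 1 := (hmodel 0).a2.2
  set m : ℕ → Fin 4 × Fin 2 → ℝ := fun S q =>
    avgE P (fun s ω => groupMoments (φ (n s) (X s ω)) (H s ω) q) S with hmdef
  -- the expected moments are those of a mixture, in every finite sample and in the limit
  have h1 : ∀ d S, m S (1, d) = p 0 * m S (0, d) + (1 - p 0 - p 1) *
      avgE P (fun s ω => pairAverage (φ (n s) (X s ω)) d (G s ω)) S := fun d S =>
    avgE_congr_linear (fun s => ((hmodel s).integral_groupMoments (hφ (n s)) d).1) S
  have h2 : ∀ d S, m S (2, d) = p 0 * m S (0, d) + (1 - p 0 - p 1) *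
      avgE P (fun s ω => pairAverage (φ (n s) (X s ω)) d (G s ω)) S := fun d S =>
    avgE_congr_linear (fun s => ((hmodel s).integral_groupMoments (hφ (n s)) d).2.1) S
  have h3 : ∀ d S, m S (3, d) =
    (2 * p 0 - p 0 ^ 2) * m S (0, d) + (1 - p 0 - p 1) * (1 - p 0 + p 1) *
      avgE P (fun s ω => pairAverage (φ (n s) (X s ω)) d (G s ω)) S := fun d S =>
    avgE_congr_linear (fun s => ((hmodel s).integral_groupMoments (hφ (n s)) d).2.2) S
  have hmix0 : IsMixture p π υ₀ := by
    refine ⟨fun d => ?_, fun d => ?_, fun d => ?_⟩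
    · refine tendsto_nhds_unique (hυ₀ (1, d))
        ((((hυ₀ (0, d)).const_mul _).add ((hπ d).const_mul _)).congr fun S => ?_)
      exact (h1 d S).symm
    · refine tendsto_nhds_unique (hυ₀ (2, d))
        ((((hυ₀ (0, d)).const_mul _).add ((hπ d).const_mul _)).congr fun S => ?_)
      exact (h2 d S).symm
    · refine tendsto_nhds_unique (hυ₀ (3, d))
        ((((hυ₀ (0, d)).const_mul _).add ((hπ d).const_mul _)).congr fun S => ?_)
      exact (h3 d S).symm
  have hne0 : ∀ d, υ₀ (0, d) ≠ 0 := fun d => (hφpos d).ne'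
  refine ⟨hmix0, ?_⟩
  have hexact : ∀ᶠ S in atTop, rates (m S) = p := by
    have hπS : ∀ d, Tendsto (fun S =>
      avgE P (fun s ω => pairAverage (φ (n s) (X s ω)) d (G s ω)) S / m S (0, d))
        atTop (𝓝 (π d)) := fun d => by
      have := (hπ d).div (hυ₀ (0, d)) (hne0 d)
      rwa [mul_div_cancel_right₀ _ (hne0 d)] at this
    have hpos : ∀ᶠ S in atTop, ∀ d, 0 < m S (0, d) :=
      eventually_all.2 fun d => (hυ₀ (0, d)).eventually_const_lt (hφpos d)
    filter_upwards [hpos, (hπS 1).eventually_const_lt hπpos,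
      ((hπS 1).sub (hπS 0)).eventually_ne (sub_ne_zero.2 hπne)] with S e1 e2 e3
    have hmix : IsMixture p (fun d =>
        avgE P (fun s ω => pairAverage (φ (n s) (X s ω)) d (G s ω)) S / m S (0, d)) (m S) := by
      refine ⟨fun d => ?_, fun d => ?_, fun d => ?_⟩
      · rw [div_mul_cancel₀ _ (e1 d).ne']; exact h1 d S
      · rw [div_mul_cancel₀ _ (e1 d).ne']; exact h2 d S
      · rw [div_mul_cancel₀ _ (e1 d).ne']; exact h3 d S
    exact hmix.rates_eq (fun d => (e1 d).ne') hp (sub_ne_zero.1 e3) e2.ne'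
  exact hexact

set_option maxHeartbeats 400000 in
/-- The estimator of the rates is consistent and asymptotically linear. The expansion is around the
average expected moments of the first `S` groups, where `rates` takes the value `p`, rather than
around their limit `υ₀`, to which they may converge arbitrarily slowly. -/
theorem first_stage_expansion {K : ℕ} {n : ℕ → ℕ} (hn : ∀ s, 3 ≤ n s) {p : Fin 2 → ℝ}
    {G H : (s : ℕ) → Ω → Matrix (Fin (n s)) (Fin (n s)) ℝ}
    {X : (s : ℕ) → Ω → Matrix (Fin (n s)) (Fin K) ℝ}
    (hmodel : ∀ s, LinkModel P (G s) (H s) (X s) p)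
    {φ : (m : ℕ) → Matrix (Fin m) (Fin K) ℝ → Fin m → Fin m → Fin 2}
    (hφ : ∀ m i j, Measurable (fun x => φ m x i j))
    (hind : iIndepFun (fun s ω => groupMoments (φ (n s) (X s ω)) (H s ω)) P)
    {υ₀ : Fin 4 × Fin 2 → ℝ}
    (hυ₀ : ∀ q, Tendsto (avgE P (fun s ω => groupMoments (φ (n s) (X s ω)) (H s ω) q)) atTop
      (𝓝 (υ₀ q)))
    (hφpos : ∀ d, 0 < υ₀ (0, d)) {π : Fin 2 → ℝ}
    (hπ : ∀ d, Tendsto (avgE P (fun s ω => pairAverage (φ (n s) (X s ω)) d (G s ω))) atTop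
      (𝓝 (π d * υ₀ (0, d))))
    (hπpos : 0 < π 1) (hπne : π 1 ≠ π 0) :
    Tendsto (fun x : ℕ × Ω => ratesEstimator φ n (fun s => H s x.2) (fun s => X s x.2) x.1) (whp P)
      (𝓝 p) ∧
    Tendsto (fun x : ℕ × Ω => √(x.1 : ℝ) •
      (ratesEstimator φ n (fun s => H s x.2) (fun s => X s x.2) x.1 - p) -
      (√(x.1 : ℝ))⁻¹ • ∑ s ∈ Finset.range x.1, firstStageInfluence P (jacobian rates υ₀)
        (fun ω' => groupMoments (φ (n s) (X s ω')) (H s ω')) x.2) (whp P) (𝓝 0) := by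
  have hp : p 0 + p 1 < 1 := (hmodel 0).a2.2
  have hm : ∀ s, Measurable fun ω => groupMoments (φ (n s) (X s ω)) (H s ω) := fun s =>
    measurable_groupMoments (hφ (n s)) (hmodel s).measH (hmodel s).measX
  have hb : ∀ q s ω, |groupMoments (φ (n s) (X s ω)) (H s ω) q| ≤ 3 := fun q s ω =>
    abs_groupMoments_le (hn s) _ ((hmodel s).adjH ω) q
  have hmq : ∀ q s, Measurable fun ω => groupMoments (φ (n s) (X s ω)) (H s ω) q := fun q s =>
    (measurable_pi_apply q).comp (hm s)
  have hindq : ∀ q, iIndepFun (fun s ω => groupMoments (φ (n s) (X s ω)) (H s ω) q) P := fun q =>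
    hind.comp (fun _ v => v q) fun _ => measurable_pi_apply q
  have hUI : ∀ q, UniformIntegrable (fun s ω => groupMoments (φ (n s) (X s ω)) (H s ω) q) 1 P :=
    fun q =>
    uniformIntegrable_of_bounded le_rfl (by norm_num) (fun s => (hmq q s).aestronglyMeasurable)
      (hb q)
  have hUI2 : ∀ q, UniformIntegrable (fun s ω => groupMoments (φ (n s) (X s ω)) (H s ω) q) 2 P :=
    fun q =>
    uniformIntegrable_of_bounded (by norm_num) (by norm_num) (fun s =>
      (hmq q s).aestronglyMeasurable) (hb q)
  set m : ℕ → Fin 4 × Fin 2 → ℝ := fun S q =>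
    avgE P (fun s ω => groupMoments (φ (n s) (X s ω)) (H s ω) q) S with hmdef
  set υ : ℕ × Ω → Fin 4 × Fin 2 → ℝ := fun x q =>
    (∑ s ∈ Finset.range x.1, groupMoments (φ (n s) (X s x.2)) (H s x.2) q) / x.1 with hυdef
  have hm0 : Tendsto m atTop (𝓝 υ₀) := tendsto_pi_nhds.2 hυ₀
  obtain ⟨hmix0, hexact⟩ :=
    isMixture_limit_and_eventually_rates_eq hmodel hφ hυ₀ hφpos hπ hπpos hπne
  have hne0 : ∀ d, υ₀ (0, d) ≠ 0 := fun d => (hφpos d).ne'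
  have hrates0 : rates υ₀ = p := hmix0.rates_eq hne0 hp hπne hπpos.ne'
  have hD := hmix0.hasStrictFDerivAt_rates hne0 hp hπne hπpos.ne'
  have hmw : Tendsto (fun x : ℕ × Ω => m x.1) (whp P) (𝓝 υ₀) := hm0.comp tendsto_fst_whp
  have hυ : Tendsto υ (whp P) (𝓝 υ₀) := by
    refine tendsto_pi_nhds.2 fun q => ?_
    have := (weak_law (hindq q) (hUI q)).add (tendsto_pi_nhds.1 hmw q)
    rw [zero_add] at this
    exact this.congr fun x => sub_add_cancel _ _
  have hest : ∀ x : ℕ × Ω, ratesEstimator φ n (fun s => H s x.2) (fun s => X s x.2) x.1 =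
    rates (υ x) := fun _ => rfl
  refine ⟨?_, ?_⟩
  · simp only [hest]
    have := hD.continuousAt.tendsto.comp hυ
    rwa [hrates0] at this
  -- linearization around the expected moments
  have hlo : (fun x : ℕ × Ω =>
    rates (υ x) - rates (m x.1) - fderiv ℝ rates υ₀ (υ x - m x.1)) =o[whp P]
      fun x => υ x - m x.1 :=
    hD.isLittleO.comp_tendsto (hυ.prodMk_nhds hmw)
  have hlo' : (fun x : ℕ × Ω => √(x.1 : ℝ) •
    (rates (υ x) - rates (m x.1) - fderiv ℝ rates υ₀ (υ x - m x.1))) =o[whp P]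
      fun x => √(x.1 : ℝ) • (υ x - m x.1) := (Asymptotics.isBigO_refl _ _).smul_isLittleO hlo
  have hscale : ∀ x : ℕ × Ω, √(x.1 : ℝ) • (υ x - m x.1) =
    fun q => (√(x.1 : ℝ))⁻¹ * ∑ s ∈ Finset.range x.1,
      (groupMoments (φ (n s) (X s x.2)) (H s x.2) q - ∫ ω',
          groupMoments (φ (n s) (X s ω')) (H s ω') q ∂P) := by
    intro x
    ext q
    simp only [Pi.smul_apply, Pi.sub_apply, smul_eq_mul, hυdef, hmdef, avgE]
    rw [div_sub_div_same, ← Finset.sum_sub_distrib, mul_div_assoc', mul_comm, mul_div_assoc,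
      mul_comm]
    congr 1
    rcases Nat.eq_zero_or_pos x.1 with h | h
    · simp [h]
    · exact Real.sqrt_div_self
  have hOP : BoundedInProb P (fun x : ℕ × Ω => √(x.1 : ℝ) • (υ x - m x.1)) := by
    refine boundedInProb_pi fun q => ?_
    obtain ⟨D, _, hD⟩ := UniformIntegrable.exists_integral_sq_le (hUI2 q)
    have := boundedInProb_normalized_sum (hindq q) (fun s => (hUI2 q).memLp s) hD
    simpa only [hscale] using this
  refine (hOP.tendsto_zero_of_isLittleO hlo').congr' ?_
  filter_upwards [tendsto_fst_whp.eventually hexact] with x hx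
  rw [hest, hx, smul_sub]
  congr 1
  rw [← (fderiv ℝ rates υ₀).map_smul, ← jacobian_mulVec, hscale]
  simp only [firstStageInfluence]
  rw [← Matrix.mulVec_sum, ← Matrix.mulVec_smul]
  congr 1
  ext q
  simp

end

/-! ### Asymptotic normality -/

set_option maxHeartbeats 400000 in
theorem proposition5 {Ω : Type*} [MeasurableSpace Ω] (P : Measure Ω) [IsProbabilityMeasure P]
    {K : ℕ}
    -- group sizes
    (n : ℕ → ℕ) (hn : ∀ s, 3 ≤ n s)
    -- parameters: `λ`, `β` and the misclassification rates `p = (p₀, p₁)`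
    (lam : ℝ) (β : Fin K → ℝ) (p : Fin 2 → ℝ)
    -- actual network, reported network, covariates, structural errors, outcomes
    (G H : (s : ℕ) → Ω → Matrix (Fin (n s)) (Fin (n s)) ℝ)
    (X : (s : ℕ) → Ω → Matrix (Fin (n s)) (Fin K) ℝ)
    (ε y : (s : ℕ) → Ω → Fin (n s) → ℝ)
    (hG : ∀ s, Measurable (G s)) (hH : ∀ s, Measurable (H s)) (hX : ∀ s, Measurable (X s))
    (hε : ∀ s, Measurable (ε s)) (hy : ∀ s, Measurable (y s))
    (hGadj : ∀ s ω, IsAdjacency (G s ω)) (hHadj : ∀ s ω, IsAdjacency (H s ω))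
    -- the actual links are undirected
    (hGsymm : ∀ s, ∀ᵐ ω ∂P, (G s ω).IsSymm)
    -- the structural form
    (hinv : ∀ s, ∀ᵐ ω ∂P, IsUnit (1 - lam • G s ω))
    (hstruct : ∀ s, ∀ᵐ ω ∂P,
      y s ω = lam • Matrix.mulVec (G s ω) (y s ω) + Matrix.mulVec (X s ω) β + ε s ω)
    -- independent groups
    (hindep : iIndepFun (fun s ω => (G s ω, H s ω, X s ω, ε s ω)) P)
    -- (A1)-(A4)
    (hA1 : ∀ s, AssumptionA1 P (G s) (H s) (X s))
    (hA2 : ∀ s, AssumptionA2 P (G s) (H s) (X s) p)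
    (hA3 : ∀ s, AssumptionA3 P (G s) (H s) (X s) (ε s))
    (hA4 : ∀ s, AssumptionA4 P (G s) (H s) (X s))
    -- the binary functions `φ_ij(X)`
    (φ : (m : ℕ) → Matrix (Fin m) (Fin K) ℝ → Fin m → Fin m → Fin 2)
    (hφ : ∀ m i j, Measurable (fun x => φ m x i j))
    -- population counterpart of the first-stage moments; `π d` is the average probability of an
    -- actual link given `φ = d`
    (υ₀ : Fin 4 × Fin 2 → ℝ)
    (hυ₀ : ∀ q, Tendsto (avgE P (fun s ω => groupMoments (φ (n s) (X s ω)) (H s ω) q)) atTop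
      (𝓝 (υ₀ q)))
    (hφpos : ∀ d, 0 < υ₀ (0, d))
    (π : Fin 2 → ℝ)
    (hπ : ∀ d, Tendsto (avgE P (fun s ω => pairAverage (φ (n s) (X s ω)) d (G s ω))) atTop
      (𝓝 (π d * υ₀ (0, d))))
    (hπpos : 0 < π 1) (hπne : π 1 ≠ π 0)
    -- the limits `A₀`, `B₀`, `F₀` of average moments, and the rank condition (IV-R)
    (A₀ : Matrix (Fin K ⊕ Fin K) (Unit ⊕ Fin K) ℝ)
    (B₀ : Matrix (Fin K ⊕ Fin K) (Fin K ⊕ Fin K) ℝ)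
    (F₀ : Matrix (Fin K ⊕ Fin K) (Fin 2) ℝ)
    (hA₀ : ∀ a b, Tendsto (avgE P (fun s ω => ((instruments (H s ω) (X s ω)).transpose *
      regressors (H s ω) (X s ω) (y s ω) p) a b)) atTop (𝓝 (A₀ a b)))
    (hB₀ : ∀ a b, Tendsto (avgE P (fun s ω => ((instruments (H s ω) (X s ω)).transpose *
      instruments (H s ω) (X s ω)) a b)) atTop (𝓝 (B₀ a b)))
    (hF₀ : ∀ a k, Tendsto (avgE P (fun s ω => momentGradient (H s ω) (X s ω) (y s ω)
      (coefficients lam β) p a k)) atTop (𝓝 (F₀ a k)))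
    (hrankA : A₀.rank = K + 1) (hrankB : B₀.rank = 2 * K)
    -- uniform integrability for the laws of large numbers and the central limit theorem
    (hUIR : ∀ a b, UniformIntegrable (fun s ω => ((instruments (H s ω) (X s ω)).transpose *
      regressors (H s ω) (X s ω) (y s ω) p) a b) 1 P)
    (hUIZ : ∀ a b, UniformIntegrable (fun s ω => ((instruments (H s ω) (X s ω)).transpose *
      instruments (H s ω) (X s ω)) a b) 1 P)
    (hUIgrad : ∀ a k, UniformIntegrable (fun s ω => instrumentedGradient (H s ω) (X s ω) (y s ω)
      p a k) 1 P)
    (hUIv : ∀ a, UniformIntegrable (fun s ω => instrumentedError lam p (G s ω) (H s ω) (X s ω)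
      (y s ω) (ε s ω) a) 2 P)
    -- the influence functions `τ_s` and `κ_s`
    (τ : (s : ℕ) → Ω → Fin 2 → ℝ)
    (hτ : ∀ s ω, τ s ω = firstStageInfluence P (jacobian rates υ₀)
      (fun ω' => groupMoments (φ (n s) (X s ω')) (H s ω')) ω)
    (κ : (s : ℕ) → Ω → Fin K ⊕ Fin K → ℝ)
    (hκ : ∀ s ω, κ s ω = instrumentedError lam p (G s ω) (H s ω) (X s ω) (y s ω) (ε s ω) -
      Matrix.mulVec F₀ (τ s ω))
    -- the (average) second moment `E(κ_s κ_s')`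
    (V : Matrix (Fin K ⊕ Fin K) (Fin K ⊕ Fin K) ℝ)
    (hV : ∀ a b, Tendsto (avgE P (fun s ω => κ s ω a * κ s ω b)) atTop (𝓝 (V a b))) :
    TendstoInDistribution
      (fun (S : ℕ) ω => √(S : ℝ) • WithLp.toLp 2
        (twoStepEstimator φ n (fun s => H s ω) (fun s => X s ω) (fun s => y s ω) S -
          coefficients lam β))
      atTop id (fun _ => P)
      (multivariateGaussian 0 (twoStageMatrix A₀ B₀ * V * (twoStageMatrix A₀ B₀).transpose)) := by
  have hp : 1 - p 0 - p 1 ≠ 0 := by linarith [(hA2 0).2]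
  have hmodel : ∀ s, LinkModel P (G s) (H s) (X s) p := fun s =>
    ⟨hG s, hH s, hX s, hGadj s, hHadj s, hGsymm s, hA1 s, hA2 s, hA4 s⟩
  have hred : ∀ s, ∀ᵐ ω ∂P, y s ω =
      Matrix.mulVec (1 - lam • G s ω)⁻¹ (Matrix.mulVec (X s ω) β + ε s ω) := fun s => by
    filter_upwards [hinv s, hstruct s] with ω h1 h2
    exact reduced_form h1 (by rw [← add_assoc]; exact h2)
  have hindY := iIndepFun_with_outcome hindep hred
  have mH : ∀ s, Measurable
    fun z : Matrix (Fin (n s)) (Fin (n s)) ℝ × Matrix (Fin (n s)) (Fin (n s)) ℝ ×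
      Matrix (Fin (n s)) (Fin K) ℝ × (Fin (n s) → ℝ) × (Fin (n s) → ℝ) => z.2.1 :=
        fun s => measurable_snd.fst
  have mX : ∀ s, Measurable
    fun z : Matrix (Fin (n s)) (Fin (n s)) ℝ × Matrix (Fin (n s)) (Fin (n s)) ℝ ×
      Matrix (Fin (n s)) (Fin K) ℝ × (Fin (n s) → ℝ) × (Fin (n s) → ℝ) => z.2.2.1 :=
        fun s => measurable_snd.snd.fst
  have mε : ∀ s, Measurable
    fun z : Matrix (Fin (n s)) (Fin (n s)) ℝ × Matrix (Fin (n s)) (Fin (n s)) ℝ ×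
      Matrix (Fin (n s)) (Fin K) ℝ × (Fin (n s) → ℝ) × (Fin (n s) → ℝ) => z.2.2.2.1 :=
        fun s => measurable_snd.snd.snd.fst
  have my : ∀ s, Measurable
    fun z : Matrix (Fin (n s)) (Fin (n s)) ℝ × Matrix (Fin (n s)) (Fin (n s)) ℝ ×
      Matrix (Fin (n s)) (Fin K) ℝ × (Fin (n s) → ℝ) × (Fin (n s) → ℝ) => z.2.2.2.2 :=
        fun s => measurable_snd.snd.snd.snd
  -- the group statistics are functions of the independent tuples `(G, H, X, ε, y)`
  have hindR : ∀ a b, iIndepFun (fun s ω => ((instruments (H s ω) (X s ω)).transpose *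
      regressors (H s ω) (X s ω) (y s ω) p) a b) P := fun a b =>
    hindY.comp (fun s z =>
      ((instruments z.2.1 z.2.2.1).transpose * regressors z.2.1 z.2.2.1 z.2.2.2.2 p) a b)
      fun s => (measurable_matrix_mul
        (measurable_matrix_transpose (measurable_instruments (mH s) (mX s)))
        (measurable_regressors (mH s) (mX s) (my s) measurable_const)).matrix_apply a b
  have hindZ : ∀ a b, iIndepFun (fun s ω => ((instruments (H s ω) (X s ω)).transpose *
      instruments (H s ω) (X s ω)) a b) P := fun a b =>
    hindY.comp (fun s z => ((instruments z.2.1 z.2.2.1).transpose * instruments z.2.1 z.2.2.1) a b)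
      fun s => (measurable_matrix_mul
        (measurable_matrix_transpose (measurable_instruments (mH s) (mX s)))
        (measurable_instruments (mH s) (mX s))).matrix_apply a b
  have hindg : ∀ a k, iIndepFun (fun s ω => instrumentedGradient (H s ω) (X s ω) (y s ω) p a k) P :=
    fun a k =>
    hindY.comp (fun s z => instrumentedGradient z.2.1 z.2.2.1 z.2.2.2.2 p a k)
      fun s => (measurable_instrumentedGradient (mH s) (mX s) (my s) hp).matrix_apply a k
  have hindυ : iIndepFun (fun s ω => groupMoments (φ (n s) (X s ω)) (H s ω)) P :=
    hindY.comp (fun s z => groupMoments (φ (n s) z.2.2.1) z.2.1)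
      fun s => measurable_groupMoments (hφ (n s)) (mH s) (mX s)
  have hκ' : ∀ s ω, κ s ω = instrumentedError lam p (G s ω) (H s ω) (X s ω) (y s ω) (ε s ω) -
      Matrix.mulVec F₀ (firstStageInfluence P (jacobian rates υ₀)
        (fun ω' => groupMoments (φ (n s) (X s ω')) (H s ω')) ω) := fun s ω => by rw [hκ, hτ]
  have hindκ : iIndepFun κ P := by
    have h1 := hindY.comp (fun s z =>
      instrumentedError lam p z.1 z.2.1 z.2.2.1 z.2.2.2.2 z.2.2.2.1 -
      Matrix.mulVec F₀ (Matrix.mulVec (jacobian rates υ₀) (fun q =>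
        groupMoments (φ (n s) z.2.2.1) z.2.1 q -
        ∫ ω', groupMoments (φ (n s) (X s ω')) (H s ω') q ∂P)))
      fun s => (measurable_instrumentedError measurable_fst (mH s) (mX s) (mε s) (my s) lam p).sub
        (measurable_matrix_mulVec measurable_const (measurable_matrix_mulVec measurable_const
          (measurable_pi_iff.2 fun q => ((measurable_pi_apply q).comp
            (measurable_groupMoments (hφ (n s)) (mH s) (mX s))).sub measurable_const)))
    refine h1.congr fun s => ae_of_all _ fun ω => ?_
    rw [hκ']; rfl
  -- the first-stage influence functions
  have hmυ : ∀ s q, Measurable fun ω => groupMoments (φ (n s) (X s ω)) (H s ω) q := fun s q =>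
    (measurable_pi_apply q).comp (measurable_groupMoments (hφ (n s)) (hH s) (hX s))
  have hbυ : ∀ s ω q, |groupMoments (φ (n s) (X s ω)) (H s ω) q| ≤ 3 := fun s ω q =>
    abs_groupMoments_le (hn s) _ (hHadj s ω) q
  have hiυ : ∀ s q, Integrable (fun ω => groupMoments (φ (n s) (X s ω)) (H s ω) q) P := fun s q =>
    Integrable.of_bound (hmυ s q).aestronglyMeasurable 3 (ae_of_all _ fun ω => hbυ s ω q)
  have hτ' : ∀ s ω k, τ s ω k = ∑ q, jacobian rates υ₀ k q *
      (groupMoments (φ (n s) (X s ω)) (H s ω) q - ∫ ω',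
        groupMoments (φ (n s) (X s ω')) (H s ω') q ∂P) :=
    fun s ω k => by rw [hτ]; rfl
  have hcυ : ∀ s q, IsCentered P (fun ω => groupMoments (φ (n s) (X s ω)) (H s ω) q -
      ∫ ω', groupMoments (φ (n s) (X s ω')) (H s ω') q ∂P) := fun s q =>
    ⟨(hiυ s q).sub (integrable_const _), by rw [integral_sub (hiυ s q) (integrable_const _)]; simp⟩
  have hcτ : ∀ s k, IsCentered P (fun ω => τ s ω k) := fun s k => by
    simp only [hτ']
    exact IsCentered.sum _ fun q _ => (hcυ s q).const_mul _
  have hUIτ : ∀ k, UniformIntegrable (fun s ω => τ s ω k) 2 P := fun k => by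
    simp only [hτ']
    refine UniformIntegrable.finsetSum (by norm_num) (by norm_num) _ fun q _ =>
        UniformIntegrable.const_mul _ ?_
    refine uniformIntegrable_of_bounded (C := 6) (by norm_num) (by norm_num)
      (fun s => (hcυ s q).1.1) fun s ω => ?_
    have h1 : |∫ ω', groupMoments (φ (n s) (X s ω')) (H s ω') q ∂P| ≤ 3 := by
      have := norm_integral_le_of_norm_le_const (μ := P) (C := 3)
        (f := fun ω' => groupMoments (φ (n s) (X s ω')) (H s ω') q) (ae_of_all _ fun ω => hbυ s ω q)
      simpa using this
    refine (abs_sub _ _).trans ?_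
    linarith [hbυ s ω q]
  have hindτ : ∀ k, iIndepFun (fun s ω => τ s ω k) P := fun k => by
    have := hindυ.comp (fun s v => ∑ q, jacobian rates υ₀ k q *
      (v q - ∫ ω', groupMoments (φ (n s) (X s ω')) (H s ω') q ∂P)) fun s =>
        Finset.measurable_sum _ fun q _ =>
          ((measurable_pi_apply q).sub measurable_const).const_mul _
    exact this.congr fun s => ae_of_all _ fun ω => (hτ' s ω k).symm
  -- the influence functions `κ` are centred and uniformly square integrable
  have hκa : ∀ s ω a, κ s ω a = instrumentedError lam p (G s ω) (H s ω) (X s ω) (y s ω) (ε s ω) a +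
      ∑ k, (-F₀ a k) * τ s ω k := fun s ω a => by
    rw [hκ]; simp [Matrix.mulVec, dotProduct, sub_eq_add_neg]
  have hcv : ∀ s a, IsCentered P (fun ω =>
      instrumentedError lam p (G s ω) (H s ω) (X s ω) (y s ω) (ε s ω) a) := fun s a => by
    have hi := ((hUIv a).memLp s).integrable (by norm_num)
    exact ⟨hi, (hmodel s).integral_instrumentedError_eq_zero (hA3 s) (hred s) a hi⟩
  have hcκ : ∀ s a, IsCentered P (fun ω => κ s ω a) := fun s a => by
    simp only [hκa]
    exact (hcv s a).add (IsCentered.sum _ fun k _ => (hcτ s k).const_mul _)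
  have hUIκ : ∀ a, UniformIntegrable (fun s ω => κ s ω a) 2 P := fun a => by
    simp only [hκa]
    exact UniformIntegrable.add (by norm_num) (hUIv a)
      (UniformIntegrable.finsetSum (by norm_num) (by norm_num) _ fun k _ =>
        UniformIntegrable.const_mul _ (hUIτ k))
  have hOPτ : ∀ k, BoundedInProb P (fun x : ℕ × Ω =>
      ((√(x.1 : ℝ))⁻¹ • ∑ s ∈ Finset.range x.1, τ s x.2) k) := fun k => by
    obtain ⟨D, _, hD⟩ := UniformIntegrable.exists_integral_sq_le (hUIτ k)
    have := boundedInProb_normalized_sum (hindτ k) (fun s => (hUIτ k).memLp s) hD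
    simpa [(hcτ _ k).mean] using this
  have hOPκ : ∀ a, BoundedInProb P (fun x : ℕ × Ω =>
      ((√(x.1 : ℝ))⁻¹ • ∑ s ∈ Finset.range x.1, κ s x.2) a) := fun a => by
    obtain ⟨D, _, hD⟩ := UniformIntegrable.exists_integral_sq_le (hUIκ a)
    have := boundedInProb_normalized_sum (hindκ.comp (fun _ v => v a) fun _ =>
      measurable_pi_apply a)
      (fun s => (hUIκ a).memLp s) hD
    simpa [(hcκ _ a).mean] using this
  obtain ⟨hphat, hphatexp⟩ := first_stage_expansion hn hmodel hφ hindυ hυ₀ hφpos hπ hπpos hπne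
  simp only [← hτ] at hphatexp
  set q : ℕ × Ω → Fin 2 → ℝ :=
    fun x => ratesEstimator φ n (fun s => H s x.2) (fun s => X s x.2) x.1 with hq
  set ρ : ℕ × Ω → ℝ := fun x => (1 - p 0 - p 1) / (1 - q x 0 - q x 1) with hρ
  have hcq : Tendsto (fun x => 1 - q x 0 - q x 1) (whp P) (𝓝 (1 - p 0 - p 1)) :=
    (tendsto_const_nhds.sub (tendsto_pi_nhds.1 hphat 0)).sub (tendsto_pi_nhds.1 hphat 1)
  have hqne : ∀ᶠ x in whp P, 1 - q x 0 - q x 1 ≠ 0 := hcq.eventually_ne hp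
  have hρ1 : Tendsto ρ (whp P) (𝓝 1) := by
    have := (tendsto_const_nhds (x := 1 - p 0 - p 1)).div hcq hp
    rwa [div_self hp] at this
  have hgradlaw : ∀ a k, Tendsto (fun x : ℕ × Ω => (∑ s ∈ Finset.range x.1,
      instrumentedGradient (H s x.2) (X s x.2) (y s x.2) p a k) / x.1 -
        avgE P (fun s ω => instrumentedGradient (H s ω) (X s ω) (y s ω) p a k) x.1) (whp P) (𝓝 0) :=
            fun a k => by
    have := weak_law (hindg a k) (hUIgrad a k)
    exact this
  set F : ℕ × Ω → Matrix (Fin K ⊕ Fin K) (Fin 2) ℝ := fun x => (x.1 : ℝ)⁻¹ • ∑ s ∈ Finset.range x.1,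
    momentGradient (H s x.2) (X s x.2) (y s x.2) (coefficients lam β) p with hF
  have hFlim : Tendsto F (whp P) (𝓝 F₀) := by
    refine tendsto_pi_nhds.2 fun a => tendsto_pi_nhds.2 fun k => ?_
    have h1 := ((hgradlaw a k).const_mul lam).add ((hF₀ a k).comp tendsto_fst_whp)
    rw [mul_zero, zero_add] at h1
    refine h1.congr fun x => ?_
    simp only [hF, Function.comp_apply, momentGradient_eq _ _ _ hp, avgE, Matrix.smul_apply,
      Matrix.sum_apply,
      smul_eq_mul, integral_const_mul, ← Finset.mul_sum]
    ring
  set A : ℕ × Ω → Matrix (Fin K ⊕ Fin K) (Unit ⊕ Fin K) ℝ :=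
    fun x => (x.1 : ℝ)⁻¹ • ∑ s ∈ Finset.range x.1,
    (instruments (H s x.2) (X s x.2)).transpose * regressors (H s x.2) (X s x.2) (y s x.2)
      (q x) with hA
  set B : ℕ × Ω → Matrix (Fin K ⊕ Fin K) (Fin K ⊕ Fin K) ℝ :=
    fun x => (x.1 : ℝ)⁻¹ • ∑ s ∈ Finset.range x.1,
    (instruments (H s x.2) (X s x.2)).transpose * instruments (H s x.2) (X s x.2) with hB
  have hBlim : Tendsto B (whp P) (𝓝 B₀) := by
    refine tendsto_pi_nhds.2 fun a => tendsto_pi_nhds.2 fun b => ?_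
    have h1 := (weak_law (hindZ a b) (hUIZ a b)).add ((hB₀ a b).comp tendsto_fst_whp)
    rw [zero_add] at h1
    refine h1.congr fun x => ?_
    simp only [hB, Function.comp_apply, Matrix.smul_apply, Matrix.sum_apply, smul_eq_mul,
      sub_add_cancel]
    ring
  have hOPgrad : ∀ a k, BoundedInProb P (fun x : ℕ × Ω => (∑ s ∈ Finset.range x.1,
      instrumentedGradient (H s x.2) (X s x.2) (y s x.2) p a k) / x.1) := fun a k => by
    have := boundedInProb_average (hUIgrad a k)
    exact this
  have hAlim : Tendsto A (whp P) (𝓝 A₀) := by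
    refine tendsto_pi_nhds.2 fun a => tendsto_pi_nhds.2 fun b => ?_
    have h1 := (weak_law (hindR a b) (hUIR a b)).add ((hA₀ a b).comp tendsto_fst_whp)
    rw [zero_add] at h1
    have h2 : Tendsto (fun x : ℕ × Ω =>
      Sum.elim (fun _ => (1 : ℝ)) (fun _ => 0) b * (ρ x * ∑ k, (q x - p) k *
        ((∑ s ∈ Finset.range x.1, instrumentedGradient (H s x.2) (X s x.2) (y s x.2) p a k) / x.1)))
            (whp P) (𝓝 0) := by
      have h3 : Tendsto (fun x : ℕ × Ω => ∑ k, (q x - p) k *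
        ((∑ s ∈ Finset.range x.1, instrumentedGradient (H s x.2) (X s x.2) (y s x.2) p a k) / x.1))
            (whp P) (𝓝 (∑ _k : Fin 2, 0)) := by
        refine tendsto_finsetSum _ fun k _ => (hOPgrad a k).zero_mul ?_
        have := (tendsto_pi_nhds.1 hphat k).sub_const (p k)
        rwa [sub_self] at this
      have := (hρ1.mul h3).const_mul (Sum.elim (fun _ => (1 : ℝ)) (fun _ => 0) b)
      simpa using this
    have h4 := h1.add h2
    rw [add_zero] at h4
    refine h4.congr' ?_
    filter_upwards [hqne] with x hx
    have hgrad : ∑ k, (q x - p) k * ((∑ s ∈ Finset.range x.1,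
        instrumentedGradient (H s x.2) (X s x.2) (y s x.2) p a k) / x.1) =
        (x.1 : ℝ)⁻¹ * ∑ s ∈ Finset.range x.1,
          Matrix.mulVec (instrumentedGradient (H s x.2) (X s x.2) (y s x.2) p) (q x - p) a := by
      simp only [Matrix.mulVec, dotProduct]
      rw [Finset.sum_comm, Finset.mul_sum]
      refine Finset.sum_congr rfl fun k _ => ?_
      rw [← Finset.sum_mul]; ring
    simp only [hgrad, hA, Function.comp_apply, Matrix.smul_apply, Matrix.sum_apply, smul_eq_mul,
      sub_add_cancel,
      instruments_mul_regressors_apply _ _ _ hp hx, Finset.sum_add_distrib, ← Finset.mul_sum]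
    simp only [hρ]
    ring
  -- `B₀` is a limit of averaged expected Gram matrices
  have hBps : B₀.PosSemidef := posSemidef_of_tendsto_avgE (P := P)
    (f := fun s ω => (instruments (H s ω) (X s ω)).transpose * instruments (H s ω) (X s ω))
    (fun s a b => memLp_one_iff_integrable.1 ((hUIZ a b).memLp s)) hB₀ fun s ω => by
      have := Matrix.posSemidef_conjTranspose_mul_self (instruments (H s ω) (X s ω))
      rwa [Matrix.conjTranspose_eq_transpose_of_trivial] at this
  obtain ⟨hBdet, hABdet⟩ := isUnit_twoStage (A := A₀) hBps
    (by rw [hrankB]; simp; ring) (by rw [hrankA]; simp; ring)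
  obtain ⟨hMlim, hMunit⟩ := tendsto_twoStage hAlim hBlim hBdet hABdet
  set M₀ := twoStageMatrix A₀ B₀ with hM₀
  have hCLT := tendstoInDistribution_normalized_sum hindκ hUIκ (fun s a => (hcκ s a).mean) hV M₀
  refine tendstoInDistribution_of_tendstoInMeasure_sub _ _ hCLT ?_ fun S => ?_
  swap
  · have h1 : Measurable fun ω =>
      twoStepEstimator φ n (fun s => H s ω) (fun s => X s ω) (fun s => y s ω) S -
        coefficients lam β := (measurable_twoStepEstimator hH hX hy hφ S).sub measurable_const
    have h2 : Continuous fun v : Unit ⊕ Fin K → ℝ => √(S : ℝ) • WithLp.toLp 2 v := by fun_prop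
    exact (h2.measurable.comp h1).aemeasurable
  refine tendstoInMeasure_of_tendsto_whp (c := (0 : EuclideanSpace ℝ (Unit ⊕ Fin K))) ?_
  set T : ℕ × Ω → Fin 2 → ℝ := fun x => (√(x.1 : ℝ))⁻¹ • ∑ s ∈ Finset.range x.1, τ s x.2 with hT
  set κbar : ℕ × Ω → Fin K ⊕ Fin K → ℝ :=
    fun x => (√(x.1 : ℝ))⁻¹ • ∑ s ∈ Finset.range x.1, κ s x.2 with hκbar
  have hGlim : Tendsto (fun x => F₀ - ρ x • F x) (whp P) (𝓝 0) := by
    have := (tendsto_const_nhds (x := F₀)).sub (hρ1.smul hFlim)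
    rwa [one_smul, sub_self] at this
  -- the effect of plugging in the estimated rates is `F₀ T` up to a negligible term
  have hW : Tendsto (fun x => Matrix.mulVec (F₀ - ρ x • F x) (T x) -
      Matrix.mulVec (ρ x • F x) (√(x.1 : ℝ) • (q x - p) - T x)) (whp P) (𝓝 0) := by
    have h1 := tendsto_mulVec_zero_of_boundedInProb hGlim hOPτ
    have h2 := (hρ1.smul hFlim).matrix_mulVec hphatexp
    have := h1.sub h2
    simpa using this
  have hmain : Tendsto (fun x => Matrix.mulVec (twoStageMatrix (A x) (B x) - M₀) (κbar x) +
      Matrix.mulVec (twoStageMatrix (A x) (B x)) (Matrix.mulVec (F₀ - ρ x • F x) (T x) -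
      Matrix.mulVec (ρ x • F x) (√(x.1 : ℝ) • (q x - p) - T x))) (whp P) (𝓝 0) := by
    have h0 : Tendsto (fun x => twoStageMatrix (A x) (B x) - M₀) (whp P) (𝓝 0) := by
      have := hMlim.sub_const M₀
      rwa [sub_self] at this
    have h1 := tendsto_mulVec_zero_of_boundedInProb h0 hOPκ
    have h2 := hMlim.matrix_mulVec hW
    have := h1.add h2
    simpa using this
  have hcont : Tendsto (fun v : Unit ⊕ Fin K → ℝ => WithLp.toLp 2 v) (𝓝 0)
      (𝓝 (0 : EuclideanSpace ℝ (Unit ⊕ Fin K))) := by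
    have : Continuous fun v : Unit ⊕ Fin K → ℝ => WithLp.toLp 2 v := by fun_prop
    exact this.tendsto 0
  refine (hcont.comp hmain).congr' ?_
  have hstr : ∀ᶠ x in whp P, ∀ s, y s x.2 =
      lam • Matrix.mulVec (G s x.2) (y s x.2) + Matrix.mulVec (X s x.2) β + ε s x.2 :=
    eventually_whp_of_ae fun S => ae_all_iff.2 hstruct
  filter_upwards [hqne, hMunit, hstr,
    tendsto_fst_whp.eventually (eventually_gt_atTop 0)] with x hx1 hx2 hx3 hx4
  have hest := adjusted2SLS_sub_eq (n := n) hp hx1 hx3 hx4 (A := A x) (B := B x) rfl rfl hx2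
  simp only [Function.comp_apply, Pi.sub_apply]
  change _ = √(x.1 : ℝ) • WithLp.toLp 2
    (adjusted2SLS n (fun s => H s x.2) (fun s => X s x.2) (fun s => y s x.2) (q x) x.1 -
    coefficients lam β) - WithLp.toLp 2 (Matrix.mulVec M₀ (κbar x))
  rw [hest, ← WithLp.toLp_smul, ← WithLp.toLp_sub, ← Matrix.mulVec_smul]
  congr 1
  have hsqrt : √(x.1 : ℝ) * (x.1 : ℝ)⁻¹ = (√(x.1 : ℝ))⁻¹ := by
    rw [← div_eq_mul_inv, Real.sqrt_div_self]
  have hκsum : κbar x = (√(x.1 : ℝ))⁻¹ • (∑ s ∈ Finset.range x.1,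
      instrumentedError lam p (G s x.2) (H s x.2) (X s x.2) (y s x.2) (ε s x.2)) - Matrix.mulVec F₀
          (T x) := by
    simp only [hκbar, hT, hκ, Finset.sum_sub_distrib, smul_sub]
    rw [Matrix.mulVec_smul, Matrix.mulVec_sum]
  have hsplit : (√(x.1 : ℝ))⁻¹ • (∑ s ∈ Finset.range x.1,
      instrumentedError lam p (G s x.2) (H s x.2) (X s x.2) (y s x.2) (ε s x.2)) =
          κbar x + Matrix.mulVec F₀ (T x) := by
    rw [hκsum]; abel
  have hscore : √(x.1 : ℝ) • ((x.1 : ℝ)⁻¹ • (∑ s ∈ Finset.range x.1,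
      instrumentedError lam p (G s x.2) (H s x.2) (X s x.2) (y s x.2) (ε s x.2)) -
        ρ x • Matrix.mulVec (F x) (q x - p)) = κbar x + Matrix.mulVec F₀ (T x) -
      ρ x • Matrix.mulVec (F x) (√(x.1 : ℝ) • (q x - p)) := by
    rw [smul_sub, smul_smul, hsqrt, hsplit, smul_comm (√(x.1 : ℝ)), Matrix.mulVec_smul (F x)]
  change _ = Matrix.mulVec (twoStageMatrix (A x) (B x)) (√(x.1 : ℝ) • (_ -
    ρ x • Matrix.mulVec (F x) (q x - p))) - Matrix.mulVec M₀ (κbar x)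
  rw [hscore]
  rw [← Matrix.smul_mulVec, Matrix.sub_mulVec, Matrix.sub_mulVec, Matrix.mulVec_sub (ρ x • F x)]
  simp only [Matrix.mulVec_add, Matrix.mulVec_sub]
  abel
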